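/- Let $s\ge 3$ and $\theta\in(0,\infty)$. There is a constant $c=c(s,\theta)\in(0,\infty)$, depending only on $s$ and $\theta$, such that the following holds. Let $M^3$ be a compact smooth manifold without boundary, let $f:M^3\to\mathbb{R}^4$ be a smooth immersion with a smooth unit normal field $\nu$ (so $M$ is orientable), let $g$ be the induced metric, $\mu$ its Riemannian measure, $\nabla$ its Levi-Civita connection and $A$, with components $A_{ij}=-\langle\partial_i\partial_jf,\nu\rangle$, the second fundamental form; norms of tensors are taken with respect to $g$. Let $\gamma=\tilde\gamma\circ f$, where $\tilde\gamma\in C^2(\mathbb{R}^4)$ and $0\le\tilde\gamma\le1$, let $c_{\gamma1}$ be a number with $\|\nabla\gamma\|\le c_{\gamma1}$ on $M$, and write $$[\gamma>0]=\{p\in M:\gamma(p)>0\},\qquad \|A\|_{3,[\gamma>0]}=\Big(\int_{[\gamma>0]}\|A\|^3\,d\mu\Big)^{1/3}.$$ Then all the integrals below are finite and $$\int_M\|A\|^6\gamma^s\,d\mu+\int_M\|A\|^2\|\nabla A\|^2\gamma^s\,d\mu\le\theta\int_M\|\nabla^2A\|^2\gamma^s\,d\mu+c\,\|A\|_{3,[\gamma>0]}^{3/2}\int_M\big(\|\nabla^2A\|^2+\|A\|^6\big)\gamma^s\,d\mu+c\,(c_{\gamma1})^3\Big(\|A\|_{3,[\gamma>0]}^{3}+\|A\|_{3,[\gamma>0]}^{9/2}\Big).$$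 -/

import Mathlib

open MeasureTheory Manifold
open scoped ContDiff

noncomputable section

namespace Hypersurface

/-- Euclidean space `ℝⁿ` with its Euclidean norm and inner product. -/
abbrev Euc (n : ℕ) : Type := EuclideanSpace ℝ (Fin n)

section Local

/-! Local coordinate expressions. Here `F : ℝⁿ → ℝᵐ` is an immersion written in coordinates. -/

variable {n m k : ℕ}

/-- The partial derivative `∂ᵢ h` at `u`. -/
def pderiv {V : Type*} [NormedAddCommGroup V] [NormedSpace ℝ V]
    (i : Fin n) (h : Euc n → V) (u : Euc n) : V :=
  fderiv ℝ h u (EuclideanSpace.single i 1)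

/-- The induced metric `g_ij = ⟨∂ᵢF, ∂ⱼF⟩`. -/
def metric (F : Euc n → Euc m) (u : Euc n) : Matrix (Fin n) (Fin n) ℝ :=
  Matrix.of fun i j => inner ℝ (pderiv i F u) (pderiv j F u)

/-- The Christoffel symbols
`Γ^k_ij = ½ g^{kl} (∂ᵢ g_jl + ∂ⱼ g_il - ∂ₗ g_ij)`. -/
def christoffel (F : Euc n → Euc m) (k i j : Fin n) (u : Euc n) : ℝ :=
  1 / 2 * ∑ l, (metric F u)⁻¹ k l *
    (pderiv i (fun v => metric F v j l) u + pderiv j (fun v => metric F v i l) u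
      - pderiv l (fun v => metric F v i j) u)

/-- The components of a covariant `k`-tensor field in coordinates: one function for every
multi-index `(i₁, …, i_k)`. -/
abbrev Comp (n k : ℕ) : Type := (Fin k → Fin n) → Euc n → ℝ

/-- The covariant derivative of a covariant `k`-tensor field `T`, the new index coming first:
`(∇T)_{j i₁ … i_k} = ∂ⱼ T_{i₁ … i_k} - ∑ₐ Γ^l_{j iₐ} T_{i₁ … l … i_k}`. -/
def covDeriv (F : Euc n → Euc m) (T : Comp n k) : Comp n (k + 1) := fun I u =>
  pderiv (I 0) (T (Fin.tail I)) u
    - ∑ a : Fin k, ∑ l : Fin n,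
        christoffel F l (I 0) (I a.succ) u * T (Function.update (Fin.tail I) a l) u

/-- The iterated covariant derivative `∇_{(j)} T`. -/
def iterCovDeriv (F : Euc n → Euc m) (T : Comp n k) : (j : ℕ) → Comp n (k + j)
  | 0 => T
  | j + 1 => covDeriv F (iterCovDeriv F T j)

/-- The squared norm `‖T‖² = g^{i₁ j₁} ⋯ g^{i_k j_k} T_{i₁ … i_k} T_{j₁ … j_k}` at `u`. -/
def normSq (F : Euc n → Euc m) (T : Comp n k) (u : Euc n) : ℝ :=
  ∑ I : Fin k → Fin n, ∑ J : Fin k → Fin n,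
    (∏ a, (metric F u)⁻¹ (I a) (J a)) * T I u * T J u

/-- The second fundamental form `A_ij = -⟨∂ᵢ∂ⱼF, N⟩` with respect to the normal field `N`. -/
def secondFF (F N : Euc n → Euc m) : Comp n 2 := fun I u =>
  -inner ℝ (pderiv (I 0) (fun v => pderiv (I 1) F v) u) (N u)

end Local

section Global

variable {n m : ℕ} {M : Type*} [TopologicalSpace M] [ChartedSpace (Euc n) M]

/-- A map on `M` written in the preferred chart at `p`. -/
def inChart {V : Type*} (h : M → V) (p : M) : Euc n → V :=
  h ∘ (chartAt (Euc n) p).symm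

/-- `‖∇_{(j)} A‖` at the point `p`, for the map `f` with unit normal field `ν`, computed in the
preferred chart at `p`. -/
def normCovDerivA (f ν : M → Euc m) (j : ℕ) (p : M) : ℝ :=
  Real.sqrt (normSq (inChart (n := n) f p)
    (iterCovDeriv (inChart (n := n) f p) (secondFF (inChart f p) (inChart ν p)) j)
    (chartAt (Euc n) p p))

/-- `‖∇γ‖` at the point `p`, with respect to the metric induced by `f`; in coordinates
`‖∇γ‖² = g^{ij} ∂ᵢγ ∂ⱼγ`. -/
def normGrad (f : M → Euc m) (γ : M → ℝ) (p : M) : ℝ :=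
  Real.sqrt (normSq (inChart (n := n) f p)
    (fun (I : Fin 1 → Fin n) u => pderiv (I 0) (inChart γ p) u) (chartAt (Euc n) p p))

/-- The measure `√(det g) dx` on the domain of the preferred chart at `p`, as a measure on `M`
that vanishes off this domain. -/
def chartVolume [MeasurableSpace M] (f : M → Euc m) (p : M) : Measure M :=
  ((volume.restrict (chartAt (Euc n) p).target).withDensity fun u =>
      ENNReal.ofReal (Real.sqrt (metric (inChart (n := n) f p) u).det)).map
    (chartAt (Euc n) p).symm

/-- The Riemannian measure `μ` of the metric induced by the immersion `f`. The measures
`√(det g) dx` of any two charts agree on the overlap of their domains, and `μ` is the measure glued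
from them: the least measure which dominates all of them, and hence the one whose restriction to
the domain of each chart is `√(det g) dx`. -/
def inducedVolume (n : ℕ) {m : ℕ} {M : Type*} [TopologicalSpace M] [ChartedSpace (Euc n) M]
    [MeasurableSpace M] (f : M → Euc m) : Measure M :=
  ⨆ p : M, chartVolume (n := n) f p

/-- `f : Mⁿ → ℝᵐ` is a smooth immersion. -/
structure IsSmoothImmersion (n : ℕ) {m : ℕ} {M : Type*} [TopologicalSpace M]
    [ChartedSpace (Euc n) M] (f : M → Euc m) : Prop where
  contMDiff : ContMDiff (𝓡 n) (𝓡 m) ∞ f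
  injective_mfderiv : ∀ p, Function.Injective (mfderiv (𝓡 n) (𝓡 m) f p)

/-- `ν` is a smooth unit normal vector field along `f : Mⁿ → ℝᵐ`. -/
structure IsUnitNormal (n : ℕ) {m : ℕ} {M : Type*} [TopologicalSpace M]
    [ChartedSpace (Euc n) M] (f ν : M → Euc m) : Prop where
  contMDiff : ContMDiff (𝓡 n) (𝓡 m) ∞ ν
  norm_eq_one : ∀ p, ‖ν p‖ = 1
  orthogonal : ∀ (p : M) (v : TangentSpace (𝓡 n) p),
    @inner ℝ (Euc m) _ (mfderiv (𝓡 n) (𝓡 m) f p v) (ν p) = 0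

/-- `‖A‖_{q, U} = (∫_U ‖A‖^q dμ)^{1/q}`. -/
def LqNormA (n : ℕ) {m : ℕ} {M : Type*} [TopologicalSpace M] [ChartedSpace (Euc n) M]
    [MeasurableSpace M] (f ν : M → Euc m) (q : ℝ) (U : Set M) : ℝ :=
  (∫ p in U, normCovDerivA (n := n) f ν 0 p ^ q ∂(inducedVolume n f)) ^ (1 / q)

end Global

end Hypersurface

end

open MeasureTheory Manifold
open scoped ContDiff

noncomputable section

set_option linter.unusedSectionVars false

/-! The geometry is moved into functions on M with values in ambient coordinates. Contracting a
coordinate tensor with the dual frame Eⁱ = g^{ij}∂ⱼF turns its norm into a Euclidean sum of squares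
(`normSq_eq_sum_lift`) and ∇ into the tangential gradient of each component followed by projection
to the tangent space (`lift_covDeriv`). The second fundamental form becomes the array of gradients
of the components ν_e (`lift_secondFF`). Iterating this gives `covShape`, and no chart is needed
afterwards.

Integration by parts comes from the tangential operators ν_e ∂_c - ν_c ∂_e. For e ≠ c, √(det g)
times such a derivative of φ is, up to a locally constant sign, the Jacobian determinant of (f_a,
f_b, φ), where a, b are the two remaining coordinates. This is a null Lagrangian, so the integral
over M vanishes (`integral_rot_eq_zero`). The divergence theorem for tangential fields is a
combination of these identities (`integral_divergence_eq_zero`).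

They also give a Sobolev inequality of Michael–Simon type, ∫u^{3/2} ≤ C (∫ |∇u| + u|A|)^{3/2}
(`sobolev_hypersurface`). For each e the measure u ν_e² dμ is projected to ℝ³ along e and mollified.
By the vanishing identity the derivatives of the resulting density have L¹ norm controlled by ∫ |∇u|
+ u|A|, so Gagliardo–Nirenberg–Sobolev in ℝ³ bounds the density in L^{3/2}. Where ν_e ≠ 0 the
projection is a local diffeomorphism with Jacobian |ν_e|, so in the limit the density is at least
u|ν_e|; Fatou's lemma transfers the bound to M, and some |ν_e| is always at least 1/2.

For the estimate itself write κ for the gradient bound of γ, N = ‖A‖_{3,[γ>0]}, X = ∫|∇²A|²γ^s, x³ =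
∫|A|⁶γ^s, y² = ∫|A|²|∇A|²γ^s, j² = ∫|A|⁴γ^{s/3}. The divergence of ⟨A, ∇A⟩|A|²γ^s yields y² ≤ 2εX +
2ε⁻¹x³ + s²κ²j² (`integral_sq_mul_sq_le`). The Sobolev inequality for u = |A|⁴γ^{2s/3} and Hölder
yield x² ≤ C(4yj + sκj² + x²N) and j² ≤ xN². If N is small, x³ is absorbed (`cube_le_of_small`); if
N is bounded below, x³ is at most a constant times N^{3/2}x³ (`exists_cube_le`). The choice of ε
then gives θ (`exists_interpolation_const`). The condition s ≥ 3 leaves enough of the power of γ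
after one differentiation. -/

namespace Hypersurface

/-! ### Tensors in ambient components through the dual frame. -/

section LocalFrame

variable {n m k : ℕ}

/-- The dual frame `Eⁱ = g^{ij} ∂ⱼF`. -/
def coframe (F : Euc n → Euc m) (i : Fin n) (u : Euc n) : Euc m :=
  ∑ j, (metric F u)⁻¹ i j • pderiv j F u

/-- The tangential gradient of a function in coordinates, as a vector of the ambient space. -/
def tgrad (F : Euc n → Euc m) (h : Euc n → ℝ) (u : Euc n) : Euc m :=
  ∑ i, pderiv i h u • coframe F i u

/-- The orthogonal projection onto the tangent space. -/
def tproj (F : Euc n → Euc m) (a b : Fin m) (u : Euc n) : ℝ :=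
  ∑ i, coframe F i u a * pderiv i F u b

/-- The ambient components of a covariant tensor given in coordinates. -/
def lift (F : Euc n → Euc m) (T : Comp n k) (α : Fin k → Fin m) (u : Euc n) : ℝ :=
  ∑ I : Fin k → Fin n, (∏ a, coframe F (I a) u (α a)) * T I u

theorem metric_apply (F : Euc n → Euc m) (u : Euc n) (i j : Fin n) :
    metric F u i j = inner ℝ (pderiv i F u) (pderiv j F u) := rfl

theorem metric_isSymm (F : Euc n → Euc m) (u : Euc n) (i j : Fin n) :
    metric F u i j = metric F u j i := by
  rw [metric_apply, metric_apply, real_inner_comm]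

theorem metric_inv_symm (F : Euc n → Euc m) (u : Euc n) (i j : Fin n) :
    (metric F u)⁻¹ i j = (metric F u)⁻¹ j i := by
  have h : (metric F u).transpose = metric F u := by
    ext i j; exact metric_isSymm F u j i
  have := Matrix.transpose_nonsing_inv (metric F u)
  rw [h] at this
  exact congrFun (congrFun this j) i

theorem inner_coframe_pderiv {F : Euc n → Euc m} {u : Euc n} (hg : IsUnit (metric F u).det)
    (i j : Fin n) : inner ℝ (coframe F i u) (pderiv j F u) = if i = j then 1 else 0 := by
  have h := Matrix.nonsing_inv_mul (metric F u) hg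
  have h2 := congrFun (congrFun h i) j
  rw [Matrix.mul_apply, Matrix.one_apply] at h2
  rw [coframe, sum_inner, ← h2]
  simp [inner_smul_left, metric_apply]

theorem inner_coframe_coframe {F : Euc n → Euc m} {u : Euc n} (hg : IsUnit (metric F u).det)
    (i j : Fin n) : inner ℝ (coframe F i u) (coframe F j u) = (metric F u)⁻¹ i j := by
  conv_lhs => rw [show coframe F j u = ∑ l, (metric F u)⁻¹ j l • pderiv l F u from rfl]
  rw [inner_sum]
  simp [inner_smul_right, inner_coframe_pderiv hg, metric_inv_symm F u i j]

theorem euc_inner (x y : Euc m) : inner ℝ x y = ∑ a, x a * y a := by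
  simp [PiLp.inner_apply, mul_comm]

theorem sum_coframe_mul_pderiv {F : Euc n → Euc m} {u : Euc n} (hg : IsUnit (metric F u).det)
    (i j : Fin n) : ∑ a, coframe F i u a * pderiv j F u a = if i = j then 1 else 0 := by
  rw [← euc_inner, inner_coframe_pderiv hg]

theorem sum_fun_prod {ι : Type*} [Fintype ι] {κ : Type*} [Fintype κ] [DecidableEq ι]
    (f : ι → κ → ℝ) : ∑ α : ι → κ, ∏ a, f a (α a) = ∏ a, ∑ j, f a j := by
  rw [Finset.prod_univ_sum, Fintype.piFinset_univ]

theorem prod_ite_eq_ite {ι κ : Type*} [Fintype ι] [DecidableEq κ] (I J : ι → κ) :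
    (∏ a, if I a = J a then (1 : ℝ) else 0) = if I = J then 1 else 0 := by
  split_ifs with h
  · subst h; simp
  · obtain ⟨a, ha⟩ := Function.ne_iff.1 h
    exact Finset.prod_eq_zero (Finset.mem_univ a) (by simp [ha])

/-- In the expanded square the sum over ambient multi-indices factors over the slots, and each slot
contributes ⟨Eⁱ, Eʲ⟩ = g^{ij}. -/
theorem normSq_eq_sum_lift {F : Euc n → Euc m} {u : Euc n} (hg : IsUnit (metric F u).det)
    (T : Comp n k) : normSq F T u = ∑ α, lift F T α u ^ 2 := by
  have h : ∀ α, lift F T α u ^ 2 = ∑ I : Fin k → Fin n, ∑ J : Fin k → Fin n,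
      (∏ a, coframe F (I a) u (α a) * coframe F (J a) u (α a)) * T I u * T J u := by
    intro α
    rw [lift, sq, Finset.sum_mul_sum]
    refine Finset.sum_congr rfl fun I _ => Finset.sum_congr rfl fun J _ => ?_
    rw [Finset.prod_mul_distrib]; ring
  simp_rw [h, normSq]
  symm
  rw [Finset.sum_comm]
  refine Finset.sum_congr rfl fun I _ => ?_
  rw [Finset.sum_comm]
  refine Finset.sum_congr rfl fun J _ => ?_
  rw [← Finset.sum_mul, ← Finset.sum_mul,
    sum_fun_prod (fun (a : Fin k) (b : Fin m) => coframe F (I a) u b * coframe F (J a) u b)]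
  simp_rw [← euc_inner, inner_coframe_coframe hg]

/-- Duality ⟨Eⁱ, ∂ⱼF⟩ = δᵢⱼ in every slot: the passage to ambient components loses nothing. -/
theorem sum_prod_pderiv_mul_lift {F : Euc n → Euc m} {u : Euc n} (hg : IsUnit (metric F u).det)
    (T : Comp n k) (I : Fin k → Fin n) :
    ∑ α : Fin k → Fin m, (∏ a, pderiv (I a) F u (α a)) * lift F T α u = T I u := by
  simp_rw [lift, Finset.mul_sum]
  rw [Finset.sum_comm]
  have h : ∀ J : Fin k → Fin n, ∑ α : Fin k → Fin m, (∏ a, pderiv (I a) F u (α a)) *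
      ((∏ a, coframe F (J a) u (α a)) * T J u) = (if J = I then 1 else 0) * T J u := by
    intro J
    simp_rw [← mul_assoc, ← Finset.prod_mul_distrib]
    rw [← Finset.sum_mul, sum_fun_prod (fun (a : Fin k) (b : Fin m) => pderiv (I a) F u b * coframe F (J a) u b)]
    simp_rw [mul_comm (pderiv _ F u _), sum_coframe_mul_pderiv hg, prod_ite_eq_ite]
  simp [h]

theorem sum_pderiv_mul_tgrad {F : Euc n → Euc m} {u : Euc n} (hg : IsUnit (metric F u).det)
    (h : Euc n → ℝ) (j : Fin n) : inner ℝ (tgrad F h u) (pderiv j F u) = pderiv j h u := by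
  rw [tgrad, sum_inner]
  simp [inner_smul_left, inner_coframe_pderiv hg]

end LocalFrame

/-! ### Smoothness of the coordinate expressions; tangential Gauss formula. -/

section LocalSmooth

variable {n m k : ℕ} {U : Set (Euc n)} {V : Type*} [NormedAddCommGroup V] [NormedSpace ℝ V]

theorem contDiffOn_pderiv {h : Euc n → V} {l l' : WithTop ℕ∞} (hU : IsOpen U)
    (hh : ContDiffOn ℝ l h U) (hl : l' + 1 ≤ l) (i : Fin n) : ContDiffOn ℝ l' (pderiv i h) U :=
  (hh.fderiv_of_isOpen hU hl).clm_apply contDiffOn_const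

theorem contDiffOn_det {p : ℕ} {A : Euc n → Matrix (Fin p) (Fin p) ℝ} {l : WithTop ℕ∞}
    (hA : ∀ i j, ContDiffOn ℝ l (fun u => A u i j) U) : ContDiffOn ℝ l (fun u => (A u).det) U := by
  simp_rw [Matrix.det_apply']
  exact ContDiffOn.sum fun σ _ => contDiffOn_const.mul (contDiffOn_prod fun i _ => hA _ _)

/-- Cramer's rule expresses the entries of the inverse as quotients of determinants. -/
theorem contDiffOn_inv {p : ℕ} {A : Euc n → Matrix (Fin p) (Fin p) ℝ} {l : WithTop ℕ∞}
    (hA : ∀ i j, ContDiffOn ℝ l (fun u => A u i j) U) (hd : ∀ u ∈ U, IsUnit (A u).det)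
    (i j : Fin p) : ContDiffOn ℝ l (fun u => (A u)⁻¹ i j) U := by
  have h : ∀ u, (A u)⁻¹ i j = (A u).det⁻¹ * ((A u).updateRow j (Pi.single i 1)).det := by
    intro u
    rw [Matrix.inv_def, Matrix.smul_apply, Matrix.adjugate_apply, Ring.inverse_eq_inv', smul_eq_mul]
  simp_rw [h]
  refine ((contDiffOn_det hA).inv fun u hu => (hd u hu).ne_zero).mul (contDiffOn_det fun a b => ?_)
  by_cases hab : a = j
  · subst hab; simp only [Matrix.updateRow_self]; exact contDiffOn_const
  · simp only [Matrix.updateRow_ne hab]; exact hA a b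

/-- `F` is a smooth immersion of the open set `U` in coordinates. -/
structure IsLocalImmersion (F : Euc n → Euc m) (U : Set (Euc n)) : Prop where
  isOpen : IsOpen U
  contDiffOn : ContDiffOn ℝ ∞ F U
  isUnit_det : ∀ u ∈ U, IsUnit (metric F u).det

variable {F : Euc n → Euc m}

theorem infty_add_one_le : (∞ : WithTop ℕ∞) + 1 ≤ ∞ := by
  exact le_of_eq rfl

theorem two_le_infty : (2 : WithTop ℕ∞) ≤ ∞ := by
  exact WithTop.coe_le_coe.2 (le_top : (2 : ℕ∞) ≤ ⊤)

theorem contDiffOn_coord {h : Euc n → Euc m} {l : WithTop ℕ∞} (hh : ContDiffOn ℝ l h U)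
    (a : Fin m) : ContDiffOn ℝ l (fun u => h u a) U :=
  contDiffOn_euclidean.1 hh a

namespace IsLocalImmersion

theorem contDiffOn_pderiv (hF : IsLocalImmersion F U) (i : Fin n) :
    ContDiffOn ℝ ∞ (pderiv i F) U :=
  Hypersurface.contDiffOn_pderiv hF.isOpen hF.contDiffOn infty_add_one_le i

theorem contDiffOn_metric (hF : IsLocalImmersion F U) (i j : Fin n) :
    ContDiffOn ℝ ∞ (fun u => metric F u i j) U :=
  (hF.contDiffOn_pderiv i).inner ℝ (hF.contDiffOn_pderiv j)

theorem contDiffOn_metric_inv (hF : IsLocalImmersion F U) (i j : Fin n) :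
    ContDiffOn ℝ ∞ (fun u => (metric F u)⁻¹ i j) U :=
  contDiffOn_inv hF.contDiffOn_metric hF.isUnit_det i j

theorem contDiffOn_coframe (hF : IsLocalImmersion F U) (i : Fin n) :
    ContDiffOn ℝ ∞ (coframe F i) U :=
  ContDiffOn.sum fun j _ => (hF.contDiffOn_metric_inv i j).smul (hF.contDiffOn_pderiv j)

theorem contDiffOn_tgrad (hF : IsLocalImmersion F U) {h : Euc n → ℝ} {l l' : WithTop ℕ∞}
    (hh : ContDiffOn ℝ l h U) (hl : l' + 1 ≤ l) (hl' : l' ≤ ∞) : ContDiffOn ℝ l' (tgrad F h) U :=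
  ContDiffOn.sum fun i _ => (Hypersurface.contDiffOn_pderiv hF.isOpen hh hl i).smul
    ((hF.contDiffOn_coframe i).of_le hl')

theorem contDiffOn_lift (hF : IsLocalImmersion F U) {T : Comp n k}
    (hT : ∀ I, ContDiffOn ℝ ∞ (T I) U) (α : Fin k → Fin m) : ContDiffOn ℝ ∞ (lift F T α) U :=
  ContDiffOn.sum fun I _ => (contDiffOn_prod fun a _ =>
    contDiffOn_coord (hF.contDiffOn_coframe (I a)) (α a)).mul (hT I)

theorem contDiffOn_christoffel (hF : IsLocalImmersion F U) (l i j : Fin n) :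
    ContDiffOn ℝ ∞ (christoffel F l i j) U := by
  have h : ∀ i j l, ContDiffOn ℝ ∞ (pderiv i fun v => metric F v j l) U := fun i j l =>
    Hypersurface.contDiffOn_pderiv hF.isOpen (hF.contDiffOn_metric j l) infty_add_one_le i
  exact contDiffOn_const.mul (ContDiffOn.sum fun q _ => (hF.contDiffOn_metric_inv l q).mul
    (((h _ _ _).add (h _ _ _)).sub (h _ _ _)))

theorem contDiffOn_covDeriv (hF : IsLocalImmersion F U) {T : Comp n k}
    (hT : ∀ I, ContDiffOn ℝ ∞ (T I) U) (I : Fin (k + 1) → Fin n) :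
    ContDiffOn ℝ ∞ (covDeriv F T I) U :=
  (Hypersurface.contDiffOn_pderiv hF.isOpen (hT _) infty_add_one_le _).sub
    (ContDiffOn.sum fun _ _ => ContDiffOn.sum fun _ _ =>
      (hF.contDiffOn_christoffel _ _ _).mul (hT _))

end IsLocalImmersion

theorem pderiv_inner {F G : Euc n → Euc m} {u : Euc n} (hF : DifferentiableAt ℝ F u)
    (hG : DifferentiableAt ℝ G u) (i : Fin n) :
    pderiv i (fun v => inner ℝ (F v) (G v)) u =
      inner ℝ (F u) (pderiv i G u) + inner ℝ (pderiv i F u) (G u) := by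
  simp only [pderiv]; rw [fderiv_inner_apply ℝ hF hG]

theorem pderiv_coord {G : Euc n → Euc m} {u : Euc n} (hG : DifferentiableAt ℝ G u) (i : Fin n)
    (a : Fin m) : pderiv i (fun v => G v a) u = pderiv i G u a := by
  have h := (((EuclideanSpace.proj a : Euc m →L[ℝ] ℝ).hasFDerivAt).comp u hG.hasFDerivAt).fderiv
  have h2 : (fun v => G v a) = (EuclideanSpace.proj a : Euc m →L[ℝ] ℝ) ∘ G := rfl
  simp only [pderiv]
  rw [h2, h]; rfl

theorem pderiv_comm {V : Type*} [NormedAddCommGroup V] [NormedSpace ℝ V] {G : Euc n → V}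
    {u : Euc n} (hG : ContDiffAt ℝ 2 G u) (i j : Fin n) :
    pderiv i (pderiv j G) u = pderiv j (pderiv i G) u := by
  have hd : DifferentiableAt ℝ (fderiv ℝ G) u :=
    (hG.fderiv_right (m := 1) (by norm_num)).differentiableAt (by norm_num)
  have h : ∀ i j : Fin n, pderiv i (pderiv j G) u =
      fderiv ℝ (fderiv ℝ G) u (EuclideanSpace.single i 1) (EuclideanSpace.single j 1) := by
    intro i j
    have h2 : HasFDerivAt (pderiv j G) _ u :=
      hd.hasFDerivAt.clm_apply (hasFDerivAt_const (EuclideanSpace.single j (1:ℝ)) u)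
    rw [show pderiv i (pderiv j G) u = fderiv ℝ (pderiv j G) u (EuclideanSpace.single i 1) from rfl,
      h2.fderiv]
    simp
  rw [h, h]
  exact (hG.isSymmSndFDerivAt (by simp)) _ _

/-- The tangential part of the Gauss formula: `⟨Eᵏ, ∂ᵢ∂ⱼF⟩ = Γ^k_ij`. -/
theorem inner_coframe_pderiv_pderiv (hF : IsLocalImmersion F U) {u : Euc n} (hu : u ∈ U)
    (l i j : Fin n) :
    inner ℝ (coframe F l u) (pderiv i (pderiv j F) u) = christoffel F l i j u := by
  have hN : U ∈ nhds u := hF.isOpen.mem_nhds hu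
  have hd : ∀ j, DifferentiableAt ℝ (pderiv j F) u := fun j =>
    ((hF.contDiffOn_pderiv j).contDiffAt hN).differentiableAt (by simp)
  have hc : ∀ i j, pderiv i (pderiv j F) u = pderiv j (pderiv i F) u := fun i j =>
    pderiv_comm ((hF.contDiffOn.contDiffAt hN).of_le two_le_infty) i j
  have hm : ∀ i j l, pderiv i (fun v => metric F v j l) u =
      inner ℝ (pderiv j F u) (pderiv i (pderiv l F) u)
        + inner ℝ (pderiv i (pderiv j F) u) (pderiv l F u) := fun i j l =>
    pderiv_inner (hd j) (hd l) i
  rw [coframe, sum_inner, christoffel, Finset.mul_sum]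
  -- Term by term in the index contracted with g^{-1}: after symmetrising second derivatives, ∂ᵢg_jq
  -- + ∂ⱼg_iq - ∂_q g_ij = 2⟨∂_qF, ∂ᵢ∂ⱼF⟩.
  refine Finset.sum_congr rfl fun q _ => ?_
  rw [inner_smul_left, hm, hm, hm, hc j i, hc q i, hc q j,
    real_inner_comm (pderiv i (pderiv j F) u) (pderiv q F u),
    real_inner_comm (pderiv i (pderiv q F) u) (pderiv j F u)]
  simp only [conj_trivial]
  ring

end LocalSmooth

/-! ### Covariant differentiation in ambient components. -/

section LiftDeriv

variable {n m k : ℕ} {U : Set (Euc n)} {F : Euc n → Euc m}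

theorem pderiv_mul {f g : Euc n → ℝ} {u : Euc n} (hf : DifferentiableAt ℝ f u)
    (hg : DifferentiableAt ℝ g u) (i : Fin n) :
    pderiv i (fun v => f v * g v) u = f u * pderiv i g u + pderiv i f u * g u := by
  simp only [pderiv]; rw [fderiv_fun_mul hf hg]; simp [mul_comm]

theorem pderiv_sum {ι : Type*} {s : Finset ι} {f : ι → Euc n → ℝ} {u : Euc n}
    (hf : ∀ a ∈ s, DifferentiableAt ℝ (f a) u) (i : Fin n) :
    pderiv i (fun v => ∑ a ∈ s, f a v) u = ∑ a ∈ s, pderiv i (f a) u := by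
  simp only [pderiv]; rw [fderiv_fun_sum hf]; simp

theorem pderiv_prod {ι : Type*} [DecidableEq ι] {s : Finset ι} {f : ι → Euc n → ℝ} {u : Euc n}
    (hf : ∀ a ∈ s, DifferentiableAt ℝ (f a) u) (i : Fin n) :
    pderiv i (fun v => ∏ a ∈ s, f a v) u =
      ∑ a ∈ s, (∏ b ∈ s.erase a, f b u) * pderiv i (f a) u := by
  simp only [pderiv]
  rw [(HasFDerivAt.finsetProd fun a ha => (hf a ha).hasFDerivAt).fderiv]
  simp

theorem pderiv_congr {V : Type*} [NormedAddCommGroup V] [NormedSpace ℝ V] {f g : Euc n → V}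
    {u : Euc n} (h : f =ᶠ[nhds u] g) (i : Fin n) : pderiv i f u = pderiv i g u := by
  simp only [pderiv]; rw [h.fderiv_eq]

theorem tgrad_congr {f g : Euc n → ℝ} {u : Euc n} (h : f =ᶠ[nhds u] g) :
    tgrad F f u = tgrad F g u := by
  simp only [tgrad, pderiv_congr h]

theorem sum_prod_mul_lift (X : Fin k → Euc m) (T : Comp n k) (u : Euc n) :
    ∑ α : Fin k → Fin m, (∏ b, X b (α b)) * lift F T α u =
      ∑ J : Fin k → Fin n, (∏ b, inner ℝ (X b) (coframe F (J b) u)) * T J u := by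
  simp_rw [lift, Finset.mul_sum]
  rw [Finset.sum_comm]
  refine Finset.sum_congr rfl fun J _ => ?_
  simp_rw [← mul_assoc, ← Finset.prod_mul_distrib]
  rw [← Finset.sum_mul, sum_fun_prod (fun (a : Fin k) (b : Fin m) => X a b * coframe F (J a) u b)]
  simp_rw [euc_inner]

theorem prod_update_eq {W : Type*} (X : Fin k → W) (a : Fin k) (w : W) (φ : Fin k → W → ℝ) :
    ∏ b, φ b (Function.update X a w b) = φ a w * ∏ b ∈ Finset.univ.erase a, φ b (X b) := by
  rw [← Finset.mul_prod_erase _ _ (Finset.mem_univ a), Function.update_self]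
  congr 1
  refine Finset.prod_congr rfl fun b hb => ?_
  rw [Function.update_of_ne (Finset.ne_of_mem_erase hb)]

/-- A vector w of the ambient space put into one slot is seen only through its components ⟨Eˡ, w⟩.
With w = ∂ᵢ∂ⱼF these are the Christoffel symbols. -/
theorem sum_prod_update_mul_lift {u : Euc n} (hg : IsUnit (metric F u).det) (T : Comp n k)
    (I : Fin k → Fin n) (a : Fin k) (w : Euc m) :
    ∑ α : Fin k → Fin m, ((∏ b ∈ Finset.univ.erase a, pderiv (I b) F u (α b)) * w (α a)) *
        lift F T α u
      = ∑ l, inner ℝ (coframe F l u) w * T (Function.update I a l) u := by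
  have h1 : ∀ (w : Euc m) (α : Fin k → Fin m),
      (∏ b ∈ Finset.univ.erase a, pderiv (I b) F u (α b)) * w (α a) =
        ∏ b, Function.update (fun b => pderiv (I b) F u) a w b (α b) := by
    intro w α
    rw [prod_update_eq (fun b => pderiv (I b) F u) a w (fun b x => x (α b)), mul_comm]
  have h2 : ∀ l, T (Function.update I a l) u = ∑ α : Fin k → Fin m,
      (∏ b, Function.update (fun b => pderiv (I b) F u) a (pderiv l F u) b (α b)) *
        lift F T α u := by
    intro l
    rw [← sum_prod_pderiv_mul_lift hg T]
    refine Finset.sum_congr rfl fun α _ => ?_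
    congr 1
    refine Finset.prod_congr rfl fun b _ => ?_
    by_cases hb : b = a
    · subst hb; simp
    · simp [Function.update_of_ne hb]
  simp_rw [h1, h2, sum_prod_mul_lift]
  simp_rw [Finset.mul_sum]
  rw [Finset.sum_comm]
  refine Finset.sum_congr rfl fun J _ => ?_
  simp_rw [prod_update_eq _ a _ (fun b x => inner ℝ x (coframe F (J b) u)),
    real_inner_comm (coframe F (J a) u) (pderiv _ F u), inner_coframe_pderiv hg]
  simp only [ite_mul, one_mul, zero_mul, mul_ite, mul_zero, Finset.sum_ite_eq, Finset.mem_univ,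
    if_true]
  rw [real_inner_comm]; ring

/-- The Leibniz rule applied to T_I = ∏ ∂F · lift T. The terms in which a factor ∂F is
differentiated are, by the Gauss formula, exactly the Christoffel terms of ∇T, and they cancel. -/
theorem covDeriv_eq_sum_pderiv_lift (hF : IsLocalImmersion F U) {u : Euc n} (hu : u ∈ U)
    {T : Comp n k} (hT : ∀ I, ContDiffOn ℝ ∞ (T I) U) (J : Fin (k + 1) → Fin n) :
    covDeriv F T J u = ∑ α : Fin k → Fin m,
      (∏ a, pderiv (J a.succ) F u (α a)) * pderiv (J 0) (lift F T α) u := by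
  have hN : U ∈ nhds u := hF.isOpen.mem_nhds hu
  have hdP : ∀ i, DifferentiableAt ℝ (pderiv i F) u := fun i =>
    ((hF.contDiffOn_pderiv i).contDiffAt hN).differentiableAt (by simp)
  have hdc : ∀ i a, DifferentiableAt ℝ (fun v => pderiv i F v a) u := fun i a =>
    ((contDiffOn_coord (hF.contDiffOn_pderiv i) a).contDiffAt hN).differentiableAt (by simp)
  have hdL : ∀ α, DifferentiableAt ℝ (lift F T α) u := fun α =>
    ((hF.contDiffOn_lift hT α).contDiffAt hN).differentiableAt (by simp)
  have hdQ : ∀ α : Fin k → Fin m,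
      DifferentiableAt ℝ (fun v => ∏ a, pderiv (J (Fin.succ a)) F v (α a)) u := fun α =>
    (HasFDerivAt.finsetProd fun a _ => (hdc (J (Fin.succ a)) (α a)).hasFDerivAt).differentiableAt
  have h1 : T (Fin.tail J) =ᶠ[nhds u] fun v => ∑ α : Fin k → Fin m,
      (∏ a, pderiv (J (Fin.succ a)) F v (α a)) * lift F T α v := by
    filter_upwards [hN] with v hv
    rw [← sum_prod_pderiv_mul_lift (hF.isUnit_det v hv) T]; rfl
  rw [covDeriv, pderiv_congr h1, pderiv_sum fun α _ => (hdQ α).fun_mul (hdL α)]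
  simp_rw [fun α => pderiv_mul (hdQ α) (hdL α) (J 0), pderiv_prod fun a _ => hdc _ _,
    fun i a => pderiv_coord (hdP i) (J 0) a]
  rw [Finset.sum_add_distrib, add_sub_assoc, add_eq_left, sub_eq_zero]
  simp_rw [Finset.sum_mul]
  rw [Finset.sum_comm]
  refine Finset.sum_congr rfl fun a _ => ?_
  refine (sum_prod_update_mul_lift (hF.isUnit_det u hu) T (Fin.tail J) a
    (pderiv (J 0) (pderiv (J a.succ) F) u)).trans ?_
  simp_rw [inner_coframe_pderiv_pderiv hF hu]

theorem sum_fin_succ_fun {κ : Type*} [Fintype κ] (φ : (Fin (k + 1) → κ) → ℝ) :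
    ∑ J, φ J = ∑ j, ∑ I : Fin k → κ, φ (Fin.cons j I) := by
  rw [← Fintype.sum_prod_type', ← (Fin.consEquiv fun _ => κ).sum_comp]
  rfl

theorem tgrad_apply (h : Euc n → ℝ) (u : Euc n) (a : Fin m) :
    tgrad F h u a = ∑ i, pderiv i h u * coframe F i u a := by
  simp [tgrad]

/-- This is the form of ∇ used from here on: Christoffel symbols disappear, and only the projection
∑ Eⁱ ⊗ ∂ᵢF of the old slots is left. -/
theorem lift_covDeriv (hF : IsLocalImmersion F U) {u : Euc n} (hu : u ∈ U)
    {T : Comp n k} (hT : ∀ I, ContDiffOn ℝ ∞ (T I) U) (α : Fin (k + 1) → Fin m) :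
    lift F (covDeriv F T) α u = ∑ β : Fin k → Fin m,
      (∏ a, tproj F (α a.succ) (β a) u) * tgrad F (lift F T β) u (α 0) := by
  rw [lift, sum_fin_succ_fun]
  simp_rw [covDeriv_eq_sum_pderiv_lift hF hu hT, Fin.prod_univ_succ, Fin.cons_zero, Fin.cons_succ,
    Finset.mul_sum]
  have : ∀ β : Fin k → Fin m, (∏ a, tproj F (α a.succ) (β a) u) * tgrad F (lift F T β) u (α 0) =
      ∑ j, ∑ I : Fin k → Fin n, coframe F j u (α 0) * (∏ a, coframe F (I a) u (α a.succ)) *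
        ((∏ a, pderiv (I a) F u (β a)) * pderiv j (lift F T β) u) := by
    intro β
    simp_rw [tproj, tgrad_apply]
    rw [← sum_fun_prod (fun (a : Fin k) (i : Fin n) => coframe F i u (α a.succ) * pderiv i F u (β a)),
      Finset.sum_mul_sum, Finset.sum_comm]
    refine Finset.sum_congr rfl fun j _ => Finset.sum_congr rfl fun I _ => ?_
    rw [Finset.prod_mul_distrib]; ring
  simp_rw [this]
  symm
  rw [Finset.sum_comm]
  refine Finset.sum_congr rfl fun j _ => ?_
  rw [Finset.sum_comm]

end LiftDeriv

/-! ### Hypersurfaces of ℝ⁴ with a unit normal, in coordinates. -/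

section Normal

/-- `N` is a smooth unit normal field of the immersion `F` of `U` in coordinates. -/
structure IsLocalNormal (F N : Euc 3 → Euc 4) (U : Set (Euc 3)) : Prop where
  contDiffOn : ContDiffOn ℝ ∞ N U
  norm_eq_one : ∀ u ∈ U, ‖N u‖ = 1
  orthogonal : ∀ u ∈ U, ∀ i, inner ℝ (pderiv i F u) (N u) = 0

variable {F N : Euc 3 → Euc 4} {U : Set (Euc 3)} {u : Euc 3}

/-- The matrices with rows (∂ᵢF, N) and columns (Eⁱ, N) are square because 3 + 1 = 4, so the
one-sided inverse relation given by duality is two-sided; the other side is the completeness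
relation. -/
theorem tproj_eq (hF : IsLocalImmersion F U) (hN : IsLocalNormal F N U) (hu : u ∈ U)
    (a b : Fin 4) : tproj F a b u = (if a = b then 1 else 0) - N u a * N u b := by
  have hg := hF.isUnit_det u hu
  let B : Matrix (Fin 3 ⊕ Unit) (Fin 4) ℝ := Matrix.of fun x a =>
    Sum.elim (fun i => pderiv i F u a) (fun _ => N u a) x
  let C : Matrix (Fin 4) (Fin 3 ⊕ Unit) ℝ := Matrix.of fun a x =>
    Sum.elim (fun i => coframe F i u a) (fun _ => N u a) x
  have hNN : inner ℝ (N u) (N u) = (1 : ℝ) := by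
    rw [real_inner_self_eq_norm_sq, hN.norm_eq_one u hu]; norm_num
  have hNE : ∀ i, inner ℝ (coframe F i u) (N u) = (0 : ℝ) := by
    intro i
    rw [coframe, sum_inner]
    simp [inner_smul_left, hN.orthogonal u hu]
  have hBC : B * C = 1 := by
    ext x y
    rw [Matrix.mul_apply]
    rcases x with i | _ <;> rcases y with j | _
    · simp only [B, C, Matrix.of_apply, Sum.elim_inl]
      rw [← euc_inner, real_inner_comm, inner_coframe_pderiv hg, Matrix.one_apply]
      simp [eq_comm]
    · simp only [B, C, Matrix.of_apply, Sum.elim_inl, Sum.elim_inr]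
      rw [← euc_inner, hN.orthogonal u hu]; simp
    · simp only [B, C, Matrix.of_apply, Sum.elim_inl, Sum.elim_inr]
      rw [← euc_inner, real_inner_comm, hNE]; simp
    · simp only [B, C, Matrix.of_apply, Sum.elim_inr]
      rw [← euc_inner, hNN]; simp
  have hCB : C * B = 1 :=
    (Matrix.mul_eq_one_comm_of_card_eq (Fin 3 ⊕ Unit) (Fin 4) ℝ (by simp)).1 hBC
  have h := congrFun (congrFun hCB a) b
  rw [Matrix.mul_apply, Fintype.sum_sum_type, Matrix.one_apply] at h
  simp only [B, C, Matrix.of_apply, Sum.elim_inl, Sum.elim_inr, Finset.univ_unique,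
    Finset.sum_const, Finset.card_singleton, one_smul] at h
  rw [tproj, ← h]; ring

theorem eq_sum_inner_pderiv_coframe (hF : IsLocalImmersion F U) (hN : IsLocalNormal F N U)
    (hu : u ∈ U) {w : Euc 4} (hw : inner ℝ w (N u) = 0) (a : Fin 4) :
    w a = ∑ i, inner ℝ w (pderiv i F u) * coframe F i u a := by
  have h : ∑ b, tproj F a b u * w b = w a := by
    simp_rw [tproj_eq hF hN hu, sub_mul, Finset.sum_sub_distrib]
    rw [euc_inner] at hw
    have : ∑ b, N u a * N u b * w b = N u a * ∑ b, w b * N u b := by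
      rw [Finset.mul_sum]; exact Finset.sum_congr rfl fun b _ => by ring
    rw [this, hw]; simp
  rw [← h]
  simp_rw [tproj, euc_inner, Finset.sum_mul]
  rw [Finset.sum_comm]
  exact Finset.sum_congr rfl fun i _ => Finset.sum_congr rfl fun b _ => by ring

theorem inner_tgrad_normal (hN : IsLocalNormal F N U) (hu : u ∈ U) (h : Euc 3 → ℝ) :
    inner ℝ (tgrad F h u) (N u) = 0 := by
  simp [tgrad, coframe, sum_inner, inner_smul_left, hN.orthogonal u hu]

/-- The tangential gradient is the only tangential vector which represents `dh`. -/
theorem eq_tgrad (hF : IsLocalImmersion F U) (hN : IsLocalNormal F N U) (hu : u ∈ U)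
    {w : Euc 4} (hw : inner ℝ w (N u) = 0) {h : Euc 3 → ℝ}
    (hwh : ∀ i, inner ℝ w (pderiv i F u) = pderiv i h u) : w = tgrad F h u := by
  ext a
  rw [eq_sum_inner_pderiv_coframe hF hN hu hw, tgrad_apply]
  simp_rw [hwh]

/-- Weingarten's equation. Differentiating ⟨∂ⱼF, N⟩ = 0 gives A_ij = ⟨∂ᵢN, ∂ⱼF⟩, and ∂ᵢN is
tangential since |N| = 1. -/
theorem lift_secondFF (hF : IsLocalImmersion F U) (hN : IsLocalNormal F N U) (hu : u ∈ U)
    (α : Fin 2 → Fin 4) :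
    lift F (secondFF F N) α u = tgrad F (fun v => N v (α 1)) u (α 0) := by
  have hU : U ∈ nhds u := hF.isOpen.mem_nhds hu
  have hNd : DifferentiableAt ℝ N u := (hN.contDiffOn.contDiffAt hU).differentiableAt (by simp)
  have hFd : ∀ j, DifferentiableAt ℝ (pderiv j F) u := fun j =>
    ((hF.contDiffOn_pderiv j).contDiffAt hU).differentiableAt (by simp)
  have h0 : ∀ i, inner ℝ (pderiv i N u) (N u) = (0 : ℝ) := by
    intro i
    have h1 : (fun v => inner ℝ (N v) (N v)) =ᶠ[nhds u] fun _ => (1 : ℝ) := by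
      filter_upwards [hU] with v hv
      rw [real_inner_self_eq_norm_sq, hN.norm_eq_one v hv]; norm_num
    have h2 := pderiv_congr h1 i
    rw [pderiv_inner hNd hNd, real_inner_comm] at h2
    simp only [pderiv, fderiv_fun_const] at h2 ⊢
    simp at h2
    linarith
  have h1 : ∀ i j, -inner ℝ (pderiv i (fun v => pderiv j F v) u) (N u) =
      (inner ℝ (pderiv i N u) (pderiv j F u) : ℝ) := by
    intro i j
    have h1 : (fun v => inner ℝ (pderiv j F v) (N v)) =ᶠ[nhds u] fun _ => (0 : ℝ) := by
      filter_upwards [hU] with v hv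
      exact hN.orthogonal v hv j
    have h2 := pderiv_congr h1 i
    rw [pderiv_inner (hFd j) hNd] at h2
    have h3 : pderiv i (fun _ : Euc 3 => (0 : ℝ)) u = 0 := by simp [pderiv]
    rw [h3, real_inner_comm] at h2
    linarith
  rw [lift, sum_fin_succ_fun, tgrad_apply]
  refine Finset.sum_congr rfl fun i _ => ?_
  rw [pderiv_coord hNd, eq_sum_inner_pderiv_coframe hF hN hu (h0 i), sum_fin_succ_fun,
    Finset.sum_mul]
  refine Finset.sum_congr rfl fun j _ => ?_
  rw [Fintype.sum_unique]
  simp only [secondFF, Fin.prod_univ_two, Fin.cons_zero, Fin.cons_one]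
  rw [h1]; ring

end Normal

/-- A kernel vector x of the Gram matrix satisfies |dF(x)|² = 0. -/
theorem isUnit_det_metric {n m : ℕ} {F : Euc n → Euc m} {u : Euc n}
    (h : Function.Injective (fderiv ℝ F u)) : IsUnit (metric F u).det := by
  rw [isUnit_iff_ne_zero]
  intro h0
  obtain ⟨x, hx, hx0⟩ := Matrix.exists_mulVec_eq_zero_iff.2 h0
  have hs : ∀ y : Fin n → ℝ, fderiv ℝ F u (WithLp.toLp 2 y) = ∑ i, y i • pderiv i F u := by
    intro y
    have : (WithLp.toLp 2 y : Euc n) = ∑ i, y i • EuclideanSpace.single i (1 : ℝ) := by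
      ext a; simp [Finset.sum_apply, Pi.single_apply]
    rw [this, map_sum]; simp [pderiv]
  have h1 : inner ℝ (fderiv ℝ F u (WithLp.toLp 2 x)) (fderiv ℝ F u (WithLp.toLp 2 x)) = (0 : ℝ) := by
    rw [hs x, sum_inner]
    refine Finset.sum_eq_zero fun i _ => ?_
    have := congrFun hx0 i
    rw [Matrix.mulVec, dotProduct] at this
    rw [inner_smul_left, inner_sum]
    simp_rw [inner_smul_right]
    have h2 : ∑ j, x j * inner ℝ (pderiv i F u) (pderiv j F u) = (0 : ℝ) := by
      rw [← this.trans (Pi.zero_apply i)]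
      exact Finset.sum_congr rfl fun j _ => by rw [metric_apply]; ring
    rw [h2, mul_zero]
  have h2 : fderiv ℝ F u (WithLp.toLp 2 x) = 0 := inner_self_eq_zero.1 h1
  have h3 : (WithLp.toLp 2 x : Euc n) = 0 := h (by rw [h2, map_zero])
  exact hx (by simpa using congrArg WithLp.ofLp h3)

/-! ### Changes between preferred charts. -/

section Transition

variable {M : Type*} [TopologicalSpace M] [ChartedSpace (Euc 3) M]

/-- `h` is of class `Cˡ` in every preferred chart. -/
def ChartContDiff {V : Type*} [NormedAddCommGroup V] [NormedSpace ℝ V] (l : WithTop ℕ∞)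
    (h : M → V) : Prop :=
  ∀ p, ContDiffOn ℝ l (inChart (n := 3) h p) (chartAt (Euc 3) p).target

/-- The coordinate change from the preferred chart at `p` to the one at `q`. -/
def transition (p q : M) : Euc 3 → Euc 3 := chartAt (Euc 3) q ∘ (chartAt (Euc 3) p).symm

/-- The domain of the coordinate change. -/
def overlap (p q : M) : Set (Euc 3) :=
  (chartAt (Euc 3) p).target ∩ (chartAt (Euc 3) p).symm ⁻¹' (chartAt (Euc 3) q).source

theorem isOpen_overlap (p q : M) : IsOpen (overlap p q) :=
  (chartAt (Euc 3) p).isOpen_inter_preimage_symm (chartAt (Euc 3) q).open_source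

theorem inChart_transition {V : Type*} (h : M → V) {p q : M} {v : Euc 3} (hv : v ∈ overlap p q) :
    inChart (n := 3) h p v = inChart (n := 3) h q (transition p q v) := by
  simp [inChart, transition, (chartAt (Euc 3) q).left_inv hv.2]

theorem transition_mem {p q : M} {v : Euc 3} (hv : v ∈ overlap p q) :
    transition p q v ∈ overlap q p := by
  refine ⟨(chartAt (Euc 3) q).map_source hv.2, ?_⟩
  simp only [transition, Set.mem_preimage, Function.comp_apply, (chartAt (Euc 3) q).left_inv hv.2]
  exact (chartAt (Euc 3) p).map_target hv.1

theorem transition_transition {p q : M} {v : Euc 3} (hv : v ∈ overlap p q) :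
    transition q p (transition p q v) = v := by
  simp [transition, (chartAt (Euc 3) q).left_inv hv.2, (chartAt (Euc 3) p).right_inv hv.1]

theorem mem_overlap {p q : M} {v : Euc 3} (hv : v ∈ (chartAt (Euc 3) p).target)
    (hq : q = (chartAt (Euc 3) p).symm v) : v ∈ overlap p q ∧
      transition p q v = chartAt (Euc 3) q q := by
  subst hq
  exact ⟨⟨hv, mem_chart_source _ _⟩, rfl⟩

theorem ChartContDiff.differentiableAt {V : Type*} [NormedAddCommGroup V] [NormedSpace ℝ V]
    {l : WithTop ℕ∞} {h : M → V} (hh : ChartContDiff l h) (hl : 1 ≤ l) {p : M} {v : Euc 3}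
    (hv : v ∈ (chartAt (Euc 3) p).target) : DifferentiableAt ℝ (inChart (n := 3) h p) v :=
  ((hh p).contDiffAt ((chartAt (Euc 3) p).open_target.mem_nhds hv)).differentiableAt
    (by rintro rfl; simp at hl)

theorem mfderiv_eq_fderiv_inChart {m : ℕ} {h : M → Euc m} (hh : ContMDiff (𝓡 3) (𝓡 m) ∞ h)
    (q : M) : (mfderiv (𝓡 3) (𝓡 m) h q : Euc 3 →L[ℝ] Euc m) =
      fderiv ℝ (inChart (n := 3) h q) (chartAt (Euc 3) q q) := by
  have hd : MDifferentiableAt (𝓡 3) (𝓡 m) h q := (hh q).mdifferentiableAt (by simp)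
  refine hd.mfderiv.trans ?_
  simp only [writtenInExtChartAt, extChartAt, mfld_simps]
  rw [fderivWithin_univ]
  rfl

variable [IsManifold (𝓡 3) ∞ M]

theorem ContMDiff.chartContDiff {V : Type*} [NormedAddCommGroup V] [NormedSpace ℝ V] {h : M → V}
    {l : WithTop ℕ∞} (hl : l ≤ ∞) (hh : ContMDiff (𝓡 3) 𝓘(ℝ, V) l h) : ChartContDiff l h := by
  intro p
  have : ContMDiffOn (𝓡 3) 𝓘(ℝ, V) l (h ∘ (chartAt (Euc 3) p).symm) (chartAt (Euc 3) p).target :=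
    hh.comp_contMDiffOn (contMDiffOn_chart_symm.of_le hl)
  exact contMDiffOn_iff_contDiffOn.1 this

theorem contDiffOn_transition (p q : M) : ContDiffOn ℝ ∞ (transition p q) (overlap p q) := by
  rw [← contMDiffOn_iff_contDiffOn]
  exact (contMDiffOn_chart (I := 𝓡 3) (n := ∞) (x := q)).comp
    ((contMDiffOn_chart_symm (I := 𝓡 3) (n := ∞) (x := p)).mono Set.inter_subset_left)
    fun v hv => hv.2

theorem hasFDerivAt_transition {p q : M} {v : Euc 3} (hv : v ∈ overlap p q) :
    HasFDerivAt (transition p q) (fderiv ℝ (transition p q) v) v :=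
  (((contDiffOn_transition p q).contDiffAt ((isOpen_overlap p q).mem_nhds hv)).differentiableAt
    (by simp)).hasFDerivAt

theorem fderiv_transition_comp {p q : M} {v : Euc 3} (hv : v ∈ overlap p q) :
    (fderiv ℝ (transition q p) (transition p q v)).comp (fderiv ℝ (transition p q) v) =
      ContinuousLinearMap.id ℝ (Euc 3) := by
  have h1 := (hasFDerivAt_transition (transition_mem hv)).comp v (hasFDerivAt_transition hv)
  have h2 : transition q p ∘ transition p q =ᶠ[nhds v] id := by
    filter_upwards [(isOpen_overlap p q).mem_nhds hv] with w hw
    exact transition_transition hw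
  rw [← h1.fderiv, h2.fderiv_eq, fderiv_id]

theorem fderiv_inChart {V : Type*} [NormedAddCommGroup V] [NormedSpace ℝ V] {h : M → V}
    {p q : M} {v : Euc 3} (hv : v ∈ overlap p q)
    (hd : DifferentiableAt ℝ (inChart (n := 3) h q) (transition p q v)) :
    fderiv ℝ (inChart (n := 3) h p) v =
      (fderiv ℝ (inChart (n := 3) h q) (transition p q v)).comp (fderiv ℝ (transition p q) v) := by
  have h1 := hd.hasFDerivAt.comp v (hasFDerivAt_transition hv)
  have h2 : inChart (n := 3) h p =ᶠ[nhds v] inChart (n := 3) h q ∘ transition p q := by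
    filter_upwards [(isOpen_overlap p q).mem_nhds hv] with w hw
    exact inChart_transition h hw
  rw [h2.fderiv_eq, h1.fderiv]

variable {f ν : M → Euc 4}

theorem IsSmoothImmersion.isLocalImmersion (hf : IsSmoothImmersion 3 f) (p : M) :
    IsLocalImmersion (inChart (n := 3) f p) (chartAt (Euc 3) p).target where
  isOpen := (chartAt (Euc 3) p).open_target
  contDiffOn := ContMDiff.chartContDiff le_rfl hf.contMDiff p
  isUnit_det := by
    intro v hv
    apply isUnit_det_metric
    -- The derivative of f on the manifold is taken in the preferred chart at the point itself, so
    -- at a general v one passes from the chart at p to the preferred chart at the point with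
    -- coordinates v.
    obtain ⟨ho, ht⟩ := mem_overlap hv rfl
    have hC := ContMDiff.chartContDiff le_rfl hf.contMDiff
    rw [fderiv_inChart ho (hC.differentiableAt (by simp) (transition_mem ho).1), ht,
      ← mfderiv_eq_fderiv_inChart hf.contMDiff]
    refine (hf.injective_mfderiv _).comp ?_
    have := fderiv_transition_comp ho
    exact Function.LeftInverse.injective
      (g := fderiv ℝ (transition ((chartAt (Euc 3) p).symm v) p) (transition p _ v))
      fun x => by
        have := DFunLike.congr_fun this x
        simpa using this

theorem IsUnitNormal.isLocalNormal (hf : IsSmoothImmersion 3 f) (hν : IsUnitNormal 3 f ν) (p : M) :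
    IsLocalNormal (inChart (n := 3) f p) (inChart (n := 3) ν p) (chartAt (Euc 3) p).target where
  contDiffOn := ContMDiff.chartContDiff le_rfl hν.contMDiff p
  norm_eq_one v _ := hν.norm_eq_one _
  orthogonal := by
    intro v hv i
    obtain ⟨ho, ht⟩ := mem_overlap hv rfl
    have hC := ContMDiff.chartContDiff le_rfl hf.contMDiff
    rw [pderiv, fderiv_inChart ho (hC.differentiableAt (by simp) (transition_mem ho).1), ht,
      ← mfderiv_eq_fderiv_inChart hf.contMDiff]
    exact hν.orthogonal _ _

end Transition

/-! ### The gradient as a globally defined ambient vector field. -/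

section Grad

variable {M : Type*} [TopologicalSpace M] [ChartedSpace (Euc 3) M]

/-- The gradient of a function on the hypersurface, as a vector of the ambient space. -/
def grad (f : M → Euc 4) (h : M → ℝ) (q : M) : Euc 4 :=
  tgrad (inChart (n := 3) f q) (inChart (n := 3) h q) (chartAt (Euc 3) q q)

theorem inner_eq_fderiv {F : Euc 3 → Euc 4} {u : Euc 3} {h : Euc 3 → ℝ} {w : Euc 4}
    (hwh : ∀ i, inner ℝ w (pderiv i F u) = pderiv i h u) (x : Euc 3) :
    inner ℝ w (fderiv ℝ F u x) = fderiv ℝ h u x := by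
  have hx : x = ∑ i, x i • EuclideanSpace.single i (1 : ℝ) := by
    ext a; simp [Finset.sum_apply, Pi.single_apply]
  rw [hx, map_sum, map_sum, inner_sum]
  refine Finset.sum_congr rfl fun i _ => ?_
  rw [map_smul, map_smul, inner_smul_right, smul_eq_mul, ← pderiv, ← pderiv, hwh]

variable [IsManifold (𝓡 3) ∞ M] {f ν : M → Euc 4}

theorem inner_grad_normal (hf : IsSmoothImmersion 3 f) (hν : IsUnitNormal 3 f ν) (h : M → ℝ)
    (q : M) : inner ℝ (grad f h q) (ν q) = 0 := by
  have := inner_tgrad_normal (hν.isLocalNormal hf q) (mem_chart_target (Euc 3) q)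
    (F := inChart (n := 3) f q) (inChart (n := 3) h q)
  rwa [show inChart (n := 3) ν q (chartAt (Euc 3) q q) = ν q by
    simp [inChart, (chartAt (Euc 3) q).left_inv (mem_chart_source _ q)]] at this

/-- Independence of the chart: `grad` uses a different chart at every point, but being tangential
and representing dh determine the vector. -/
theorem inChart_grad (hf : IsSmoothImmersion 3 f) (hν : IsUnitNormal 3 f ν) {h : M → ℝ}
    (hh : ChartContDiff 1 h) (p : M) {v : Euc 3} (hv : v ∈ (chartAt (Euc 3) p).target) :
    inChart (n := 3) (grad f h) p v = tgrad (inChart (n := 3) f p) (inChart (n := 3) h p) v := by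
  obtain ⟨ho, ht⟩ := mem_overlap hv rfl
  have hC := ContMDiff.chartContDiff le_rfl hf.contMDiff
  refine eq_tgrad (hf.isLocalImmersion p) (hν.isLocalNormal hf p) hv ?_ fun i => ?_
  · exact inner_grad_normal hf hν h _
  · rw [pderiv, fderiv_inChart ho (hC.differentiableAt (by simp) (transition_mem ho).1), pderiv,
      fderiv_inChart ho (hh.differentiableAt (by simp) (transition_mem ho).1), ht]
    refine inner_eq_fderiv (fun j => ?_) _
    exact sum_pderiv_mul_tgrad ((hf.isLocalImmersion _).isUnit_det _ (mem_chart_target _ _)) _ j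

theorem ChartContDiff.grad (hf : IsSmoothImmersion 3 f) (hν : IsUnitNormal 3 f ν) {h : M → ℝ}
    {l l' : WithTop ℕ∞} (hh : ChartContDiff l h) (hl : l' + 1 ≤ l) (hl' : l' ≤ ∞) :
    ChartContDiff l' (grad f h) := by
  intro p
  have h1 : ChartContDiff 1 h := fun p => (hh p).of_le (le_trans le_add_self hl)
  refine ((hf.isLocalImmersion p).contDiffOn_tgrad (hh p) hl hl').congr fun v hv => ?_
  exact inChart_grad hf hν h1 p hv

end Grad

/-! ### Calculus rules for the gradient. -/

section Rules

variable {M : Type*} [TopologicalSpace M] [ChartedSpace (Euc 3) M] {f : M → Euc 4}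

theorem grad_mul {h k : M → ℝ} (hh : ChartContDiff 1 h) (hk : ChartContDiff 1 k) (q : M) :
    grad f (fun x => h x * k x) q = h q • grad f k q + k q • grad f h q := by
  have hv := mem_chart_target (Euc 3) q
  have h1 := fun i => pderiv_mul (((hh q).contDiffAt
    ((chartAt (Euc 3) q).open_target.mem_nhds hv)).differentiableAt one_ne_zero)
    (((hk q).contDiffAt
    ((chartAt (Euc 3) q).open_target.mem_nhds hv)).differentiableAt one_ne_zero) i
  have h2 : ∀ h : M → ℝ, inChart (n := 3) h q (chartAt (Euc 3) q q) = h q := fun h => by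
    simp [inChart, (chartAt (Euc 3) q).left_inv (mem_chart_source _ q)]
  have h3 : (inChart (n := 3) (fun x => h x * k x) q) =
    fun v => inChart (n := 3) h q v * inChart (n := 3) k q v := rfl
  simp only [grad, tgrad, h3, h1, h2, Finset.smul_sum, ← Finset.sum_add_distrib, add_smul, mul_smul]
  refine Finset.sum_congr rfl fun i _ => ?_
  rw [smul_comm (k q)]

theorem grad_sum {ι : Type*} {s : Finset ι} {h : ι → M → ℝ} (hh : ∀ i ∈ s, ChartContDiff 1 (h i))
    (q : M) : grad f (fun x => ∑ i ∈ s, h i x) q = ∑ i ∈ s, grad f (h i) q := by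
  have hv := mem_chart_target (Euc 3) q
  have h3 : (inChart (n := 3) (fun x => ∑ i ∈ s, h i x) q) =
    fun v => ∑ i ∈ s, inChart (n := 3) (h i) q v := rfl
  simp only [grad, tgrad, h3]
  rw [Finset.sum_comm]
  refine Finset.sum_congr rfl fun j _ => ?_
  rw [pderiv_sum, Finset.sum_smul]
  exact fun i hi => (((hh i hi q).contDiffAt
    ((chartAt (Euc 3) q).open_target.mem_nhds hv)).differentiableAt one_ne_zero)

theorem grad_const (c : ℝ) (q : M) : grad f (fun _ : M => c) q = 0 := by
  have h3 : (inChart (n := 3) (fun _ : M => c) q) = fun _ => c := rfl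
  simp [grad, tgrad, h3, pderiv]

theorem grad_comp {φ : ℝ → ℝ} {h : M → ℝ} (hh : ChartContDiff 1 h) {φ' : ℝ} {q : M}
    (hφ : HasDerivAt φ φ' (h q)) : grad f (fun x => φ (h x)) q = φ' • grad f h q := by
  have hv := mem_chart_target (Euc 3) q
  have h3 : (inChart (n := 3) (fun x => φ (h x)) q) = φ ∘ inChart (n := 3) h q := rfl
  have hd := (((hh q).contDiffAt
    ((chartAt (Euc 3) q).open_target.mem_nhds hv)).differentiableAt one_ne_zero).hasFDerivAt
  have h2 : inChart (n := 3) h q (chartAt (Euc 3) q q) = h q := by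
    simp [inChart, (chartAt (Euc 3) q).left_inv (mem_chart_source _ q)]
  rw [← h2] at hφ
  have h4 := hφ.comp_hasFDerivAt _ hd
  simp only [grad, tgrad, h3, Finset.smul_sum, pderiv, h4.fderiv]
  refine Finset.sum_congr rfl fun i _ => ?_
  simp [mul_smul]

end Rules

/-! ### Gram determinants and the Riemannian measure in charts. -/

theorem det_clm_eq (L : Euc 3 →L[ℝ] Euc 3) :
    L.det = (Matrix.of fun i j => L (EuclideanSpace.single j 1) i).det := by
  rw [ContinuousLinearMap.det, ← LinearMap.det_toMatrix (EuclideanSpace.basisFun (Fin 3) ℝ).toBasis]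
  congr 1

theorem det_gram {F : Euc 3 → Euc 4} {u : Euc 3} : 0 ≤ (metric F u).det := by
  have : (metric F u).PosSemidef := by
    refine Matrix.PosSemidef.of_dotProduct_mulVec_nonneg ?_ fun x => ?_
    · ext i j; simp [metric_isSymm F u i j]
    · have h : star x ⬝ᵥ (metric F u).mulVec x =
          inner ℝ (∑ i, x i • pderiv i F u) (∑ i, x i • pderiv i F u) := by
        simp only [dotProduct, Matrix.mulVec, star_trivial, sum_inner, inner_sum, inner_smul_left,
          inner_smul_right, metric_apply, conj_trivial, Finset.mul_sum]
        exact Finset.sum_congr rfl fun i _ => Finset.sum_congr rfl fun j _ => by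
          rw [real_inner_comm (pderiv j F u) (pderiv i F u)]; ring
      rw [h]; exact real_inner_self_nonneg
  exact this.det_nonneg

/-- The Gram matrices are related by g_F = Lᵀ g_G L. This is the transformation law that makes √(det
g) dx chart independent. -/
theorem det_metric_comp {F G : Euc 3 → Euc 4} {u v : Euc 3} {L : Euc 3 →L[ℝ] Euc 3}
    (h : fderiv ℝ F u = (fderiv ℝ G v).comp L) :
    Real.sqrt (metric F u).det = |L.det| * Real.sqrt (metric G v).det := by
  set D : Matrix (Fin 3) (Fin 3) ℝ := Matrix.of fun i j => L (EuclideanSpace.single j 1) i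
  have hp : ∀ j, pderiv j F u = ∑ i, D i j • pderiv i G v := by
    intro j
    rw [pderiv, h, ContinuousLinearMap.comp_apply]
    have hx : L (EuclideanSpace.single j 1) = ∑ i, D i j • EuclideanSpace.single i (1 : ℝ) := by
      ext a; simp [D, Finset.sum_apply, Pi.single_apply]
    rw [hx, map_sum]; simp [pderiv]
  have h2 : metric F u = D.transpose * metric G v * D := by
    ext i j
    rw [metric_apply, hp, hp, sum_inner, Matrix.mul_apply]
    simp_rw [inner_sum, Matrix.mul_apply, Finset.sum_mul, inner_smul_left, inner_smul_right,
      Matrix.transpose_apply, metric_apply, conj_trivial]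
    rw [Finset.sum_comm]
    exact Finset.sum_congr rfl fun i _ => Finset.sum_congr rfl fun j _ => by ring
  rw [h2, Matrix.det_mul, Matrix.det_mul, Matrix.det_transpose, det_clm_eq]
  rw [show D.det * (metric G v).det * D.det = D.det ^ 2 * (metric G v).det by ring,
    Real.sqrt_mul (sq_nonneg _), Real.sqrt_sq_eq_abs]

section Volume

variable {M : Type*} [TopologicalSpace M] [ChartedSpace (Euc 3) M] {f : M → Euc 4}

/-- The density `√(det g)` in the preferred chart at `p`. -/
def density (f : M → Euc 4) (p : M) (u : Euc 3) : ℝ :=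
  Real.sqrt (metric (inChart (n := 3) f p) u).det

theorem density_nonneg (f : M → Euc 4) (p : M) (u : Euc 3) : 0 ≤ density f p u := Real.sqrt_nonneg _

theorem measurableSet_chart_target (p : M) : MeasurableSet (chartAt (Euc 3) p).target :=
  (chartAt (Euc 3) p).open_target.measurableSet

theorem measurableSet_inter_chart_symm [MeasurableSpace M] [BorelSpace M] (p : M) {S : Set M}
    (hS : MeasurableSet S) :
    MeasurableSet ((chartAt (Euc 3) p).target ∩ (chartAt (Euc 3) p).symm ⁻¹' S) := by
  classical
  have h : Measurable ((chartAt (Euc 3) p).target.piecewise (chartAt (Euc 3) p).symm fun _ => p) :=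
    (chartAt (Euc 3) p).continuousOn_symm.measurable_piecewise continuousOn_const
      (measurableSet_chart_target p)
  convert (measurableSet_chart_target p).inter (h hS) using 1
  ext v
  simp only [Set.mem_inter_iff, Set.mem_preimage]
  refine and_congr_right fun hv => ?_
  rw [Set.piecewise_eq_of_mem _ _ _ hv]

theorem aemeasurable_chart_symm [MeasurableSpace M] [BorelSpace M] (p : M) (φ : Euc 3 → ENNReal) :
    AEMeasurable (chartAt (Euc 3) p).symm
      ((volume.restrict (chartAt (Euc 3) p).target).withDensity φ) :=
  ((chartAt (Euc 3) p).continuousOn_symm.aemeasurable (measurableSet_chart_target p)).mono_ac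
    (withDensity_absolutelyContinuous _ _)

theorem chartVolume_le_inducedVolume [MeasurableSpace M] (p : M) :
    chartVolume (n := 3) f p ≤ inducedVolume 3 f :=
  le_iSup (fun p => chartVolume (n := 3) f p) p

variable [IsManifold (𝓡 3) ∞ M]

theorem continuousOn_density (hf : IsSmoothImmersion 3 f) (p : M) :
    ContinuousOn (density f p) (chartAt (Euc 3) p).target :=
  Real.continuous_sqrt.comp_continuousOn
    (contDiffOn_det (hf.isLocalImmersion p).contDiffOn_metric).continuousOn

theorem aemeasurable_density (hf : IsSmoothImmersion 3 f) (p : M) :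
    AEMeasurable (density f p) (volume.restrict (chartAt (Euc 3) p).target) :=
  (continuousOn_density hf p).aemeasurable (measurableSet_chart_target p)

variable [MeasurableSpace M] [BorelSpace M]

theorem lintegral_chartVolume (hf : IsSmoothImmersion 3 f) (p : M) {h : M → ENNReal}
    (hh : Measurable h) : ∫⁻ x, h x ∂chartVolume (n := 3) f p =
      ∫⁻ v in (chartAt (Euc 3) p).target,
        ENNReal.ofReal (density f p v) * h ((chartAt (Euc 3) p).symm v) := by
  rw [chartVolume, lintegral_map' hh.aemeasurable (aemeasurable_chart_symm p _)]
  exact lintegral_withDensity_eq_lintegral_mul₀ (aemeasurable_density hf p).ennreal_ofReal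
    (hh.comp_aemeasurable
      ((chartAt (Euc 3) p).continuousOn_symm.aemeasurable (measurableSet_chart_target p)))

theorem chartVolume_apply (hf : IsSmoothImmersion 3 f) (p : M) {S : Set M}
    (hS : MeasurableSet S) : chartVolume (n := 3) f p S =
      ∫⁻ v in (chartAt (Euc 3) p).target ∩ (chartAt (Euc 3) p).symm ⁻¹' S,
        ENNReal.ofReal (density f p v) := by
  rw [← lintegral_indicator_one hS, lintegral_chartVolume hf p (measurable_one.indicator hS),
    ← lintegral_indicator (measurableSet_chart_target p),
    ← lintegral_indicator (measurableSet_inter_chart_symm p hS)]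
  congr 1
  ext v
  by_cases hv : v ∈ (chartAt (Euc 3) p).target <;>
  by_cases hv' : (chartAt (Euc 3) p).symm v ∈ S <;> simp [Set.indicator, hv, hv']

theorem chartVolume_eq_of_subset (hf : IsSmoothImmersion 3 f) (p q : M) {S : Set M}
    (hS : MeasurableSet S) (hp : S ⊆ (chartAt (Euc 3) p).source)
    (hq : S ⊆ (chartAt (Euc 3) q).source) :
    chartVolume (n := 3) f p S = chartVolume (n := 3) f q S := by
  rw [chartVolume_apply hf p hS, chartVolume_apply hf q hS]
  set Ap := (chartAt (Euc 3) p).target ∩ (chartAt (Euc 3) p).symm ⁻¹' S with hAp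
  have hsub : Ap ⊆ overlap p q := fun v hv => ⟨hv.1, hq hv.2⟩
  have him : (chartAt (Euc 3) q).target ∩ (chartAt (Euc 3) q).symm ⁻¹' S =
      transition p q '' Ap := by
    ext w
    constructor
    · intro hw
      have hwo : w ∈ overlap q p := ⟨hw.1, hp hw.2⟩
      refine ⟨transition q p w, ⟨(transition_mem hwo).1, ?_⟩, transition_transition hwo⟩
      simp only [transition, Set.mem_preimage, Function.comp_apply,
        (chartAt (Euc 3) p).left_inv hwo.2]
      exact hw.2
    · rintro ⟨v, hv, rfl⟩
      refine ⟨(transition_mem (hsub hv)).1, ?_⟩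
      simp only [transition, Set.mem_preimage, Function.comp_apply,
        (chartAt (Euc 3) q).left_inv (hsub hv).2]
      exact hv.2
  rw [him, lintegral_image_eq_lintegral_abs_det_fderiv_mul volume
    (measurableSet_inter_chart_symm p hS)
    (fun v hv => (hasFDerivAt_transition (hsub hv)).hasFDerivWithinAt)]
  · refine setLIntegral_congr_fun (measurableSet_inter_chart_symm p hS) fun v hv => ?_
    have hC := ContMDiff.chartContDiff le_rfl hf.contMDiff
    beta_reduce
    rw [density, det_metric_comp (fderiv_inChart (hsub hv)
      (hC.differentiableAt (by simp) (transition_mem (hsub hv)).1)),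
      ENNReal.ofReal_mul (abs_nonneg _)]
    rfl
  · intro v hv w hw hvw
    rw [← transition_transition (hsub hv), hvw, transition_transition (hsub hw)]

theorem chartVolume_inter_source (hf : IsSmoothImmersion 3 f) (p : M) {S : Set M}
    (hS : MeasurableSet S) :
    chartVolume (n := 3) f p (S ∩ (chartAt (Euc 3) p).source) = chartVolume (n := 3) f p S := by
  rw [chartVolume_apply hf p hS,
    chartVolume_apply hf p (hS.inter (chartAt (Euc 3) p).open_source.measurableSet)]
  congr 2
  ext v
  simp only [Set.mem_inter_iff, Set.mem_preimage]
  exact ⟨fun h => ⟨h.1, h.2.1⟩, fun h => ⟨h.1, h.2, (chartAt (Euc 3) p).map_target h.1⟩⟩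

/-- For the upper bound on the supremum, a measure is glued from finitely many disjoint chart
pieces. It dominates every chart measure and equals the one at p on the domain of that chart. -/
theorem inducedVolume_apply_of_subset [CompactSpace M] (hf : IsSmoothImmersion 3 f) (p : M)
    {S : Set M} (hS : MeasurableSet S) (hp : S ⊆ (chartAt (Euc 3) p).source) :
    inducedVolume 3 f S = chartVolume (n := 3) f p S := by
  obtain ⟨t, ht⟩ := CompactSpace.elim_nhds_subcover (fun x : M => (chartAt (Euc 3) x).source)
    fun x => (chartAt (Euc 3) x).open_source.mem_nhds (mem_chart_source _ x)
  obtain ⟨g, hg⟩ := (t.finite_toSet.insert p).countable.exists_eq_range ⟨p, Set.mem_insert _ _⟩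
  -- The chart at p comes first, so its disjointed piece is its whole domain and all other pieces
  -- miss S.
  let c : ℕ → M := fun i => Nat.casesOn i p g
  let s : ℕ → Set M := fun i => (chartAt (Euc 3) (c i)).source
  have hs : ∀ i, MeasurableSet (s i) := fun i => (chartAt (Euc 3) (c i)).open_source.measurableSet
  have hD : ∀ i, MeasurableSet (disjointed s i) := MeasurableSet.disjointed hs
  have hcov : ⋃ i, disjointed s i = Set.univ := by
    rw [iUnion_disjointed, Set.eq_univ_iff_forall]
    intro x
    have hx : x ∈ ⋃ y ∈ t, (chartAt (Euc 3) y).source := by rw [ht]; trivial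
    simp only [Set.mem_iUnion] at hx ⊢
    obtain ⟨y, hy, hxy⟩ := hx
    have : y ∈ Set.range g := by rw [← hg]; exact Set.mem_insert_of_mem _ hy
    obtain ⟨i, rfl⟩ := this
    exact ⟨i + 1, hxy⟩
  let μ' : Measure M := Measure.sum fun i => (chartVolume (n := 3) f (c i)).restrict (disjointed s i)
  have hle : inducedVolume 3 f ≤ μ' := by
    refine iSup_le fun q => Measure.le_iff.2 fun S hS => ?_
    have h1 : S = ⋃ i, S ∩ disjointed s i := by rw [← Set.inter_iUnion, hcov, Set.inter_univ]
    conv_lhs => rw [h1]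
    refine (measure_iUnion_le _).trans ?_
    rw [Measure.sum_apply _ hS]
    refine ENNReal.tsum_le_tsum fun i => ?_
    have hSi := hS.inter (hD i)
    rw [Measure.restrict_apply hS, ← chartVolume_inter_source hf q hSi,
      chartVolume_eq_of_subset hf q (c i)
        (hSi.inter (chartAt (Euc 3) q).open_source.measurableSet) Set.inter_subset_right
        (fun x hx => disjointed_subset s i hx.1.2)]
    exact measure_mono Set.inter_subset_left
  refine le_antisymm ?_ (chartVolume_le_inducedVolume p S)
  refine (hle S).trans ?_
  rw [Measure.sum_apply _ hS, tsum_eq_single 0]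
  · rw [Measure.restrict_apply hS]
    exact measure_mono Set.inter_subset_left
  · intro i hi
    rw [Measure.restrict_apply hS]
    have : S ∩ disjointed s i = ∅ := by
      rw [← Set.disjoint_iff_inter_eq_empty]
      refine Set.disjoint_of_subset_left hp ?_
      have := disjoint_disjointed s (Ne.symm hi)
      rw [Function.onFun, disjointed_zero] at this
      exact this
    rw [this, measure_empty]

theorem inducedVolume_restrict_source [CompactSpace M] (hf : IsSmoothImmersion 3 f) (p : M) :
    (inducedVolume 3 f).restrict (chartAt (Euc 3) p).source = chartVolume (n := 3) f p := by
  ext S hS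
  rw [Measure.restrict_apply hS, inducedVolume_apply_of_subset hf p
    (hS.inter (chartAt (Euc 3) p).open_source.measurableSet) Set.inter_subset_right,
    chartVolume_inter_source hf p hS]

/-- Local finiteness suffices on a compact space, and the density is bounded on compact subsets of a
chart. Every continuous function is then integrable. -/
theorem isFiniteMeasure_inducedVolume [CompactSpace M] [T2Space M] (hf : IsSmoothImmersion 3 f) :
    IsFiniteMeasure (inducedVolume 3 f) := by
  have : IsLocallyFiniteMeasure (inducedVolume 3 f) := by
    refine ⟨fun p => ?_⟩
    obtain ⟨K, hK, hKt, hKc⟩ := local_compact_nhds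
      ((chartAt (Euc 3) p).open_target.mem_nhds (mem_chart_target (Euc 3) p))
    have hKs : (chartAt (Euc 3) p).symm '' K ⊆ (chartAt (Euc 3) p).source := by
      rintro _ ⟨v, hv, rfl⟩; exact (chartAt (Euc 3) p).map_target (hKt hv)
    have hc : IsCompact ((chartAt (Euc 3) p).symm '' K) :=
      hKc.image_of_continuousOn ((chartAt (Euc 3) p).continuousOn_symm.mono hKt)
    refine ⟨(chartAt (Euc 3) p).symm '' K, ?_, ?_⟩
    · have := (chartAt (Euc 3) p).symm.image_mem_nhds (mem_chart_target (Euc 3) p) hK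
      rwa [(chartAt (Euc 3) p).left_inv (mem_chart_source _ p)] at this
    · rw [inducedVolume_apply_of_subset hf p hc.measurableSet hKs,
        chartVolume_apply hf p hc.measurableSet]
      have hsub : (chartAt (Euc 3) p).target ∩
          (chartAt (Euc 3) p).symm ⁻¹' ((chartAt (Euc 3) p).symm '' K) ⊆ K := by
        rintro v ⟨hv, w, hw, hvw⟩
        rwa [← (chartAt (Euc 3) p).symm.injOn (hKt hw) hv hvw]
      refine (lintegral_mono_set hsub).trans_lt ?_
      have hi : IntegrableOn (density f p) K :=
        ((continuousOn_density hf p).mono hKt).integrableOn_compact hKc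
      exact hi.lintegral_lt_top
  infer_instance

theorem integral_inducedVolume [CompactSpace M] (hf : IsSmoothImmersion 3 f) (p : M) {h : M → ℝ}
    (hh : Measurable h) (hs : ∀ x, x ∉ (chartAt (Euc 3) p).source → h x = 0) :
    ∫ x, h x ∂inducedVolume 3 f =
      ∫ v in (chartAt (Euc 3) p).target, density f p v * h ((chartAt (Euc 3) p).symm v) := by
  rw [← setIntegral_eq_integral_of_forall_compl_eq_zero hs, inducedVolume_restrict_source hf,
    chartVolume, integral_map (aemeasurable_chart_symm p _) hh.aestronglyMeasurable]
  have h1 := integral_withDensity_eq_integral_smul₀ (aemeasurable_density hf p).real_toNNReal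
    fun v => h ((chartAt (Euc 3) p).symm v)
  refine h1.trans (integral_congr_ae (Filter.Eventually.of_forall fun v => ?_))
  simp only [NNReal.smul_def, smul_eq_mul, Real.coe_toNNReal _ (density_nonneg f p v)]

end Volume
-- Determinants of frames completed by the normal.
/-- The determinant of the matrix with rows `X₀, X₁, X₂, N`. -/
def frameDet (X : Fin 3 → Euc 4) (N : Euc 4) : ℝ :=
  (Matrix.of fun i a => (Fin.snoc (α := fun _ => Euc 4) X N : Fin 4 → Euc 4) i a).det

/-- The product of one matrix with the transpose of the other has the inner products as entries. Its
last column is (0, 0, 0, 1), so expansion leaves the 3 × 3 block; Y need not be orthogonal to N. -/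
theorem frameDet_mul_frameDet {X Y : Fin 3 → Euc 4} {N : Euc 4} (hN : ‖N‖ = 1)
    (hX : ∀ i, inner ℝ (X i) N = 0) :
    frameDet X N * frameDet Y N = (Matrix.of fun i j => inner ℝ (X i) (Y j)).det := by
  rw [frameDet, frameDet, ← Matrix.det_transpose (Matrix.of fun i a =>
    (Fin.snoc (α := fun _ => Euc 4) Y N : Fin 4 → Euc 4) i a), ← Matrix.det_mul]
  have h : ∀ i j, (Matrix.of (fun i a => (Fin.snoc (α := fun _ => Euc 4) X N : Fin 4 → Euc 4) i a) *
      (Matrix.of fun i a => (Fin.snoc (α := fun _ => Euc 4) Y N : Fin 4 → Euc 4) i a).transpose) i j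
      = inner ℝ ((Fin.snoc (α := fun _ => Euc 4) X N : Fin 4 → Euc 4) i)
        ((Fin.snoc (α := fun _ => Euc 4) Y N : Fin 4 → Euc 4) j) := fun i j => by
    rw [Matrix.mul_apply, euc_inner]; rfl
  rw [Matrix.det_succ_column _ (Fin.last 3), Fin.sum_univ_castSucc]
  simp only [h, Fin.snoc_castSucc, Fin.snoc_last, hX, real_inner_self_eq_norm_sq, hN]
  simp only [mul_zero, zero_mul, Finset.sum_const_zero, zero_add, one_pow, mul_one]
  rw [Even.neg_one_pow ⟨_, rfl⟩, one_mul]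
  congr 1
  ext i j
  rw [Matrix.submatrix_apply, Fin.succAbove_last, h, Fin.snoc_castSucc, Fin.snoc_castSucc]
  rfl

theorem frameDet_eq_det (x y z N : Euc 4) : frameDet ![x, y, z] N =
    Matrix.det !![x 0, x 1, x 2, x 3; y 0, y 1, y 2, y 3; z 0, z 1, z 2, z 3;
      N 0, N 1, N 2, N 3] := by
  rw [frameDet]
  congr 1
  ext i j
  fin_cases i <;> fin_cases j <;> rfl

/-- Here a, b are the two coordinates other than e, c. Thus a rotational derivative in the (e, c)
plane is a determinant containing two constant vectors. -/
theorem exists_frameDet_eq {e c : Fin 4} (hec : e ≠ c) : ∃ (a b : Fin 4) (s : ℝ), s ^ 2 = 1 ∧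
    ∀ w N : Euc 4, frameDet ![EuclideanSpace.single a 1, EuclideanSpace.single b 1, w] N =
      s * (N e * w c - N c * w e) := by
  simp only [frameDet_eq_det]
  wlog h : e < c generalizing e c
  · obtain ⟨a, b, s, hs, h2⟩ := this hec.symm (lt_of_le_of_ne (not_lt.1 h) hec.symm)
    refine ⟨a, b, -s, by simpa using hs, fun w N => ?_⟩
    rw [h2]; ring
  have hs : (2 : Fin 4).succAbove 2 = 3 := rfl
  have hs' : (1 : Fin 4).succAbove 2 = 3 := rfl
  fin_cases e <;> fin_cases c <;> first | (exfalso; revert h; decide) | skip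
  · refine ⟨2, 3, -1, by norm_num, fun w N => ?_⟩
    simp [Matrix.det_succ_row_zero, Fin.sum_univ_succ, hs, hs']; ring
  · refine ⟨1, 3, 1, by norm_num, fun w N => ?_⟩
    simp [Matrix.det_succ_row_zero, Fin.sum_univ_succ, hs, hs']; ring
  · refine ⟨1, 2, -1, by norm_num, fun w N => ?_⟩
    simp [Matrix.det_succ_row_zero, Fin.sum_univ_succ, hs, hs']; ring
  · refine ⟨0, 3, -1, by norm_num, fun w N => ?_⟩
    simp [Matrix.det_succ_row_zero, Fin.sum_univ_succ, hs, hs']; ring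
  · refine ⟨0, 2, 1, by norm_num, fun w N => ?_⟩
    simp [Matrix.det_succ_row_zero, Fin.sum_univ_succ, hs, hs']; ring
  · refine ⟨0, 1, -1, by norm_num, fun w N => ?_⟩
    simp [Matrix.det_succ_row_zero, Fin.sum_univ_succ, hs, hs']; ring

/-! ### The Jacobian determinant as a null Lagrangian. -/

section NullLagrangian

variable {U : Set (Euc 3)}

/-- The cofactor `∂ⱼα ∂ₖβ - ∂ₖα ∂ⱼβ` of `∂ᵢψ` in the Jacobian determinant of `(α, β, ψ)`. -/
def cofactor (α β : Euc 3 → ℝ) (i : Fin 3) (u : Euc 3) : ℝ :=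
  pderiv (i + 1) α u * pderiv (i + 2) β u - pderiv (i + 2) α u * pderiv (i + 1) β u

theorem det_eq_sum_cofactor (α β ψ : Euc 3 → ℝ) (u : Euc 3) :
    (Matrix.of fun i j => ![pderiv i α u, pderiv i β u, pderiv i ψ u] j).det =
      ∑ i, cofactor α β i u * pderiv i ψ u := by
  have h1 : (1 : Fin 3) + 1 = 2 := rfl
  have h2 : (1 : Fin 3) + 2 = 0 := rfl
  have h3 : (2 : Fin 3) + 1 = 0 := rfl
  have h4 : (2 : Fin 3) + 2 = 1 := rfl
  rw [Matrix.det_fin_three, Fin.sum_univ_three]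
  simp [cofactor, h1, h2, h3, h4]
  ring

theorem contDiffOn_cofactor (hU : IsOpen U) {α β : Euc 3 → ℝ} (hα : ContDiffOn ℝ ∞ α U)
    (hβ : ContDiffOn ℝ ∞ β U) (i : Fin 3) : ContDiffOn ℝ ∞ (cofactor α β i) U :=
  ((contDiffOn_pderiv hU hα infty_add_one_le _).mul
    (contDiffOn_pderiv hU hβ infty_add_one_le _)).sub
    ((contDiffOn_pderiv hU hα infty_add_one_le _).mul
    (contDiffOn_pderiv hU hβ infty_add_one_le _))

/-- The Piola identity: mixed second derivatives cancel in pairs. -/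
theorem sum_pderiv_cofactor (hU : IsOpen U) {α β : Euc 3 → ℝ} (hα : ContDiffOn ℝ ∞ α U)
    (hβ : ContDiffOn ℝ ∞ β U) {u : Euc 3} (hu : u ∈ U) :
    ∑ i, pderiv i (cofactor α β i) u = 0 := by
  have hd : ∀ {α : Euc 3 → ℝ}, ContDiffOn ℝ ∞ α U → ∀ i, DifferentiableAt ℝ (pderiv i α) u :=
    fun hα i => ((contDiffOn_pderiv hU hα infty_add_one_le i).contDiffAt
      (hU.mem_nhds hu)).differentiableAt (by simp)
  have hc : ∀ {α : Euc 3 → ℝ}, ContDiffOn ℝ ∞ α U → ∀ i j,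
      pderiv i (pderiv j α) u = pderiv j (pderiv i α) u := fun hα i j =>
    pderiv_comm ((hα.contDiffAt (hU.mem_nhds hu)).of_le two_le_infty) i j
  have hs : ∀ i j k, pderiv i (fun u => pderiv j α u * pderiv k β u - pderiv k α u * pderiv j β u) u =
      pderiv j α u * pderiv i (pderiv k β) u + pderiv i (pderiv j α) u * pderiv k β u -
      (pderiv k α u * pderiv i (pderiv j β) u + pderiv i (pderiv k α) u * pderiv j β u) := by
    intro i j k
    rw [← pderiv_mul (hd hα j) (hd hβ k), ← pderiv_mul (hd hα k) (hd hβ j)]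
    exact DFunLike.congr_fun (fderiv_fun_sub ((hd hα j).fun_mul (hd hβ k))
      ((hd hα k).fun_mul (hd hβ j))) _
  simp only [Fin.sum_univ_three]
  rw [show pderiv 0 (cofactor α β 0) u = _ from hs 0 1 2,
    show pderiv 1 (cofactor α β 1) u = _ from hs 1 2 0,
    show pderiv 2 (cofactor α β 2) u = _ from hs 2 0 1,
    hc hβ 0 1, hc hβ 0 2, hc hβ 1 2, hc hα 0 1, hc hα 0 2, hc hα 1 2]
  ring

theorem integrable_of_continuousOn {K : Set (Euc 3)} (hK : IsCompact K) {h : Euc 3 → ℝ}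
    (hc : ContinuousOn h K) (h0 : ∀ x, x ∉ K → h x = 0) : Integrable h :=
  (hc.integrableOn_compact hK).integrable_of_forall_notMem_eq_zero h0

theorem pderiv_eq_zero_of_notMem_tsupport {ψ : Euc 3 → ℝ} {u : Euc 3} (hu : u ∉ tsupport ψ)
    (i : Fin 3) : pderiv i ψ u = 0 := by
  rw [pderiv_congr (notMem_tsupport_iff_eventuallyEq.1 hu) i]
  simp [pderiv]

/-- Integrating by parts moves the derivative from ψ to the cofactors, which are divergence free,
and to σ, which is locally constant. -/
theorem integral_jacobian_eq_zero (hU : IsOpen U) {σ α β ψ : Euc 3 → ℝ}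
    (hσ : ContDiffOn ℝ ∞ σ U) (hσ' : ∀ u ∈ U, ∀ i, pderiv i σ u = 0)
    (hα : ContDiffOn ℝ ∞ α U) (hβ : ContDiffOn ℝ ∞ β U) (hψ : ContDiff ℝ 1 ψ)
    (hc : HasCompactSupport ψ) (hs : tsupport ψ ⊆ U) :
    ∫ u, σ u * (Matrix.of fun i j => ![pderiv i α u, pderiv i β u, pderiv i ψ u] j).det = 0 := by
  simp_rw [det_eq_sum_cofactor, Finset.mul_sum, ← mul_assoc]
  have hf : ∀ i, ContDiffOn ℝ ∞ (fun u => σ u * cofactor α β i u) U := fun i =>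
    hσ.mul (contDiffOn_cofactor hU hα hβ i)
  have hψc : ∀ i, Continuous (pderiv i ψ) := fun i =>
    (hψ.continuous_fderiv one_ne_zero).clm_apply continuous_const
  have hi1 : ∀ i, Integrable fun u => σ u * cofactor α β i u * pderiv i ψ u := fun i =>
    integrable_of_continuousOn hc (((hf i).continuousOn.mono hs).mul (hψc i).continuousOn)
      fun x hx => by rw [pderiv_eq_zero_of_notMem_tsupport hx, mul_zero]
  have hi2 : ∀ i, Integrable fun u => pderiv i (fun u => σ u * cofactor α β i u) u * ψ u := fun i =>
    integrable_of_continuousOn hc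
      (((contDiffOn_pderiv hU (hf i) infty_add_one_le i).continuousOn.mono hs).mul
        hψ.continuous.continuousOn)
      fun x hx => by rw [image_eq_zero_of_notMem_tsupport hx, mul_zero]
  have hi3 : ∀ i, Integrable fun u => σ u * cofactor α β i u * ψ u := fun i =>
    integrable_of_continuousOn hc (((hf i).continuousOn.mono hs).mul hψ.continuous.continuousOn)
      fun x hx => by rw [image_eq_zero_of_notMem_tsupport hx, mul_zero]
  rw [integral_finsetSum _ fun i _ => hi1 i]
  have hp : ∀ i, ∫ u, σ u * cofactor α β i u * pderiv i ψ u =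
      -∫ u, pderiv i (fun u => σ u * cofactor α β i u) u * ψ u := fun i =>
    integral_mul_fderiv_eq_neg_fderiv_mul_of_integrable (hi2 i) (hi1 i) (hi3 i)
      (fun x hx => ((hf i).contDiffAt (hU.mem_nhds (hs hx))).differentiableAt (by simp))
      fun x _ => (hψ.differentiable one_ne_zero) x
  simp_rw [hp]
  rw [Finset.sum_neg_distrib, ← integral_finsetSum _ fun i _ => hi2 i, neg_eq_zero]
  refine integral_eq_zero_of_ae (Filter.Eventually.of_forall fun u => ?_)
  simp only [Pi.zero_apply]
  by_cases hu : u ∈ tsupport ψ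
  · have hd : ∀ {h : Euc 3 → ℝ}, ContDiffOn ℝ ∞ h U → DifferentiableAt ℝ h u := fun hh =>
      (hh.contDiffAt (hU.mem_nhds (hs hu))).differentiableAt (by simp)
    rw [← Finset.sum_mul]
    simp_rw [pderiv_mul (hd hσ) (hd (contDiffOn_cofactor hU hα hβ _)), hσ' u (hs hu), zero_mul,
      add_zero]
    rw [← Finset.mul_sum, sum_pderiv_cofactor hU hα hβ (hs hu)]
    simp
  · simp [image_eq_zero_of_notMem_tsupport hu]

end NullLagrangian

/-! ### The locally constant orientation sign. -/

section Orientation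

variable {F N : Euc 3 → Euc 4} {U : Set (Euc 3)}

/-- The sign which compares the orientation of `(∂₁F, ∂₂F, ∂₃F, N)` with the standard one. -/
def orientSign (F N : Euc 3 → Euc 4) (u : Euc 3) : ℝ :=
  frameDet (fun i => pderiv i F u) (N u) * (Real.sqrt (metric F u).det)⁻¹

theorem frameDet_sq (hN : IsLocalNormal F N U) {u : Euc 3} (hu : u ∈ U) :
    frameDet (fun i => pderiv i F u) (N u) ^ 2 = (metric F u).det := by
  rw [sq, frameDet_mul_frameDet (hN.norm_eq_one u hu) (hN.orthogonal u hu)]; rfl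

theorem det_metric_pos (hF : IsLocalImmersion F U) {u : Euc 3} (hu : u ∈ U) :
    0 < (metric F u).det := lt_of_le_of_ne det_gram (hF.isUnit_det u hu).ne_zero.symm

theorem orientSign_sq (hF : IsLocalImmersion F U) (hN : IsLocalNormal F N U) {u : Euc 3}
    (hu : u ∈ U) : orientSign F N u ^ 2 = 1 := by
  have := det_metric_pos hF hu
  rw [orientSign, mul_pow, frameDet_sq hN hu, inv_pow, Real.sq_sqrt this.le,
    mul_inv_cancel₀ this.ne']

theorem sqrt_det_eq (hF : IsLocalImmersion F U) (hN : IsLocalNormal F N U) {u : Euc 3}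
    (hu : u ∈ U) : Real.sqrt (metric F u).det =
      orientSign F N u * frameDet (fun i => pderiv i F u) (N u) := by
  have h0 := det_metric_pos hF hu
  rw [orientSign, mul_right_comm, ← sq, frameDet_sq hN hu, ← div_eq_mul_inv, Real.div_sqrt]

theorem contDiffOn_orientSign (hF : IsLocalImmersion F U) (hN : IsLocalNormal F N U) :
    ContDiffOn ℝ ∞ (orientSign F N) U := by
  refine ContDiffOn.mul (contDiffOn_det fun i a => ?_) (ContDiffOn.inv ?_ fun u hu => ?_)
  · simp only [Matrix.of_apply]
    refine contDiffOn_coord ?_ a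
    refine Fin.lastCases ?_ (fun i => ?_) i
    · simp only [Fin.snoc_last]; exact hN.contDiffOn
    · simp only [Fin.snoc_castSucc]; exact hF.contDiffOn_pderiv i
  · exact ContDiffOn.sqrt (contDiffOn_det hF.contDiffOn_metric)
      fun u hu => (det_metric_pos hF hu).ne'
  · exact (Real.sqrt_pos.2 (det_metric_pos hF hu)).ne'

/-- The sign is smooth with square one; differentiating the square suffices, so chart domains need
not be connected. -/
theorem pderiv_orientSign (hF : IsLocalImmersion F U) (hN : IsLocalNormal F N U) {u : Euc 3}
    (hu : u ∈ U) (i : Fin 3) : pderiv i (orientSign F N) u = 0 := by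
  have hU := hF.isOpen.mem_nhds hu
  have hd := ((contDiffOn_orientSign hF hN).contDiffAt hU).differentiableAt (by simp)
  have h1 : (fun v => orientSign F N v * orientSign F N v) =ᶠ[nhds u] fun _ => (1 : ℝ) := by
    filter_upwards [hU] with v hv
    rw [← sq, orientSign_sq hF hN hv]
  have h2 := pderiv_congr h1 i
  rw [pderiv_mul hd hd] at h2
  have h3 : pderiv i (fun _ : Euc 3 => (1 : ℝ)) u = 0 := by simp [pderiv]
  rw [h3] at h2
  have h4 : orientSign F N u ≠ 0 := fun h0 => by
    have := orientSign_sq hF hN hu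
    rw [h0] at this; norm_num at this
  have h5 : orientSign F N u * pderiv i (orientSign F N) u = 0 := by linarith
  exact (mul_eq_zero.1 h5).resolve_left h4

end Orientation

/-! ### Vanishing integrals of the operators ν_e ∂_c - ν_c ∂_e. -/

section Stokes

variable {M : Type*} [TopologicalSpace M] [ChartedSpace (Euc 3) M]

theorem ChartContDiff.continuous {V : Type*} [NormedAddCommGroup V] [NormedSpace ℝ V]
    {l : WithTop ℕ∞} {h : M → V} (hh : ChartContDiff l h) : Continuous h := by
  rw [continuous_iff_continuousAt]
  intro p
  have h1 : ContinuousAt (inChart (n := 3) h p) (chartAt (Euc 3) p p) :=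
    (hh p).continuousOn.continuousAt
      ((chartAt (Euc 3) p).open_target.mem_nhds (mem_chart_target _ p))
  have h2 := h1.comp ((chartAt (Euc 3) p).continuousAt (mem_chart_source _ p))
  refine h2.congr ?_
  filter_upwards [(chartAt (Euc 3) p).open_source.mem_nhds (mem_chart_source _ p)] with x hx
  simp [inChart, (chartAt (Euc 3) p).left_inv hx]

/-- The tangential operator `ν_e ∂_c - ν_c ∂_e`. -/
def rot (f ν : M → Euc 4) (e c : Fin 4) (φ : M → ℝ) (q : M) : ℝ :=
  ν q e * grad f φ q c - ν q c * grad f φ q e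

variable {f ν : M → Euc 4}

theorem grad_eq_zero_of_notMem_tsupport {φ : M → ℝ} {q : M} (hq : q ∉ tsupport φ) :
    grad f φ q = 0 := by
  have h1 : φ =ᶠ[nhds q] 0 := notMem_tsupport_iff_eventuallyEq.1 hq
  have h2 : inChart (n := 3) φ q =ᶠ[nhds (chartAt (Euc 3) q q)] fun _ => 0 := by
    have h3 := (chartAt (Euc 3) q).continuousAt_symm (mem_chart_target _ q)
    rw [ContinuousAt, (chartAt (Euc 3) q).left_inv (mem_chart_source _ q)] at h3
    exact h3.eventually h1
  rw [grad, tgrad_congr h2]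
  simp [tgrad, pderiv]

theorem ChartContDiff.mul {h k : M → ℝ} {l : WithTop ℕ∞} (hh : ChartContDiff l h)
    (hk : ChartContDiff l k) : ChartContDiff l fun q => h q * k q := fun p => (hh p).mul (hk p)

theorem ChartContDiff.sub {h k : M → ℝ} {l : WithTop ℕ∞} (hh : ChartContDiff l h)
    (hk : ChartContDiff l k) : ChartContDiff l fun q => h q - k q := fun p => (hh p).sub (hk p)

theorem ChartContDiff.sum {ι : Type*} {s : Finset ι} {h : ι → M → ℝ} {l : WithTop ℕ∞}
    (hh : ∀ i ∈ s, ChartContDiff l (h i)) : ChartContDiff l fun q => ∑ i ∈ s, h i q :=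
  fun p => ContDiffOn.sum fun i hi => hh i hi p

theorem ChartContDiff.prod {ι : Type*} {s : Finset ι} {h : ι → M → ℝ} {l : WithTop ℕ∞}
    (hh : ∀ i ∈ s, ChartContDiff l (h i)) : ChartContDiff l fun q => ∏ i ∈ s, h i q :=
  fun p => contDiffOn_prod fun i hi => hh i hi p

theorem ChartContDiff.const (c : ℝ) {l : WithTop ℕ∞} : ChartContDiff l fun _ : M => c :=
  fun _ => contDiffOn_const

theorem ChartContDiff.of_le {V : Type*} [NormedAddCommGroup V] [NormedSpace ℝ V]
    {l l' : WithTop ℕ∞} {h : M → V} (hh : ChartContDiff l h) (hl : l' ≤ l) : ChartContDiff l' h :=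
  fun p => (hh p).of_le hl

theorem ChartContDiff.coord {h : M → Euc 4} {l : WithTop ℕ∞} (hh : ChartContDiff l h)
    (a : Fin 4) : ChartContDiff l fun q => h q a := fun p => contDiffOn_coord (hh p) a

theorem ChartContDiff.comp {φ : ℝ → ℝ} {h : M → ℝ} {l : WithTop ℕ∞} (hφ : ContDiff ℝ l φ)
    (hh : ChartContDiff l h) : ChartContDiff l fun q => φ (h q) :=
  fun p => hφ.comp_contDiffOn (hh p)

variable [IsManifold (𝓡 3) ∞ M]

theorem IsUnitNormal.chartContDiff (hν : IsUnitNormal 3 f ν) (a : Fin 4) :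
    ChartContDiff ∞ fun q => ν q a :=
  (ContMDiff.chartContDiff le_rfl hν.contMDiff).coord a

theorem ChartContDiff.grad_coord (hf : IsSmoothImmersion 3 f) (hν : IsUnitNormal 3 f ν) {h : M → ℝ}
    {l l' : WithTop ℕ∞} (hh : ChartContDiff l h) (hl : l' + 1 ≤ l) (hl' : l' ≤ ∞) (a : Fin 4) :
    ChartContDiff l' fun q => Hypersurface.grad f h q a :=
  (hh.grad hf hν hl hl').coord a

theorem continuous_rot (hf : IsSmoothImmersion 3 f) (hν : IsUnitNormal 3 f ν) {φ : M → ℝ}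
    (hφ : ChartContDiff 1 φ) (e c : Fin 4) : Continuous (rot f ν e c φ) := by
  have hg := fun a => (hφ.grad_coord hf hν (l' := 0) (by simp) (by simp) a).continuous
  have hn := fun a => (hν.chartContDiff a).continuous
  exact ((hn e).mul (hg c)).sub ((hn c).mul (hg e))

/-- The density is the sign times the determinant of (∂F, N), and the operator is s times that of
(e_a, e_b, ∇φ, N). Their product is the determinant of the inner products, namely of ∂ᵢf_a, ∂ᵢf_b,
∂ᵢφ. -/
theorem density_mul_rot (hf : IsSmoothImmersion 3 f) (hν : IsUnitNormal 3 f ν) {φ : M → ℝ}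
    (hφ : ChartContDiff 1 φ) {e c a b : Fin 4} {s : ℝ} (hs : s ^ 2 = 1)
    (hX : ∀ w N : Euc 4, frameDet ![EuclideanSpace.single a 1, EuclideanSpace.single b 1, w] N =
      s * (N e * w c - N c * w e)) (p : M) {v : Euc 3} (hv : v ∈ (chartAt (Euc 3) p).target) :
    density f p v * rot f ν e c φ ((chartAt (Euc 3) p).symm v) =
      s * (orientSign (inChart (n := 3) f p) (inChart (n := 3) ν p) v *
      (Matrix.of fun i j => ![pderiv i (fun u => inChart (n := 3) f p u a) v,
        pderiv i (fun u => inChart (n := 3) f p u b) v, pderiv i (inChart (n := 3) φ p) v] j).det) := by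
  set F := inChart (n := 3) f p
  set N := inChart (n := 3) ν p with hNdef
  have hF : IsLocalImmersion F _ := hf.isLocalImmersion p
  have hN : IsLocalNormal F N _ := hν.isLocalNormal hf p
  set w := tgrad F (inChart (n := 3) φ p) v with hw
  have h1 : rot f ν e c φ ((chartAt (Euc 3) p).symm v) = N v e * w c - N v c * w e := by
    have := inChart_grad hf hν hφ p hv
    rw [hw, ← this]; rfl
  have h2 := hX w (N v)
  have h3 : N v e * w c - N v c * w e =
      s * frameDet ![EuclideanSpace.single a 1, EuclideanSpace.single b 1, w] (N v) := by
    rw [h2, ← mul_assoc, ← sq, hs, one_mul]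
  have hd : DifferentiableAt ℝ F v :=
    (hF.contDiffOn.contDiffAt (hF.isOpen.mem_nhds hv)).differentiableAt (by simp)
  rw [h1, h3, density, sqrt_det_eq hF hN hv]
  have h4 := frameDet_mul_frameDet (Y := ![EuclideanSpace.single a 1, EuclideanSpace.single b 1, w])
    (hN.norm_eq_one v hv) (hN.orthogonal v hv)
  have h5 : (Matrix.of fun i j => inner ℝ (pderiv i F v)
      ((![EuclideanSpace.single a 1, EuclideanSpace.single b 1, w] : Fin 3 → Euc 4) j)) =
      Matrix.of fun i j => ![pderiv i (fun u => F u a) v,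
        pderiv i (fun u => F u b) v, pderiv i (inChart (n := 3) φ p) v] j := by
    ext i j
    simp only [Matrix.of_apply]
    fin_cases j
    · simp [pderiv_coord hd, EuclideanSpace.inner_single_right]
    · simp [pderiv_coord hd, EuclideanSpace.inner_single_right]
    · simp only [hw]
      rw [← sum_pderiv_mul_tgrad (hF.isUnit_det v hv) (inChart (n := 3) φ p) i, real_inner_comm]
      rfl
  rw [← h5, ← h4]
  ring

theorem integral_rot_of_tsupport_subset [T2Space M] [CompactSpace M] [MeasurableSpace M]
    [BorelSpace M]
    (hf : IsSmoothImmersion 3 f) (hν : IsUnitNormal 3 f ν) {φ : M → ℝ}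
    (hφ : ChartContDiff 1 φ) (e c : Fin 4) (p : M)
    (hp : tsupport φ ⊆ (chartAt (Euc 3) p).source) :
    ∫ x, rot f ν e c φ x ∂inducedVolume 3 f = 0 := by
  by_cases hec : e = c
  · subst hec; simp [rot]
  obtain ⟨a, b, s, hs, hX⟩ := exists_frameDet_eq hec
  have hr0 : ∀ x, x ∉ (chartAt (Euc 3) p).source → rot f ν e c φ x = 0 := fun x hx => by
    simp [rot, grad_eq_zero_of_notMem_tsupport (fun h => hx (hp h))]
  rw [integral_inducedVolume hf p (continuous_rot hf hν hφ e c).measurable hr0,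
    setIntegral_congr_fun (measurableSet_chart_target p)
      fun v hv => density_mul_rot hf hν hφ hs hX p hv]
  set T := (chartAt (Euc 3) p).target
  have hT : IsOpen T := (chartAt (Euc 3) p).open_target
  set K := chartAt (Euc 3) p '' tsupport φ
  have hK : IsCompact K := (isClosed_tsupport φ).isCompact.image_of_continuousOn
    ((chartAt (Euc 3) p).continuousOn.mono hp)
  have hKT : K ⊆ T := by
    rintro _ ⟨x, hx, rfl⟩; exact (chartAt (Euc 3) p).map_source (hp hx)
  -- Outside the target the chart inverse has no meaning; extension by zero is C¹ because the image
  -- K of the support is compact in T.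
  let ψ : Euc 3 → ℝ := T.indicator (inChart (n := 3) φ p)
  have hψ0 : ∀ v, v ∉ K → ψ v = 0 := by
    intro v hv
    by_cases hvT : v ∈ T
    · simp only [ψ, Set.indicator_of_mem hvT]
      refine image_eq_zero_of_notMem_tsupport (f := φ) fun h => hv ⟨_, h, ?_⟩
      exact (chartAt (Euc 3) p).right_inv hvT
    · simp [ψ, hvT]
  have hψs : tsupport ψ ⊆ K := closure_minimal (fun v hv => by
    by_contra h; exact hv (hψ0 v h)) hK.isClosed
  have hψe : ∀ v ∈ T, inChart (n := 3) φ p =ᶠ[nhds v] ψ := fun v hv => by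
    filter_upwards [hT.mem_nhds hv] with w hw
    simp [ψ, Set.indicator_of_mem hw]
  have hψ1 : ContDiff ℝ 1 ψ := by
    refine contDiff_of_contDiffOn_union_of_isOpen (s := T) (t := Kᶜ) ?_ ?_ ?_ hT
      hK.isClosed.isOpen_compl
    · exact (hφ p).congr fun v hv => (hψe v hv).self_of_nhds.symm
    · exact (contDiffOn_const (c := (0 : ℝ))).congr fun v hv => hψ0 v hv
    · rw [Set.eq_univ_iff_forall]
      intro v
      by_cases h : v ∈ K
      · exact Or.inl (hKT h)
      · exact Or.inr h
  have hF := hf.isLocalImmersion p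
  have hN := hν.isLocalNormal hf p
  rw [integral_const_mul]
  have key := integral_jacobian_eq_zero hT (contDiffOn_orientSign hF hN)
    (fun u hu i => pderiv_orientSign hF hN hu i) (contDiffOn_coord hF.contDiffOn a)
    (contDiffOn_coord hF.contDiffOn b) hψ1 (hK.of_isClosed_subset (isClosed_tsupport ψ) hψs)
    (hψs.trans hKT)
  rw [← setIntegral_eq_integral_of_forall_compl_eq_zero (s := T)] at key
  · rw [mul_eq_zero]; right
    rw [← key]
    refine setIntegral_congr_fun (measurableSet_chart_target p) fun v hv => ?_
    simp only [fun i => pderiv_congr (hψe v hv) i]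
  · intro v hv
    rw [det_eq_sum_cofactor]
    simp [pderiv_eq_zero_of_notMem_tsupport fun h => hv (hKT (hψs h))]

theorem integral_rot_eq_zero [T2Space M] [CompactSpace M] [MeasurableSpace M] [BorelSpace M]
    (hf : IsSmoothImmersion 3 f) (hν : IsUnitNormal 3 f ν) {φ : M → ℝ}
    (hφ : ChartContDiff 1 φ) (e c : Fin 4) :
    ∫ x, rot f ν e c φ x ∂inducedVolume 3 f = 0 := by
  obtain ⟨t, ht⟩ := CompactSpace.elim_nhds_subcover (fun x : M => (chartAt (Euc 3) x).source)
    fun x => (chartAt (Euc 3) x).open_source.mem_nhds (mem_chart_source _ x)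
  obtain ⟨χ, hχ⟩ := SmoothPartitionOfUnity.exists_isSubordinate (𝓡 3) (isClosed_univ (X := M))
    (fun x : t => (chartAt (Euc 3) (x : M)).source) (fun x => (chartAt (Euc 3) (x : M)).open_source)
    (fun x _ => by
      have hx : x ∈ ⋃ y ∈ t, (chartAt (Euc 3) y).source := by rw [ht]; trivial
      simp only [Set.mem_iUnion] at hx ⊢
      obtain ⟨y, hy, hxy⟩ := hx
      exact ⟨⟨y, hy⟩, hxy⟩)
  have hC : ∀ i, ChartContDiff 1 fun q => χ i q * φ q := fun i =>
    (ContMDiff.chartContDiff (l := 1) (by simp) ((χ i).contMDiff.of_le (by simp))).mul hφ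
  have hs : φ = fun q => ∑ i, χ i q * φ q := by
    ext q
    have := χ.sum_eq_one (Set.mem_univ q)
    rw [finsum_eq_sum_of_fintype] at this
    rw [← Finset.sum_mul, this, one_mul]
  have hr : rot f ν e c φ = fun q => ∑ i, rot f ν e c (fun q => χ i q * φ q) q := by
    ext q
    conv_lhs => rw [hs]
    simp only [rot]
    rw [grad_sum fun i _ => hC i]
    simp [Finset.mul_sum]
  have := isFiniteMeasure_inducedVolume hf
  rw [hr, integral_finsetSum]
  · refine Finset.sum_eq_zero fun i _ => integral_rot_of_tsupport_subset hf hν (hC i) e c i ?_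
    refine (closure_mono fun q hq => ?_).trans (hχ i)
    exact left_ne_zero_of_mul hq
  · intro i _
    exact (continuous_rot hf hν (hC i) e c).integrable_of_hasCompactSupport
      (HasCompactSupport.of_compactSpace _)

end Stokes

/-! ### Gradients of ambient functions restricted to the hypersurface. -/

section Ambient

variable {M : Type*} [TopologicalSpace M] [ChartedSpace (Euc 3) M] [IsManifold (𝓡 3) ∞ M]
  {f ν : M → Euc 4}

theorem ChartContDiff.comp_map {V : Type*} [NormedAddCommGroup V] [NormedSpace ℝ V]
    (hf : IsSmoothImmersion 3 f) {H : Euc 4 → V} {l : WithTop ℕ∞}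
    (hl : l ≤ ∞) (hH : ContDiff ℝ l H) : ChartContDiff l fun q => H (f q) :=
  fun p => hH.comp_contDiffOn ((hf.isLocalImmersion p).contDiffOn.of_le hl)

/-- The ambient gradient minus its normal part is tangential and represents the differential, so
uniqueness applies. -/
theorem grad_comp_map (hf : IsSmoothImmersion 3 f) (hν : IsUnitNormal 3 f ν) {H : Euc 4 → ℝ}
    {q : M} (hH : DifferentiableAt ℝ H (f q)) (a : Fin 4) :
    grad f (fun x => H (f x)) q a =
      fderiv ℝ H (f q) (EuclideanSpace.single a 1) - ν q a * fderiv ℝ H (f q) (ν q) := by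
  have hv := mem_chart_target (Euc 3) q
  have hval : ∀ {V : Type} (h : M → V), inChart (n := 3) h q (chartAt (Euc 3) q q) = h q :=
    fun h => by simp [inChart, (chartAt (Euc 3) q).left_inv (mem_chart_source _ q)]
  have hF := hf.isLocalImmersion q
  have hN := hν.isLocalNormal hf q
  have hexp : ∀ x : Euc 4, fderiv ℝ H (f q) x =
      ∑ a, fderiv ℝ H (f q) (EuclideanSpace.single a 1) * x a := by
    intro x
    have hx : x = ∑ i, x i • EuclideanSpace.single i (1 : ℝ) := by
      ext a; simp [Finset.sum_apply, Pi.single_apply]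
    conv_lhs => rw [hx]
    rw [map_sum]; simp [mul_comm]
  have hNN : ∑ a, ν q a * ν q a = 1 := by
    rw [← euc_inner, real_inner_self_eq_norm_sq, hν.norm_eq_one]; norm_num
  let w : Euc 4 := WithLp.toLp 2 fun a =>
    fderiv ℝ H (f q) (EuclideanSpace.single a 1) - ν q a * fderiv ℝ H (f q) (ν q)
  have hw : w = tgrad (inChart (n := 3) f q) (inChart (n := 3) (fun x => H (f x)) q)
      (chartAt (Euc 3) q q) := by
    refine eq_tgrad hF hN hv ?_ fun i => ?_
    · rw [hval, euc_inner]
      simp only [w, sub_mul, Finset.sum_sub_distrib]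
      rw [← hexp]
      simp_rw [mul_right_comm]
      rw [← Finset.sum_mul, hNN]; ring
    · have hd : DifferentiableAt ℝ (inChart (n := 3) f q) (chartAt (Euc 3) q q) :=
        (hF.contDiffOn.contDiffAt (hF.isOpen.mem_nhds hv)).differentiableAt (by simp)
      have hH' : HasFDerivAt H (fderiv ℝ H (f q)) (inChart (n := 3) f q (chartAt (Euc 3) q q)) := by
        rw [hval]; exact hH.hasFDerivAt
      have hc := hH'.comp _ hd.hasFDerivAt
      have h0 := hN.orthogonal _ hv i
      rw [hval, euc_inner] at h0
      have h1 : pderiv i (inChart (n := 3) (fun x => H (f x)) q) (chartAt (Euc 3) q q) =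
          fderiv ℝ H (f q) (pderiv i (inChart (n := 3) f q) (chartAt (Euc 3) q q)) :=
        DFunLike.congr_fun hc.fderiv _
      rw [h1, euc_inner, hexp (pderiv i _ _)]
      simp only [w, sub_mul, Finset.sum_sub_distrib]
      rw [sub_eq_self]
      have : ∀ x, ν q x * fderiv ℝ H (f q) (ν q) *
          pderiv i (inChart (n := 3) f q) (chartAt (Euc 3) q q) x = fderiv ℝ H (f q) (ν q) *
          (pderiv i (inChart (n := 3) f q) (chartAt (Euc 3) q q) x * ν q x) := fun x => by ring
      simp_rw [this]
      rw [← Finset.mul_sum, h0, mul_zero]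
  rw [grad, ← hw]

end Ambient

/-! ### Projecting measures to ℝ³ and mollifying. -/

section Mollify

/-- The projection of `ℝ⁴` to `ℝ³` which forgets the coordinate `e`. -/
def dropCoord (e : Fin 4) : Euc 4 →L[ℝ] Euc 3 :=
  (EuclideanSpace.equiv (Fin 3) ℝ).symm.toContinuousLinearMap.comp
    (ContinuousLinearMap.pi fun i => EuclideanSpace.proj (e.succAbove i))

theorem dropCoord_apply (e : Fin 4) (y : Euc 4) (i : Fin 3) :
    dropCoord e y i = y (e.succAbove i) := rfl

theorem dropCoord_single_self (e : Fin 4) : dropCoord e (EuclideanSpace.single e 1) = 0 := by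
  ext i; simp [dropCoord_apply, Fin.succAbove_ne]

theorem dropCoord_single (e : Fin 4) (c : Fin 3) :
    dropCoord e (EuclideanSpace.single (e.succAbove c) 1) = EuclideanSpace.single c 1 := by
  ext i; simp [dropCoord_apply]

/-- A smooth nonnegative function of integral one with compact support. -/
structure IsMollifier (η : Euc 3 → ℝ) : Prop where
  contDiff : ContDiff ℝ ∞ η
  hasCompactSupport : HasCompactSupport η
  nonneg : ∀ x, 0 ≤ η x
  integral_eq_one : ∫ x, η x = 1

theorem IsMollifier.lintegral_eq_one {η : Euc 3 → ℝ} (hη : IsMollifier η) :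
    ∫⁻ x, ENNReal.ofReal (η x) = 1 := by
  rw [← ofReal_integral_eq_lintegral_ofReal
    (hη.contDiff.continuous.integrable_of_hasCompactSupport hη.hasCompactSupport)
    (Filter.Eventually.of_forall hη.nonneg), hη.integral_eq_one, ENNReal.ofReal_one]

variable {M : Type*} [TopologicalSpace M] [MeasurableSpace M] {f : M → Euc 4}

/-- The mollified image in `ℝ³` of the measure `w dμ` under the projection along `e`. -/
def mollify (η : Euc 3 → ℝ) (f : M → Euc 4) (e : Fin 4) (w : M → ℝ) (μ : Measure M)
    (x : Euc 3) : ℝ :=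
  ∫ q, η (x - dropCoord e (f q)) * w q ∂μ

variable [CompactSpace M] [BorelSpace M] {μ : Measure M} [IsFiniteMeasure μ] {η : Euc 3 → ℝ}
  {w : M → ℝ}

theorem continuous_integrable {V : Type*} [NormedAddCommGroup V] [SecondCountableTopology V]
    {h : M → V} (hh : Continuous h) : Integrable h μ := by
  refine hh.integrable_of_hasCompactSupport ?_
  exact HasCompactSupport.of_compactSpace _

theorem hasFDerivAt_mollify (hη : IsMollifier η) (hf : Continuous f) (hw : Continuous w)
    (e : Fin 4) (x : Euc 3) : HasFDerivAt (mollify η f e w μ)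
      (∫ q, w q • fderiv ℝ η (x - dropCoord e (f q)) ∂μ) x := by
  have hη' : Continuous (fderiv ℝ η) := hη.contDiff.continuous_fderiv (by simp)
  have hG : Continuous fun q => dropCoord e (f q) := (dropCoord e).continuous.comp hf
  obtain ⟨C, hC⟩ := (hη.hasCompactSupport.fderiv (𝕜 := ℝ)).exists_bound_of_continuous hη'
  refine hasFDerivAt_integral_of_dominated_of_fderiv_le (bound := fun q => |w q| * C)
    (F' := fun x q => w q • fderiv ℝ η (x - dropCoord e (f q))) Filter.univ_mem ?_ ?_ ?_ ?_ ?_ ?_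
  · exact Filter.Eventually.of_forall fun y => ((hη.contDiff.continuous.comp
      (continuous_const.sub hG)).mul hw).aestronglyMeasurable
  · exact continuous_integrable ((hη.contDiff.continuous.comp (continuous_const.sub hG)).mul hw)
  · exact (hw.smul (hη'.comp (continuous_const.sub hG))).aestronglyMeasurable
  · refine Filter.Eventually.of_forall fun q y _ => ?_
    rw [norm_smul, Real.norm_eq_abs]
    exact mul_le_mul_of_nonneg_left (hC _) (abs_nonneg _)
  · exact continuous_integrable (hw.abs.mul continuous_const)
  · refine Filter.Eventually.of_forall fun q y _ => ?_
    have h1 : HasFDerivAt η (fderiv ℝ η (y - dropCoord e (f q))) (y - dropCoord e (f q)) :=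
      (hη.contDiff.differentiable (by simp) _).hasFDerivAt
    have h2 := h1.comp y ((hasFDerivAt_id y).sub_const (dropCoord e (f q)))
    exact h2.mul_const (w q)

theorem contDiff_mollify (hη : IsMollifier η) (hf : Continuous f) (hw : Continuous w)
    (e : Fin 4) : ContDiff ℝ 1 (mollify η f e w μ) := by
  have hη' : Continuous (fderiv ℝ η) := hη.contDiff.continuous_fderiv (by simp)
  have hG : Continuous fun q => dropCoord e (f q) := (dropCoord e).continuous.comp hf
  obtain ⟨C, hC⟩ := (hη.hasCompactSupport.fderiv (𝕜 := ℝ)).exists_bound_of_continuous hη'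
  refine contDiff_one_iff_hasFDerivAt.2 ⟨_, ?_, hasFDerivAt_mollify hη hf hw e⟩
  refine continuous_of_dominated (bound := fun q => |w q| * C) ?_ ?_ ?_ ?_
  · exact fun x => (hw.smul (hη'.comp (continuous_const.sub hG))).aestronglyMeasurable
  · refine fun x => Filter.Eventually.of_forall fun q => ?_
    rw [norm_smul, Real.norm_eq_abs]
    exact mul_le_mul_of_nonneg_left (hC _) (abs_nonneg _)
  · exact continuous_integrable (hw.abs.mul continuous_const)
  · exact Filter.Eventually.of_forall fun q =>
      (hη'.comp (continuous_id.sub continuous_const)).const_smul (w q)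

theorem hasCompactSupport_mollify (hη : IsMollifier η) (hf : Continuous f) (e : Fin 4) :
    HasCompactSupport (mollify η f e w μ) := by
  have hG : Continuous fun q => dropCoord e (f q) := (dropCoord e).continuous.comp hf
  refine HasCompactSupport.intro
    (IsCompact.add hη.hasCompactSupport (isCompact_range hG)) fun x hx => ?_
  refine integral_eq_zero_of_ae (Filter.Eventually.of_forall fun q => ?_)
  have : x - dropCoord e (f q) ∉ tsupport η := fun h =>
    hx ⟨_, h, _, ⟨q, rfl⟩, sub_add_cancel _ _⟩
  simp [image_eq_zero_of_notMem_tsupport this]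

theorem lintegral_mollifier_sub (hη : IsMollifier η) (y : Euc 3) :
    ∫⁻ x, ENNReal.ofReal (η (x - y)) = 1 := by
  rw [lintegral_sub_right_eq_self (fun x => ENNReal.ofReal (η x)), hη.lintegral_eq_one]

theorem measurable_mollifier_sub (hη : IsMollifier η) (hf : Continuous f) (e : Fin 4) :
    Measurable fun z : Euc 3 × M => ENNReal.ofReal (η (z.1 - dropCoord e (f z.2))) := by
  have hG : Continuous fun q => dropCoord e (f q) := (dropCoord e).continuous.comp hf
  exact ENNReal.measurable_ofReal.comp (hη.contDiff.continuous.measurable.comp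
    (measurable_fst.sub (hG.measurable.comp measurable_snd)))

theorem lintegral_lintegral_mollifier (hη : IsMollifier η) (hf : Continuous f) (e : Fin 4)
    {h : M → ENNReal} (hh : Measurable h) :
    ∫⁻ x, ∫⁻ q, ENNReal.ofReal (η (x - dropCoord e (f q))) * h q ∂μ = ∫⁻ q, h q ∂μ := by
  rw [lintegral_lintegral_swap]
  · refine lintegral_congr fun q => ?_
    have hm : Measurable fun x : Euc 3 => ENNReal.ofReal (η (x - dropCoord e (f q))) :=
      ENNReal.measurable_ofReal.comp (hη.contDiff.continuous.measurable.comp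
        (measurable_id.sub measurable_const))
    rw [lintegral_mul_const _ hm, lintegral_mollifier_sub hη, one_mul]
  · exact ((measurable_mollifier_sub hη hf e).mul (hh.comp measurable_snd)).aemeasurable

theorem ofReal_mollify (hη : IsMollifier η) (hf : Continuous f) (hw : Continuous w)
    (hw0 : ∀ q, 0 ≤ w q) (e : Fin 4) (x : Euc 3) :
    ENNReal.ofReal (mollify η f e w μ x) =
      ∫⁻ q, ENNReal.ofReal (η (x - dropCoord e (f q))) * ENNReal.ofReal (w q) ∂μ := by
  have hG : Continuous fun q => dropCoord e (f q) := (dropCoord e).continuous.comp hf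
  have hi : Integrable (fun q => η (x - dropCoord e (f q)) * w q) μ := continuous_integrable
    ((hη.contDiff.continuous.comp (continuous_const.sub hG)).mul hw)
  rw [mollify, ofReal_integral_eq_lintegral_ofReal hi
    (Filter.Eventually.of_forall fun q => mul_nonneg (hη.nonneg _) (hw0 q))]
  simp_rw [ENNReal.ofReal_mul (hη.nonneg _)]

/-- With ρ the mollified density, one factor of ρ^{3/2} = ρ^{1/2} · ρ is unfolded and Tonelli
applied. A lower bound for ρ near projected points can then be used under an integral over M. -/
theorem lintegral_mollify_rpow (hη : IsMollifier η) (hf : Continuous f) (hw : Continuous w)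
    (hw0 : ∀ q, 0 ≤ w q) (e : Fin 4) :
    ∫⁻ q, (∫⁻ x, ENNReal.ofReal (η (x - dropCoord e (f q))) *
        ENNReal.ofReal (mollify η f e w μ x) ^ (1 / 2 : ℝ)) * ENNReal.ofReal (w q) ∂μ =
      ∫⁻ x, ENNReal.ofReal (mollify η f e w μ x) ^ (3 / 2 : ℝ) := by
  have hρ : Measurable fun x => ENNReal.ofReal (mollify η f e w μ x) ^ (1 / 2 : ℝ) :=
    (ENNReal.measurable_ofReal.comp
      (contDiff_mollify hη hf hw e).continuous.measurable).pow_const _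
  have h1 : ∀ x, ENNReal.ofReal (mollify η f e w μ x) ^ (3 / 2 : ℝ) =
      ∫⁻ q, ENNReal.ofReal (mollify η f e w μ x) ^ (1 / 2 : ℝ) *
        (ENNReal.ofReal (η (x - dropCoord e (f q))) * ENNReal.ofReal (w q)) ∂μ := by
    intro x
    rw [lintegral_const_mul', ← ofReal_mollify hη hf hw hw0]
    · rw [show (3 / 2 : ℝ) = 1 / 2 + 1 by norm_num,
        ENNReal.rpow_add_of_nonneg _ _ (by norm_num) (by norm_num), ENNReal.rpow_one]
    · exact ENNReal.rpow_ne_top_of_nonneg (by norm_num) ENNReal.ofReal_ne_top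
  simp_rw [h1]
  rw [lintegral_lintegral_swap]
  · refine lintegral_congr fun q => ?_
    rw [← lintegral_mul_const'  _ _ ENNReal.ofReal_ne_top]
    refine lintegral_congr fun x => ?_
    ring
  · exact ((hρ.comp measurable_fst).mul ((measurable_mollifier_sub hη hf e).mul
      ((ENNReal.measurable_ofReal.comp hw.measurable).comp measurable_snd))).aemeasurable

end Mollify

/-! ### Derivatives of the mollified densities. -/

section Sobolev

variable {M : Type*} [TopologicalSpace M] [T2Space M] [CompactSpace M] [ChartedSpace (Euc 3) M]
  [IsManifold (𝓡 3) ∞ M] [MeasurableSpace M] [BorelSpace M] {f ν : M → Euc 4} {η : Euc 3 → ℝ}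

theorem rot_mul {φ ψ : M → ℝ} (hφ : ChartContDiff 1 φ) (hψ : ChartContDiff 1 ψ) (e c : Fin 4)
    (q : M) : rot f ν e c (fun x => φ x * ψ x) q = φ q * rot f ν e c ψ q + ψ q * rot f ν e c φ q := by
  simp only [rot, grad_mul hφ hψ, PiLp.add_apply, PiLp.smul_apply, smul_eq_mul]
  ring

/-- The partial derivatives of the mollified projection. -/
theorem fderiv_mollify_single (hη : IsMollifier η) (hf : IsSmoothImmersion 3 f)
    (hν : IsUnitNormal 3 f ν) {u : M → ℝ} (hu : ChartContDiff 1 u) (e : Fin 4) (c : Fin 3)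
    (x : Euc 3) :
    fderiv ℝ (mollify η f e (fun q => u q * ν q e ^ 2) (inducedVolume 3 f)) x
        (EuclideanSpace.single c 1) =
      ∫ q, η (x - dropCoord e (f q)) * rot f ν e (e.succAbove c) (fun q => u q * ν q e) q
        ∂inducedVolume 3 f := by
  have := isFiniteMeasure_inducedVolume hf
  have hfc : Continuous f := hf.contMDiff.continuous
  have hG : Continuous fun q => dropCoord e (f q) := (dropCoord e).continuous.comp hfc
  have hνc : Continuous fun q => ν q e := (hν.chartContDiff e).continuous
  have hw : Continuous fun q => u q * ν q e ^ 2 := hu.continuous.mul (hνc.pow 2)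
  have hη' : Continuous (fderiv ℝ η) := hη.contDiff.continuous_fderiv (by simp)
  rw [(hasFDerivAt_mollify hη hfc hw e x).fderiv]
  have hi : Integrable (fun q => (u q * ν q e ^ 2) • fderiv ℝ η (x - dropCoord e (f q)))
      (inducedVolume 3 f) :=
    continuous_integrable (hw.smul (hη'.comp (continuous_const.sub hG)))
  rw [ContinuousLinearMap.integral_apply hi]
  have hH : ContDiff ℝ ∞ fun y : Euc 4 => η (x - dropCoord e y) :=
    hη.contDiff.comp (contDiff_const.sub (dropCoord e).contDiff)
  have hψ : ChartContDiff 1 fun q => η (x - dropCoord e (f q)) :=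
    ChartContDiff.comp_map hf (by simp) (hH.of_le (by simp))
  have hφ : ChartContDiff 1 fun q => u q * ν q e :=
    hu.mul ((hν.chartContDiff e).of_le (by simp))
  -- One factor ν_e stays with u and the other is produced by differentiating the mollifier, which
  -- explains the weight u ν_e².
  have h0 := integral_rot_eq_zero hf hν (hφ.mul hψ) e (e.succAbove c)
  -- The normal parts of the gradient cancel in the antisymmetric operator, and the projection kills
  -- the direction e, so a single term survives.
  have hr : ∀ q, rot f ν e (e.succAbove c) (fun q => η (x - dropCoord e (f q))) q =
      -(ν q e * fderiv ℝ η (x - dropCoord e (f q)) (EuclideanSpace.single c 1)) := by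
    intro q
    have hd : HasFDerivAt (fun y : Euc 4 => η (x - dropCoord e y))
        ((fderiv ℝ η (x - dropCoord e (f q))).comp (-(dropCoord e))) (f q) :=
      ((hη.contDiff.differentiable (by simp) _).hasFDerivAt).comp _
        ((dropCoord e).hasFDerivAt.const_sub x)
    have hg := grad_comp_map hf hν (q := q) hd.differentiableAt
    rw [rot, hg, hg, hd.fderiv]
    simp only [ContinuousLinearMap.comp_apply, neg_apply, map_neg,
      dropCoord_single_self, dropCoord_single, map_zero]
    ring
  simp only [rot_mul hφ hψ, hr] at h0
  rw [integral_add] at h0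
  · rw [← sub_eq_zero, ← neg_eq_zero, neg_sub, ← h0, add_comm, sub_eq_add_neg, ← integral_neg]
    congr 1
    refine integral_congr_ae (Filter.Eventually.of_forall fun q => ?_)
    simp; ring
  · refine continuous_integrable ?_
    exact (hu.continuous.mul hνc).mul (hνc.mul ((hη'.comp (continuous_const.sub hG)).clm_apply
      continuous_const)).neg
  · exact continuous_integrable (hψ.continuous.mul (continuous_rot hf hν hφ _ _))

end Sobolev

/-! ### Upper and lower bounds for the mollified densities. -/

section Sobolev

variable {M : Type*} [TopologicalSpace M] [T2Space M] [CompactSpace M] [ChartedSpace (Euc 3) M]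
  [IsManifold (𝓡 3) ∞ M] [MeasurableSpace M] [BorelSpace M] {f ν : M → Euc 4} {η : Euc 3 → ℝ}

theorem enorm_clm_le (L : Euc 3 →L[ℝ] ℝ) : ‖L‖ₑ ≤ ∑ c, ‖L (EuclideanSpace.single c 1)‖ₑ := by
  have h : ‖L‖ ≤ ∑ c, ‖L (EuclideanSpace.single c 1)‖ := by
    refine L.opNorm_le_bound (Finset.sum_nonneg fun _ _ => norm_nonneg _) fun x => ?_
    have hx : x = ∑ i, x i • EuclideanSpace.single i (1 : ℝ) := by
      ext a; simp [Finset.sum_apply, Pi.single_apply]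
    conv_lhs => rw [hx]
    rw [map_sum, Finset.sum_mul]
    refine (norm_sum_le _ _).trans (Finset.sum_le_sum fun i _ => ?_)
    rw [map_smul, norm_smul, mul_comm]
    exact mul_le_mul_of_nonneg_left (PiLp.norm_apply_le x i) (norm_nonneg _)
  rw [← ofReal_norm]
  refine (ENNReal.ofReal_le_ofReal h).trans ?_
  rw [ENNReal.ofReal_sum_of_nonneg fun _ _ => norm_nonneg _]
  simp only [ofReal_norm, le_refl]

/-- Mollifying preserves total mass, so the bound does not depend on η; the 3 counts the partial
derivatives. -/
theorem lintegral_fderiv_mollify_le (hη : IsMollifier η) (hf : IsSmoothImmersion 3 f)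
    (hν : IsUnitNormal 3 f ν) {u : M → ℝ} (hu : ChartContDiff 1 u) (e : Fin 4) {K : ℝ}
    (hK : ∀ c, ∫ q, |rot f ν e c (fun q => u q * ν q e) q| ∂inducedVolume 3 f ≤ K) :
    ∫⁻ x, ‖fderiv ℝ (mollify η f e (fun q => u q * ν q e ^ 2) (inducedVolume 3 f)) x‖ₑ ≤
      ENNReal.ofReal (3 * K) := by
  have := isFiniteMeasure_inducedVolume hf
  have hfc : Continuous f := hf.contMDiff.continuous
  have hφ : ChartContDiff 1 fun q => u q * ν q e :=
    hu.mul ((hν.chartContDiff e).of_le (by simp))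
  set μ := inducedVolume 3 f
  have hr : ∀ c, Continuous (rot f ν e c fun q => u q * ν q e) := fun c =>
    continuous_rot hf hν hφ e c
  have hrm : ∀ c, Measurable fun q => ‖rot f ν e c (fun q => u q * ν q e) q‖ₑ := fun c =>
    (hr c).measurable.enorm
  have h1 : ∀ x, ‖fderiv ℝ (mollify η f e (fun q => u q * ν q e ^ 2) μ) x‖ₑ ≤
      ∑ c : Fin 3, ∫⁻ q, ENNReal.ofReal (η (x - dropCoord e (f q))) *
        ‖rot f ν e (e.succAbove c) (fun q => u q * ν q e) q‖ₑ ∂μ := by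
    intro x
    refine (enorm_clm_le _).trans (Finset.sum_le_sum fun c _ => ?_)
    rw [fderiv_mollify_single hη hf hν hu]
    refine (enorm_integral_le_lintegral_enorm _).trans (lintegral_mono fun q => ?_)
    rw [enorm_mul, Real.enorm_eq_ofReal (hη.nonneg _)]
  refine (lintegral_mono h1).trans ?_
  rw [lintegral_finsetSum]
  · have h2 : ∀ c : Fin 3, ∫⁻ x, ∫⁻ q, ENNReal.ofReal (η (x - dropCoord e (f q))) *
        ‖rot f ν e (e.succAbove c) (fun q => u q * ν q e) q‖ₑ ∂μ ≤ ENNReal.ofReal K := by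
      intro c
      rw [lintegral_lintegral_mollifier hη hfc e (hrm _)]
      refine le_trans (le_of_eq ?_) (ENNReal.ofReal_le_ofReal (hK (e.succAbove c)))
      rw [ofReal_integral_eq_lintegral_ofReal (continuous_integrable (hr _).abs)
        (Filter.Eventually.of_forall fun _ => abs_nonneg _)]
      exact lintegral_congr fun q => Real.enorm_eq_ofReal_abs _
    refine (Finset.sum_le_sum fun c _ => h2 c).trans ?_
    rw [Finset.sum_const, Finset.card_univ, Fintype.card_fin, nsmul_eq_mul,
      ENNReal.ofReal_mul (by norm_num)]
    simp
  · intro c _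
    exact ((measurable_mollifier_sub hη hfc e).mul
      ((hrm (e.succAbove c)).comp measurable_snd)).lintegral_prod_right'

/-- The constant of the Gagliardo–Nirenberg–Sobolev inequality in `ℝ³`. -/
def gnsConst : NNReal := lintegralPowLePowLIntegralFDerivConst (volume : Measure (Euc 3)) (3 / 2)

/-- Gagliardo–Nirenberg–Sobolev for an L¹ gradient in ℝ³, whose exponent is 3/2; the bound is
uniform in η. -/
theorem lintegral_mollify_le (hη : IsMollifier η) (hf : IsSmoothImmersion 3 f)
    (hν : IsUnitNormal 3 f ν) {u : M → ℝ} (hu : ChartContDiff 1 u) (e : Fin 4) {K : ℝ}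
    (hK : ∀ c, ∫ q, |rot f ν e c (fun q => u q * ν q e) q| ∂inducedVolume 3 f ≤ K) :
    ∫⁻ x, ENNReal.ofReal (mollify η f e (fun q => u q * ν q e ^ 2) (inducedVolume 3 f) x)
      ^ (3 / 2 : ℝ) ≤ gnsConst * ENNReal.ofReal (3 * K) ^ (3 / 2 : ℝ) := by
  have := isFiniteMeasure_inducedVolume hf
  have hfc : Continuous f := hf.contMDiff.continuous
  have hw : Continuous fun q => u q * ν q e ^ 2 :=
    hu.continuous.mul ((hν.chartContDiff e).continuous.pow 2)
  have hp : (Module.finrank ℝ (Euc 3) : ℝ).HolderConjugate (3 / 2) := by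
    rw [finrank_euclideanSpace_fin, Real.holderConjugate_iff]; norm_num
  have h1 := lintegral_pow_le_pow_lintegral_fderiv (volume : Measure (Euc 3))
    (contDiff_mollify (μ := inducedVolume 3 f) hη hfc hw e)
    (hasCompactSupport_mollify hη hfc e) hp
  refine le_trans (lintegral_mono fun x => ?_) (h1.trans ?_)
  · refine ENNReal.rpow_le_rpow ?_ (by norm_num)
    rw [← ofReal_norm]
    exact ENNReal.ofReal_le_ofReal (le_abs_self _)
  · refine mul_le_mul_right (ENNReal.rpow_le_rpow ?_ (by norm_num)) _
    exact lintegral_fderiv_mollify_le hη hf hν hu e hK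

theorem abs_frameDet_succAbove (e : Fin 4) (N : Euc 4) :
    |frameDet (fun i => EuclideanSpace.single (e.succAbove i) 1) N| = |N e| := by
  have h3 : (fun i => EuclideanSpace.single (e.succAbove i) (1 : ℝ) : Fin 3 → Euc 4) =
      ![EuclideanSpace.single (e.succAbove 0) 1, EuclideanSpace.single (e.succAbove 1) 1,
        EuclideanSpace.single (e.succAbove 2) 1] := by
    ext i; fin_cases i <;> rfl
  have hs : (2 : Fin 4).succAbove 2 = 3 := rfl
  have hs' : (1 : Fin 4).succAbove 2 = 3 := rfl
  have h21 : (2 : Fin 4).succAbove 1 = 1 := rfl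
  have h31 : (3 : Fin 4).succAbove 1 = 1 := rfl
  have h32 : (3 : Fin 4).succAbove 2 = 2 := rfl
  rw [h3, frameDet_eq_det]
  fin_cases e <;> simp [Matrix.det_succ_row_zero, Fin.sum_univ_succ, hs, hs', h21, h31, h32]

/-- The frame determinant product with Y the basis vectors other than e, for which the determinant
of (Y, N) is ±N_e. Relative to μ the projection therefore has Jacobian |ν_e|. -/
theorem density_mul_abs_normal (hf : IsSmoothImmersion 3 f) (hν : IsUnitNormal 3 f ν) (p : M)
    (e : Fin 4) {v : Euc 3} (hv : v ∈ (chartAt (Euc 3) p).target) :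
    density f p v * |inChart (n := 3) ν p v e| =
      |((dropCoord e).comp (fderiv ℝ (inChart (n := 3) f p) v)).det| := by
  have hF := hf.isLocalImmersion p
  have hN := hν.isLocalNormal hf p
  have h1 := frameDet_mul_frameDet (Y := fun i => EuclideanSpace.single (e.succAbove i) 1)
    (hN.norm_eq_one v hv) (hN.orthogonal v hv)
  have h2 : |orientSign (inChart (n := 3) f p) (inChart (n := 3) ν p) v| = 1 := by
    have := orientSign_sq hF hN hv
    rwa [← sq_abs, pow_eq_one_iff_of_nonneg (abs_nonneg _) two_ne_zero] at this
  have h3 := sqrt_det_eq hF hN hv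
  have h4 : density f p v = |frameDet (fun i => pderiv i (inChart (n := 3) f p) v)
      (inChart (n := 3) ν p v)| := by
    rw [← abs_of_nonneg (density_nonneg f p v), density, h3, abs_mul, h2, one_mul]
  rw [h4, ← abs_frameDet_succAbove e, ← abs_mul, h1, det_clm_eq, ← Matrix.det_transpose]
  congr 2
  ext i j
  simp [dropCoord_apply, EuclideanSpace.inner_single_right, pderiv]

/-- Where the projection along `e` is a local diffeomorphism, the mollified density is bounded
below by the density of one sheet. -/
theorem exists_le_mollify (hf : IsSmoothImmersion 3 f) (hν : IsUnitNormal 3 f ν) {u : M → ℝ}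
    (hu : Continuous u) (hu0 : ∀ q, 0 ≤ u q) (e : Fin 4) (q₀ : M) {c : ℝ} (hc0 : 0 ≤ c)
    (hc : c < u q₀ * |ν q₀ e|) :
    ∃ r > 0, ∀ η : Euc 3 → ℝ, IsMollifier η → (∀ x, η x ≠ 0 → ‖x‖ < r) →
      ∀ x, ‖x - dropCoord e (f q₀)‖ < r → ENNReal.ofReal c ≤
        ENNReal.ofReal (mollify η f e (fun q => u q * ν q e ^ 2) (inducedVolume 3 f) x) := by
  have := isFiniteMeasure_inducedVolume hf
  have hfc : Continuous f := hf.contMDiff.continuous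
  have hνc : Continuous fun q => ν q e := (hν.chartContDiff e).continuous
  have hw : Continuous fun q => u q * ν q e ^ 2 := hu.mul (hνc.pow 2)
  set F := inChart (n := 3) f q₀ with hFdef
  set T := (chartAt (Euc 3) q₀).target with hTdef
  set v₀ := chartAt (Euc 3) q₀ q₀ with hv₀
  have hv₀T : v₀ ∈ T := mem_chart_target _ _
  have hT : IsOpen T := (chartAt (Euc 3) q₀).open_target
  have hsym : (chartAt (Euc 3) q₀).symm v₀ = q₀ :=
    (chartAt (Euc 3) q₀).left_inv (mem_chart_source _ _)
  have hF := hf.isLocalImmersion q₀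
  let G : Euc 3 → Euc 3 := fun v => dropCoord e (F v)
  have hGd : ∀ v ∈ T, HasFDerivAt G ((dropCoord e).comp (fderiv ℝ F v)) v := fun v hv =>
    (dropCoord e).hasFDerivAt.comp v ((hF.contDiffOn.contDiffAt
      (hT.mem_nhds hv)).differentiableAt (by simp)).hasFDerivAt
  have hGc : ContDiffAt ℝ ∞ G v₀ :=
    (dropCoord e).contDiff.contDiffAt.comp v₀ (hF.contDiffOn.contDiffAt (hT.mem_nhds hv₀T))
  -- Since 0 ≤ c < u|ν_e| at q₀, the component ν_e does not vanish there, and the inverse function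
  -- theorem applies to the projection.
  have hdet : ((dropCoord e).comp (fderiv ℝ F v₀)).det ≠ 0 := by
    intro h0
    have h1 := density_mul_abs_normal hf hν q₀ e hv₀T
    rw [← hFdef, h0, abs_zero, mul_eq_zero] at h1
    rcases h1 with h1 | h1
    · exact (Real.sqrt_pos.2 (det_metric_pos hF hv₀T)).ne' h1
    · have : |ν q₀ e| = 0 := by
        rw [← h1, inChart, Function.comp_apply, hsym]
      rw [this, mul_zero] at hc
      exact absurd hc (not_lt.2 hc0)
  obtain ⟨L, hL⟩ : ∃ L : Euc 3 ≃L[ℝ] Euc 3,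
      (L : Euc 3 →L[ℝ] Euc 3) = (dropCoord e).comp (fderiv ℝ F v₀) :=
    ⟨_, ContinuousLinearMap.coe_toContinuousLinearEquivOfDetNeZero _ hdet⟩
  have hst : HasStrictFDerivAt G (L : Euc 3 →L[ℝ] Euc 3) v₀ := by
    have := hGc.hasStrictFDerivAt (by simp)
    rw [(hGd v₀ hv₀T).fderiv] at this
    rw [hL]
    exact this
  let Φ := hst.toOpenPartialHomeomorph G
  let S : Set (Euc 3) := T ∩ (fun v => u ((chartAt (Euc 3) q₀).symm v) *
    |ν ((chartAt (Euc 3) q₀).symm v) e|) ⁻¹' Set.Ioi c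
  have hS : IsOpen S := by
    refine ContinuousOn.isOpen_inter_preimage ?_ hT isOpen_Ioi
    exact (hu.mul hνc.abs).comp_continuousOn (chartAt (Euc 3) q₀).continuousOn_symm
  let V := Φ.source ∩ S
  have hV : IsOpen V := Φ.open_source.inter hS
  have hVT : V ⊆ T := fun v hv => hv.2.1
  have hv₀V : v₀ ∈ V := ⟨hst.mem_toOpenPartialHomeomorph_source, hv₀T, by
    simp only [Set.mem_preimage, Set.mem_Ioi, hsym]; exact hc⟩
  have hinj : Set.InjOn G V := Φ.injOn.mono Set.inter_subset_left
  have hGV : IsOpen (G '' V) := Φ.isOpen_image_of_subset_source hV Set.inter_subset_left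
  obtain ⟨R, hR, hball⟩ := Metric.isOpen_iff.1 hGV (G v₀) ⟨v₀, hv₀V, rfl⟩
  have hGv₀ : G v₀ = dropCoord e (f q₀) := by
    simp only [G, hFdef, inChart, Function.comp_apply, hsym]
  -- One half of R for the distance of x from the projected point and one half for the support of η:
  -- all mass seen from x lies in the image of V.
  refine ⟨R / 2, by positivity, fun η hη hηs x hx => ?_⟩
  rw [ofReal_mollify hη hfc hw (fun q => mul_nonneg (hu0 q) (sq_nonneg _))]
  have hm : Measurable fun q => ENNReal.ofReal (η (x - dropCoord e (f q))) *
      ENNReal.ofReal (u q * ν q e ^ 2) := by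
    refine Measurable.mul ?_ (ENNReal.measurable_ofReal.comp hw.measurable)
    exact (measurable_mollifier_sub hη hfc e).comp (measurable_const.prodMk measurable_id)
  -- Other sheets over the same region only add mass, so they are discarded.
  refine le_trans ?_ (lintegral_mono' (chartVolume_le_inducedVolume q₀) le_rfl)
  rw [lintegral_chartVolume hf q₀ hm]
  have h1 : ∫⁻ y in G '' V, ENNReal.ofReal c * ENNReal.ofReal (η (x - y)) = ENNReal.ofReal c := by
    rw [lintegral_const_mul' _ _ ENNReal.ofReal_ne_top,
      setLIntegral_eq_of_support_subset, lintegral_sub_left_eq_self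
        (fun y => ENNReal.ofReal (η y)) x, hη.lintegral_eq_one, mul_one]
    intro y hy
    apply hball
    have h2 : η (x - y) ≠ 0 := fun h => hy (by simp [h])
    have h3 := hηs _ h2
    rw [Metric.mem_ball, dist_eq_norm, hGv₀]
    calc ‖y - dropCoord e (f q₀)‖ = ‖(x - dropCoord e (f q₀)) - (x - y)‖ := by congr 1; abel
      _ ≤ ‖x - dropCoord e (f q₀)‖ + ‖x - y‖ := norm_sub_le _ _
      _ < R := by linarith
  rw [← h1, lintegral_image_eq_lintegral_abs_det_fderiv_mul volume hV.measurableSet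
    (fun v hv => (hGd v (hVT hv)).hasFDerivWithinAt) hinj]
  refine le_trans (setLIntegral_mono_ae' hV.measurableSet
    (Filter.Eventually.of_forall fun v hv => ?_)) (lintegral_mono_set hVT)
  -- The Jacobian takes one factor |ν_e| out of u ν_e², and the remaining u|ν_e| exceeds c on V.
  rw [← density_mul_abs_normal hf hν q₀ e (hVT hv)]
  set q := (chartAt (Euc 3) q₀).symm v with hq
  have hle : c ≤ u q * |ν q e| := (Set.mem_Ioi.1 hv.2.2).le
  have e1 : inChart (n := 3) ν q₀ v e = ν q e := rfl
  have e2 : G v = dropCoord e (f q) := rfl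
  rw [e1, e2, ENNReal.ofReal_mul (density_nonneg f q₀ v), mul_assoc]
  refine mul_le_mul_right ?_ _
  rw [← mul_assoc, mul_comm, ← ENNReal.ofReal_mul (abs_nonneg _)]
  refine mul_le_mul_right (ENNReal.ofReal_le_ofReal ?_) _
  calc |ν q e| * c ≤ |ν q e| * (u q * |ν q e|) := mul_le_mul_of_nonneg_left hle (abs_nonneg _)
    _ = u q * ν q e ^ 2 := by rw [← sq_abs (ν q e)]; ring

end Sobolev

/-! ### The limit of the mollification and the Sobolev inequality. -/

section Sobolev

variable {M : Type*} [TopologicalSpace M] [T2Space M] [CompactSpace M] [ChartedSpace (Euc 3) M]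
  [IsManifold (𝓡 3) ∞ M] [MeasurableSpace M] [BorelSpace M] {f ν : M → Euc 4}

theorem exists_mollifier (n : ℕ) : ∃ η : Euc 3 → ℝ, IsMollifier η ∧
    ∀ x, η x ≠ 0 → ‖x‖ < 1 / ((n : ℝ) + 1) := by
  let b : ContDiffBump (0 : Euc 3) :=
    ⟨1 / (2 * ((n : ℝ) + 1)), 1 / ((n : ℝ) + 1), by positivity, by
      apply one_div_lt_one_div_of_lt (by positivity)
      have : (0 : ℝ) < (n : ℝ) + 1 := by positivity
      linarith⟩
  refine ⟨b.normed volume, ⟨b.contDiff_normed, b.hasCompactSupport_normed,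
    b.nonneg_normed, b.integral_normed⟩, fun x hx => ?_⟩
  have : x ∈ Function.support (b.normed volume) := hx
  rw [b.support_normed_eq, mem_ball_zero_iff] at this
  exact this

/-- Fatou's lemma along mollifiers with shrinking support. Only a pointwise lower bound of the limit
inferior is needed; points with ν_e = 0 contribute nothing. -/
theorem lintegral_rpow_mul_normal_le (hf : IsSmoothImmersion 3 f) (hν : IsUnitNormal 3 f ν)
    {u : M → ℝ} (hu : ChartContDiff 1 u) (hu0 : ∀ q, 0 ≤ u q) (e : Fin 4) {K : ℝ}
    (hK : ∀ c, ∫ q, |rot f ν e c (fun q => u q * ν q e) q| ∂inducedVolume 3 f ≤ K) :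
    ∫⁻ q, ENNReal.ofReal (u q * |ν q e|) ^ (1 / 2 : ℝ) * ENNReal.ofReal (u q * ν q e ^ 2)
      ∂inducedVolume 3 f ≤ gnsConst * ENNReal.ofReal (3 * K) ^ (3 / 2 : ℝ) := by
  have := isFiniteMeasure_inducedVolume hf
  have hfc : Continuous f := hf.contMDiff.continuous
  have hνc : Continuous fun q => ν q e := (hν.chartContDiff e).continuous
  have hw : Continuous fun q => u q * ν q e ^ 2 := hu.continuous.mul (hνc.pow 2)
  have hw0 : ∀ q, 0 ≤ u q * ν q e ^ 2 := fun q => mul_nonneg (hu0 q) (sq_nonneg _)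
  choose η hη hηs using exists_mollifier
  set w := fun q => u q * ν q e ^ 2 with hwdef
  set μ := inducedVolume 3 f
  let I : ℕ → M → ENNReal := fun n q => ∫⁻ x, ENNReal.ofReal (η n (x - dropCoord e (f q))) *
    ENNReal.ofReal (mollify (η n) f e w μ x) ^ (1 / 2 : ℝ)
  have hIm : ∀ n, Measurable (I n) := by
    intro n
    have hρ : Measurable fun x => ENNReal.ofReal (mollify (η n) f e w μ x) ^ (1 / 2 : ℝ) :=
      (ENNReal.measurable_ofReal.comp
        (contDiff_mollify (hη n) hfc hw e).continuous.measurable).pow_const _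
    have h1 : Measurable fun z : M × Euc 3 => ENNReal.ofReal (η n (z.2 - dropCoord e (f z.1))) *
        ENNReal.ofReal (mollify (η n) f e w μ z.2) ^ (1 / 2 : ℝ) :=
      ((measurable_mollifier_sub (hη n) hfc e).comp measurable_swap).mul (hρ.comp measurable_snd)
    exact h1.lintegral_prod_right'
  have hlim : ∀ q, ENNReal.ofReal (u q * |ν q e|) ^ (1 / 2 : ℝ) ≤
      Filter.liminf (fun n => I n q) Filter.atTop := by
    intro q
    refine le_of_forall_lt_imp_le_of_dense fun b hb => ?_
    have hbt : b ^ (2 : ℝ) ≠ ⊤ := ENNReal.rpow_ne_top_of_nonneg (by norm_num) hb.ne_top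
    have hb2 : b ^ (2 : ℝ) < ENNReal.ofReal (u q * |ν q e|) := by
      have := ENNReal.rpow_lt_rpow hb (show (0 : ℝ) < 2 by norm_num)
      rwa [← ENNReal.rpow_mul, show (1 / 2 : ℝ) * 2 = 1 by norm_num, ENNReal.rpow_one] at this
    have hc : (b ^ (2 : ℝ)).toReal < u q * |ν q e| := by
      rwa [← ENNReal.ofReal_toReal hbt, ENNReal.ofReal_lt_ofReal_iff_of_nonneg
        ENNReal.toReal_nonneg] at hb2
    obtain ⟨r, hr, H⟩ := exists_le_mollify hf hν hu.continuous hu0 e q ENNReal.toReal_nonneg hc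
    rw [ENNReal.ofReal_toReal hbt] at H
    refine Filter.le_liminf_of_le (by isBoundedDefault) ?_
    obtain ⟨n₀, hn₀⟩ := exists_nat_one_div_lt hr
    filter_upwards [Filter.eventually_ge_atTop n₀] with n hn
    have hnr : ∀ x, η n x ≠ 0 → ‖x‖ < r := fun x hx =>
      (hηs n x hx).trans_le ((one_div_le_one_div_of_le (by positivity) (by gcongr)).trans hn₀.le)
    have h1 : ∫⁻ x, ENNReal.ofReal (η n (x - dropCoord e (f q))) * b = b := by
      rw [lintegral_mul_const' _ _ hb.ne_top, lintegral_mollifier_sub (hη n), one_mul]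
    rw [← h1]
    refine lintegral_mono fun x => ?_
    by_cases hx : η n (x - dropCoord e (f q)) = 0
    · simp [hx]
    · refine mul_le_mul_right ?_ _
      have := ENNReal.rpow_le_rpow (H (η n) (hη n) hnr x (hnr _ hx))
        (show (0 : ℝ) ≤ 1 / 2 by norm_num)
      rwa [← ENNReal.rpow_mul, show (2 : ℝ) * (1 / 2) = 1 by norm_num, ENNReal.rpow_one] at this
  have hwm : Measurable fun q => ENNReal.ofReal (w q) := ENNReal.measurable_ofReal.comp hw.measurable
  calc ∫⁻ q, ENNReal.ofReal (u q * |ν q e|) ^ (1 / 2 : ℝ) * ENNReal.ofReal (w q) ∂μ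
      ≤ ∫⁻ q, Filter.liminf (fun n => I n q * ENNReal.ofReal (w q)) Filter.atTop ∂μ := by
        refine lintegral_mono fun q => ?_
        refine (mul_le_mul_left (hlim q) _).trans ?_
        refine le_of_eq ?_
        simp_rw [mul_comm _ (ENNReal.ofReal (w q))]
        exact (ENNReal.liminf_const_mul_of_ne_top ENNReal.ofReal_ne_top).symm
    _ ≤ Filter.liminf (fun n => ∫⁻ q, I n q * ENNReal.ofReal (w q) ∂μ) Filter.atTop :=
        lintegral_liminf_le fun n => (hIm n).mul hwm
    _ ≤ Filter.liminf (fun _ : ℕ => gnsConst * ENNReal.ofReal (3 * K) ^ (3 / 2 : ℝ))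
          Filter.atTop := by
        refine Filter.liminf_le_liminf (Filter.Eventually.of_forall fun n => ?_)
        simp only [I]
        rw [lintegral_mollify_rpow (hη n) hfc hw hw0 e]
        exact lintegral_mollify_le (hη n) hf hν hu e hK
    _ = _ := Filter.liminf_const _

theorem abs_coord_le_norm (x : Euc 4) (a : Fin 4) : |x a| ≤ ‖x‖ := by
  rw [← Real.norm_eq_abs]; exact PiLp.norm_apply_le x a

theorem abs_rot_le (hν : IsUnitNormal 3 f ν) (e c : Fin 4) (φ : M → ℝ) (q : M) :
    |rot f ν e c φ q| ≤ 2 * ‖grad f φ q‖ := by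
  have h1 : ∀ a, |ν q a| ≤ 1 := fun a => by
    rw [← hν.norm_eq_one q]; exact abs_coord_le_norm _ _
  have h2 : ∀ a, |grad f φ q a| ≤ ‖grad f φ q‖ := fun a => abs_coord_le_norm _ _
  have h3 : ∀ a b, |ν q a * grad f φ q b| ≤ ‖grad f φ q‖ := fun a b => by
    rw [abs_mul]
    exact (mul_le_of_le_one_left (abs_nonneg _) (h1 a)).trans (h2 b)
  rw [rot]
  refine (abs_sub _ _).trans ?_
  linarith [h3 e c, h3 c e]

/-- Some component satisfies |N_e| ≥ 1/2, and (1/2)^{5/2} ≥ (1/2)³ = 1/8. -/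
theorem one_le_sum_normal_rpow {N : Euc 4} (hN : ‖N‖ = 1) :
    1 ≤ 8 * ∑ e, |N e| ^ (5 / 2 : ℝ) := by
  have h1 : ∑ e, N e ^ 2 = 1 := by
    have := real_inner_self_eq_norm_sq N
    rw [hN, euc_inner] at this
    simpa [sq] using this
  have hle : ∀ e, |N e| ≤ 1 := fun e => by rw [← hN]; exact abs_coord_le_norm _ _
  have h0 : ∀ e, 0 ≤ |N e| ^ (5 / 2 : ℝ) := fun e => Real.rpow_nonneg (abs_nonneg _) _
  obtain ⟨e, he⟩ : ∃ e, 1 / 4 ≤ N e ^ 2 := by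
    by_contra! h
    have := Finset.sum_lt_sum_of_nonempty (s := Finset.univ) Finset.univ_nonempty fun e _ => h e
    rw [h1] at this
    norm_num at this
  have h2 : 1 / 2 ≤ |N e| := by
    refine le_of_sq_le_sq ?_ (abs_nonneg _)
    rw [sq_abs]; norm_num; linarith
  have h3 : (1 : ℝ) / 8 ≤ |N e| ^ (5 / 2 : ℝ) := by
    calc (1 : ℝ) / 8 = (1 / 2) ^ 3 := by norm_num
      _ ≤ |N e| ^ 3 := pow_le_pow_left₀ (by norm_num) h2 3
      _ = |N e| ^ (3 : ℝ) := by rw [← Real.rpow_natCast]; norm_num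
      _ ≤ _ := Real.rpow_le_rpow_of_exponent_ge (by linarith) (hle e) (by norm_num)
  have h4 := Finset.single_le_sum (fun e _ => h0 e) (Finset.mem_univ e)
  linarith

/-- The constant of the Sobolev inequality on hypersurfaces. -/
def sobolevConst : ℝ := 32 * (gnsConst * 6 ^ (3 / 2 : ℝ))

theorem sobolevConst_nonneg : 0 ≤ sobolevConst := by
  have := Real.rpow_nonneg (show (0 : ℝ) ≤ 6 by norm_num) (3 / 2)
  rw [sobolevConst]; positivity

/-- A Sobolev inequality on compact hypersurfaces of `ℝ⁴`, where `B` bounds the second fundamental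
form. -/
theorem sobolev_hypersurface (hf : IsSmoothImmersion 3 f) (hν : IsUnitNormal 3 f ν)
    {u B : M → ℝ} (hu : ChartContDiff 1 u) (hu0 : ∀ q, 0 ≤ u q) (hB : Continuous B)
    (hνB : ∀ e q, ‖grad f (fun x => ν x e) q‖ ≤ B q) :
    ∫ q, u q ^ (3 / 2 : ℝ) ∂inducedVolume 3 f ≤
      sobolevConst * (∫ q, (‖grad f u q‖ + u q * B q) ∂inducedVolume 3 f) ^ (3 / 2 : ℝ) := by
  have := isFiniteMeasure_inducedVolume hf
  set μ := inducedVolume 3 f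
  set K := ∫ q, (‖grad f u q‖ + u q * B q) ∂μ with hKdef
  have hgc : Continuous (grad f u) := (hu.grad hf hν (l' := 0) (by simp) (by simp)).continuous
  have hB0 : ∀ q, 0 ≤ B q := fun q => (norm_nonneg _).trans (hνB 0 q)
  have hK0 : 0 ≤ K := integral_nonneg fun q => by
    have := mul_nonneg (hu0 q) (hB0 q)
    have := norm_nonneg (grad f u q)
    simp only [Pi.zero_apply]; linarith
  have hK : ∀ e c, ∫ q, |rot f ν e c (fun q => u q * ν q e) q| ∂μ ≤ 2 * K := by
    intro e c
    have hν1 := (hν.chartContDiff e).of_le (l' := 1) (by simp)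
    rw [hKdef, ← integral_const_mul]
    refine integral_mono (continuous_integrable (continuous_rot hf hν (hu.mul hν1) e c).abs)
      (continuous_integrable (continuous_const.mul (hgc.norm.add (hu.continuous.mul hB))))
      fun q => ?_
    refine (abs_rot_le hν e c _ q).trans ?_
    refine mul_le_mul_of_nonneg_left ?_ (by norm_num)
    rw [grad_mul hu hν1]
    refine (norm_add_le _ _).trans ?_
    rw [norm_smul, norm_smul, Real.norm_of_nonneg (hu0 q), add_comm]
    refine add_le_add (mul_le_of_le_one_left (norm_nonneg _) ?_)
      (mul_le_mul_of_nonneg_left (hνB e q) (hu0 q))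
    rw [← hν.norm_eq_one q]; exact PiLp.norm_apply_le _ _
  -- Exponents: u receives 1/2 + 1 = 3/2 and |ν_e| receives 1/2 + 2 = 5/2.
  have hpt : ∀ q, ENNReal.ofReal (u q ^ (3 / 2 : ℝ)) ≤ 8 * ∑ e, ENNReal.ofReal (u q * |ν q e|) ^
      (1 / 2 : ℝ) * ENNReal.ofReal (u q * ν q e ^ 2) := by
    intro q
    have h1 : ∀ e, ENNReal.ofReal (u q * |ν q e|) ^ (1 / 2 : ℝ) * ENNReal.ofReal (u q * ν q e ^ 2) =
        ENNReal.ofReal (u q ^ (3 / 2 : ℝ) * |ν q e| ^ (5 / 2 : ℝ)) := by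
      intro e
      have ha := abs_nonneg (ν q e)
      rw [ENNReal.ofReal_rpow_of_nonneg (mul_nonneg (hu0 q) ha) (by norm_num),
        ← ENNReal.ofReal_mul (Real.rpow_nonneg (mul_nonneg (hu0 q) ha) _), Real.mul_rpow (hu0 q) ha,
        ← sq_abs (ν q e), show (3 / 2 : ℝ) = 1 / 2 + 1 by norm_num,
        show (5 / 2 : ℝ) = 1 / 2 + 2 by norm_num, Real.rpow_add_of_nonneg (hu0 q) (by norm_num)
        (by norm_num), Real.rpow_add_of_nonneg ha (by norm_num) (by norm_num), Real.rpow_one,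
        Real.rpow_two]
      congr 1; ring
    have h8 : (8 : ENNReal) = ENNReal.ofReal 8 := by simp
    simp_rw [h1]
    rw [← ENNReal.ofReal_sum_of_nonneg fun e _ => mul_nonneg (Real.rpow_nonneg (hu0 q) _)
      (Real.rpow_nonneg (abs_nonneg _) _), h8, ← ENNReal.ofReal_mul (by norm_num)]
    refine ENNReal.ofReal_le_ofReal ?_
    rw [← Finset.mul_sum, mul_left_comm]
    exact le_mul_of_one_le_right (Real.rpow_nonneg (hu0 q) _)
      (one_le_sum_normal_rpow (hν.norm_eq_one q))
  have hm : ∀ e, Measurable fun q => ENNReal.ofReal (u q * |ν q e|) ^ (1 / 2 : ℝ) *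
      ENNReal.ofReal (u q * ν q e ^ 2) := by
    intro e
    have hνc : Continuous fun q => ν q e := (hν.chartContDiff e).continuous
    exact ((ENNReal.measurable_ofReal.comp (hu.continuous.mul hνc.abs).measurable).pow_const _).mul
      (ENNReal.measurable_ofReal.comp (hu.continuous.mul (hνc.pow 2)).measurable)
  have hui : Continuous fun q => u q ^ (3 / 2 : ℝ) :=
    hu.continuous.rpow_const fun q => Or.inr (by norm_num)
  rw [← ENNReal.ofReal_le_ofReal_iff (mul_nonneg sobolevConst_nonneg (Real.rpow_nonneg hK0 _)),
    ofReal_integral_eq_lintegral_ofReal (continuous_integrable hui)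
    (Filter.Eventually.of_forall fun q => Real.rpow_nonneg (hu0 q) _)]
  refine (lintegral_mono hpt).trans ?_
  rw [lintegral_const_mul _ (Finset.measurable_fun_sum _ fun e _ => hm e),
    lintegral_finsetSum _ fun e _ => hm e]
  refine (mul_le_mul_right (Finset.sum_le_sum fun e _ =>
    lintegral_rpow_mul_normal_le hf hν hu hu0 e (hK e)) _).trans (le_of_eq ?_)
  -- Origin of `sobolevConst`: 32 is the pointwise factor 8 times 4 directions, and 6 is 3 partial
  -- derivatives times the 2 of `abs_rot_le`.
  rw [Finset.sum_const, Finset.card_univ, Fintype.card_fin, nsmul_eq_mul, sobolevConst,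
    ← mul_assoc 3 2 K, ENNReal.ofReal_rpow_of_nonneg (by positivity) (by norm_num),
    Real.mul_rpow (by norm_num) hK0, ENNReal.ofReal_mul (Real.rpow_nonneg (by norm_num) _),
    ENNReal.ofReal_mul (by positivity), ENNReal.ofReal_mul (by norm_num),
    ENNReal.ofReal_mul (by positivity), ENNReal.ofReal_coe_nnreal]
  norm_num
  ring

end Sobolev

/-! ### Algebraic identities for the unit normal. -/

section Normal

variable {M : Type*} [TopologicalSpace M] [ChartedSpace (Euc 3) M] [IsManifold (𝓡 3) ∞ M]
  {f ν : M → Euc 4}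

theorem sum_normal_mul_grad (hf : IsSmoothImmersion 3 f) (hν : IsUnitNormal 3 f ν) (h : M → ℝ)
    (q : M) : ∑ a, ν q a * grad f h q a = 0 := by
  rw [← euc_inner, real_inner_comm]; exact inner_grad_normal hf hν h q

theorem sum_normal_sq (hν : IsUnitNormal 3 f ν) (q : M) : ∑ a, ν q a * ν q a = 1 := by
  rw [← euc_inner, real_inner_self_eq_norm_sq, hν.norm_eq_one]; norm_num

/-- The derivative of |ν|² = 1. -/
theorem sum_normal_mul_grad_normal (hν : IsUnitNormal 3 f ν) (q : M) (c : Fin 4) :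
    ∑ e, ν q e * grad f (fun x => ν x e) q c = 0 := by
  have hν1 := fun e => (hν.chartContDiff e).of_le (l' := 1) (by simp)
  have h1 : grad f (fun x => ∑ e, ν x e * ν x e) q = 0 := by
    simp_rw [sum_normal_sq hν]
    exact grad_const 1 q
  rw [grad_sum fun e _ => (hν1 e).mul (hν1 e)] at h1
  simp_rw [fun e => grad_mul (hν1 e) (hν1 e) (f := f) q] at h1
  have h2 := congrArg (fun w : Euc 4 => w c) h1
  simp only [WithLp.ofLp_sum, Finset.sum_apply, PiLp.add_apply, PiLp.smul_apply, smul_eq_mul,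
    PiLp.zero_apply, Finset.sum_add_distrib] at h2
  linarith

end Normal

/-! ### The divergence theorem. -/

section Divergence

variable {M : Type*} [TopologicalSpace M] [T2Space M] [CompactSpace M] [ChartedSpace (Euc 3) M]
  [IsManifold (𝓡 3) ∞ M] [MeasurableSpace M] [BorelSpace M] {f ν : M → Euc 4}

/-- The divergence theorem for tangential vector fields. -/
theorem integral_divergence_eq_zero (hf : IsSmoothImmersion 3 f) (hν : IsUnitNormal 3 f ν)
    {W : Fin 4 → M → ℝ} (hW : ∀ c, ChartContDiff 1 (W c)) (hWν : ∀ q, ∑ c, ν q c * W c q = 0) :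
    ∫ q, ∑ c, grad f (W c) q c ∂inducedVolume 3 f = 0 := by
  have := isFiniteMeasure_inducedVolume hf
  have hν1 := fun e => (hν.chartContDiff e).of_le (l' := 1) (by simp)
  -- By the product rule the main term is |ν|² times the divergence; the others vanish by ν·W = 0,
  -- ν·∇W_c = 0 and ∑ ν_e∇ν_e = 0.
  have key : ∀ q, ∑ c, grad f (W c) q c =
      ∑ e, ∑ c, rot f ν e c (fun x => ν x e * W c x) q := by
    intro q
    have h1 : ∀ e c, rot f ν e c (fun x => ν x e * W c x) q =
        (ν q e * ν q e) * grad f (W c) q c + W c q * (ν q e * grad f (fun x => ν x e) q c)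
          - (ν q c * W c q) * grad f (fun x => ν x e) q e
          - ν q c * (ν q e * grad f (W c) q e) := by
      intro e c
      simp only [rot, grad_mul (hν1 e) (hW c), PiLp.add_apply, PiLp.smul_apply, smul_eq_mul]
      ring
    simp_rw [h1, Finset.sum_sub_distrib, Finset.sum_add_distrib]
    simp_rw [← Finset.sum_mul, hWν, zero_mul, Finset.sum_const_zero]
    simp_rw [← Finset.mul_sum]
    rw [← Finset.sum_mul, sum_normal_sq hν, one_mul]
    have h2 : ∑ e, ∑ c, W c q * (ν q e * grad f (fun x => ν x e) q c) = 0 := by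
      rw [Finset.sum_comm]
      simp_rw [← Finset.mul_sum, sum_normal_mul_grad_normal hν, mul_zero, Finset.sum_const_zero]
    have h3 : ∑ e, ∑ c, ν q c * (ν q e * grad f (W c) q e) = 0 := by
      rw [Finset.sum_comm]
      simp_rw [← Finset.mul_sum, sum_normal_mul_grad hf hν, mul_zero, Finset.sum_const_zero]
    rw [h2, h3]; ring
  simp_rw [key]
  have hi : ∀ e c, Integrable (rot f ν e c fun x => ν x e * W c x) (inducedVolume 3 f) :=
    fun e c => continuous_integrable (continuous_rot hf hν ((hν1 e).mul (hW c)) e c)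
  rw [integral_finsetSum _ fun e _ => integrable_finsetSum _ fun c _ => hi e c]
  refine Finset.sum_eq_zero fun e _ => ?_
  rw [integral_finsetSum _ fun c _ => hi e c]
  exact Finset.sum_eq_zero fun c _ => integral_rot_eq_zero hf hν ((hν1 e).mul (hW c)) e c

end Divergence

/-! ### The derivatives of A as global ambient tensors. -/

section Tensor

variable {k : ℕ} {M : Type*} [TopologicalSpace M] [ChartedSpace (Euc 3) M]

/-- The orthogonal projection onto the tangent space, in terms of the unit normal. -/
def tangentProj (ν : M → Euc 4) (a b : Fin 4) (q : M) : ℝ :=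
  (if a = b then 1 else 0) - ν q a * ν q b

/-- The covariant derivative of a tangential tensor given by its ambient components. -/
def ambientCovDeriv (f ν : M → Euc 4) (S : (Fin k → Fin 4) → M → ℝ) (α : Fin (k + 1) → Fin 4)
    (q : M) : ℝ :=
  ∑ β : Fin k → Fin 4, (∏ a, tangentProj ν (α a.succ) (β a) q) * grad f (S β) q (α 0)

/-- The ambient components of `∇_{(j)} A`. -/
def covShape (f ν : M → Euc 4) : (j : ℕ) → (Fin (2 + j) → Fin 4) → M → ℝ
  | 0 => fun α q => grad f (fun x => ν x (α 1)) q (α 0)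
  | j + 1 => ambientCovDeriv f ν (covShape f ν j)

variable [IsManifold (𝓡 3) ∞ M] {f ν : M → Euc 4}

theorem chartContDiff_tangentProj (hν : IsUnitNormal 3 f ν) (a b : Fin 4) :
    ChartContDiff ∞ (tangentProj ν a b) :=
  (ChartContDiff.const _).sub ((hν.chartContDiff a).mul (hν.chartContDiff b))

theorem chartContDiff_ambientCovDeriv (hf : IsSmoothImmersion 3 f) (hν : IsUnitNormal 3 f ν)
    {S : (Fin k → Fin 4) → M → ℝ} (hS : ∀ α, ChartContDiff ∞ (S α)) (α : Fin (k + 1) → Fin 4) :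
    ChartContDiff ∞ (ambientCovDeriv f ν S α) :=
  ChartContDiff.sum fun β _ => (ChartContDiff.prod fun _ _ =>
    chartContDiff_tangentProj hν _ _).mul ((hS β).grad_coord hf hν infty_add_one_le le_rfl _)

theorem chartContDiff_covShape (hf : IsSmoothImmersion 3 f) (hν : IsUnitNormal 3 f ν) :
    ∀ (j : ℕ) (α : Fin (2 + j) → Fin 4), ChartContDiff ∞ (covShape f ν j α)
  | 0, _ => (hν.chartContDiff _).grad_coord hf hν infty_add_one_le le_rfl _
  | j + 1, α => chartContDiff_ambientCovDeriv hf hν (chartContDiff_covShape hf hν j) α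

/-- The induction step that identifies the iterated coordinate derivatives with `covShape`: both the
projection and the gradient have chart-free descriptions. -/
theorem inChart_ambientCovDeriv (hf : IsSmoothImmersion 3 f) (hν : IsUnitNormal 3 f ν)
    {S : (Fin k → Fin 4) → M → ℝ} (hS : ∀ α, ChartContDiff ∞ (S α)) (p : M) {T : Comp 3 k}
    (hT : ∀ I, ContDiffOn ℝ ∞ (T I) (chartAt (Euc 3) p).target)
    (hTS : ∀ β, ∀ v ∈ (chartAt (Euc 3) p).target,
      lift (inChart (n := 3) f p) T β v = inChart (n := 3) (S β) p v)
    (α : Fin (k + 1) → Fin 4) {v : Euc 3} (hv : v ∈ (chartAt (Euc 3) p).target) :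
    lift (inChart (n := 3) f p) (covDeriv (inChart f p) T) α v =
      inChart (n := 3) (ambientCovDeriv f ν S α) p v := by
  have hF := hf.isLocalImmersion p
  have hN := hν.isLocalNormal hf p
  rw [lift_covDeriv hF hv hT]
  simp only [inChart, Function.comp_apply, ambientCovDeriv]
  refine Finset.sum_congr rfl fun β _ => ?_
  have h1 : tgrad (inChart (n := 3) f p) (lift (inChart (n := 3) f p) T β) v =
      grad f (S β) ((chartAt (Euc 3) p).symm v) := by
    have h2 := inChart_grad hf hν ((hS β).of_le (by simp)) p hv
    have h3 : lift (inChart (n := 3) f p) T β =ᶠ[nhds v] inChart (n := 3) (S β) p := by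
      filter_upwards [hF.isOpen.mem_nhds hv] with w hw using hTS β w hw
    rw [tgrad_congr h3, ← h2]; rfl
  congr 1
  · refine Finset.prod_congr rfl fun a _ => ?_
    exact tproj_eq hF hN hv _ _
  · exact congrArg (fun w : Euc 4 => w (α 0)) h1

theorem contDiffOn_secondFF (hf : IsSmoothImmersion 3 f) (hν : IsUnitNormal 3 f ν) (p : M)
    (I : Fin 2 → Fin 3) :
    ContDiffOn ℝ ∞ (secondFF (inChart (n := 3) f p) (inChart ν p) I) (chartAt (Euc 3) p).target := by
  have hF := hf.isLocalImmersion p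
  exact ((contDiffOn_pderiv hF.isOpen (hF.contDiffOn_pderiv (I 1)) infty_add_one_le (I 0)).inner ℝ
    (hν.isLocalNormal hf p).contDiffOn).neg

theorem contDiffOn_iterCovDeriv (hf : IsSmoothImmersion 3 f) (hν : IsUnitNormal 3 f ν) (p : M) :
    ∀ (j : ℕ) (I : Fin (2 + j) → Fin 3),
      ContDiffOn ℝ ∞ (iterCovDeriv (inChart (n := 3) f p)
        (secondFF (inChart f p) (inChart ν p)) j I) (chartAt (Euc 3) p).target
  | 0, I => contDiffOn_secondFF hf hν p I
  | j + 1, I => (hf.isLocalImmersion p).contDiffOn_covDeriv (contDiffOn_iterCovDeriv hf hν p j) I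

theorem inChart_covShape (hf : IsSmoothImmersion 3 f) (hν : IsUnitNormal 3 f ν) (p : M) :
    ∀ (j : ℕ) (α : Fin (2 + j) → Fin 4), ∀ v ∈ (chartAt (Euc 3) p).target,
      lift (inChart (n := 3) f p) (iterCovDeriv (inChart (n := 3) f p)
        (secondFF (inChart f p) (inChart ν p)) j) α v = inChart (n := 3) (covShape f ν j α) p v
  | 0, α, v, hv => by
    have h1 := lift_secondFF (hf.isLocalImmersion p) (hν.isLocalNormal hf p) hv α
    have h2 := inChart_grad hf hν ((hν.chartContDiff (α 1)).of_le (by simp)) p hv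
    refine h1.trans ?_
    exact congrArg (fun w : Euc 4 => w (α 0)) h2.symm
  | j + 1, α, v, hv => inChart_ambientCovDeriv hf hν (chartContDiff_covShape hf hν j) p
    (contDiffOn_iterCovDeriv hf hν p j) (inChart_covShape hf hν p j) α hv

theorem normCovDerivA_eq (hf : IsSmoothImmersion 3 f) (hν : IsUnitNormal 3 f ν) (j : ℕ) (q : M) :
    normCovDerivA (n := 3) f ν j q = Real.sqrt (∑ α, covShape f ν j α q ^ 2) := by
  have hv := mem_chart_target (Euc 3) q
  rw [normCovDerivA, normSq_eq_sum_lift ((hf.isLocalImmersion q).isUnit_det _ hv)]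
  congr 1
  refine Finset.sum_congr rfl fun α _ => ?_
  rw [inChart_covShape hf hν q j α _ hv, inChart, Function.comp_apply,
    (chartAt (Euc 3) q).left_inv (mem_chart_source _ q)]

theorem normCovDerivA_sq (hf : IsSmoothImmersion 3 f) (hν : IsUnitNormal 3 f ν) (j : ℕ) (q : M) :
    normCovDerivA (n := 3) f ν j q ^ 2 = ∑ α, covShape f ν j α q ^ 2 := by
  rw [normCovDerivA_eq hf hν, Real.sq_sqrt (Finset.sum_nonneg fun _ _ => sq_nonneg _)]

theorem continuous_normCovDerivA (hf : IsSmoothImmersion 3 f) (hν : IsUnitNormal 3 f ν) (j : ℕ) :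
    Continuous (normCovDerivA (n := 3) f ν j) := by
  rw [show normCovDerivA (n := 3) f ν j = fun q => Real.sqrt (∑ α, covShape f ν j α q ^ 2) from
    funext fun q => normCovDerivA_eq hf hν j q]
  exact Real.continuous_sqrt.comp (continuous_finsetSum _ fun α _ =>
    (chartContDiff_covShape hf hν j α).continuous.pow 2)

theorem normGrad_eq (hf : IsSmoothImmersion 3 f) (h : M → ℝ) (q : M) :
    normGrad (n := 3) f h q = ‖grad f h q‖ := by
  have hv := mem_chart_target (Euc 3) q
  rw [normGrad, normSq_eq_sum_lift ((hf.isLocalImmersion q).isUnit_det _ hv),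
    EuclideanSpace.norm_eq]
  congr 1
  rw [sum_fin_succ_fun]
  refine Finset.sum_congr rfl fun a _ => ?_
  rw [Fintype.sum_unique, lift, sum_fin_succ_fun, Real.norm_eq_abs, sq_abs, grad, tgrad_apply]
  congr 1
  refine Finset.sum_congr rfl fun i _ => ?_
  rw [Fintype.sum_unique]
  simp [mul_comm]

end Tensor

/-! ### Bochner-type identities for tangential tensors. -/

section TensorIdentities

variable {k : ℕ} {M : Type*} [TopologicalSpace M] [ChartedSpace (Euc 3) M]
  [IsManifold (𝓡 3) ∞ M] {f ν : M → Euc 4}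

theorem tangentProj_symm (ν : M → Euc 4) (a b : Fin 4) (q : M) :
    tangentProj ν a b q = tangentProj ν b a q := by
  simp only [tangentProj, eq_comm (a := a), mul_comm (ν q a)]

theorem sum_tangentProj_mul {x : Fin 4 → ℝ} {q : M} (hx : ∑ b, ν q b * x b = 0) (a : Fin 4) :
    ∑ b, tangentProj ν a b q * x b = x a := by
  simp only [tangentProj, sub_mul, Finset.sum_sub_distrib, mul_assoc]
  rw [← Finset.mul_sum, hx]; simp

theorem sum_tangentProj_mul_tangentProj (hν : IsUnitNormal 3 f ν) (a c : Fin 4) (q : M) :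
    ∑ b, tangentProj ν a b q * tangentProj ν b c q = tangentProj ν a c q := by
  refine sum_tangentProj_mul (x := fun b => tangentProj ν b c q) ?_ a
  simp only [tangentProj, mul_sub, Finset.sum_sub_distrib, ← mul_assoc]
  rw [← Finset.sum_mul, sum_normal_sq hν]; simp

/-- The projection of a tensor of rank `k` onto the tangential ones, as a matrix. -/
def tensorProj (ν : M → Euc 4) (α β : Fin k → Fin 4) (q : M) : ℝ :=
  ∏ a, tangentProj ν (α a) (β a) q

theorem tensorProj_symm (ν : M → Euc 4) (α β : Fin k → Fin 4) (q : M) :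
    tensorProj ν α β q = tensorProj ν β α q :=
  Finset.prod_congr rfl fun _ _ => tangentProj_symm _ _ _ _

theorem sum_tensorProj_mul_tensorProj (hν : IsUnitNormal 3 f ν) (α γ : Fin k → Fin 4) (q : M) :
    ∑ β, tensorProj ν α β q * tensorProj ν β γ q = tensorProj ν α γ q := by
  simp_rw [tensorProj, ← Finset.prod_mul_distrib]
  rw [sum_fun_prod fun (a : Fin k) (b : Fin 4) =>
    tangentProj ν (α a) b q * tangentProj ν b (γ a) q]
  simp_rw [sum_tangentProj_mul_tangentProj hν]

theorem ambientCovDeriv_cons (S : (Fin k → Fin 4) → M → ℝ) (c : Fin 4) (α : Fin k → Fin 4)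
    (q : M) : ambientCovDeriv f ν S (Fin.cons c α) q =
      ∑ β, tensorProj ν α β q * grad f (S β) q c := rfl

theorem tensorProj_cons (ν : M → Euc 4) (c d : Fin 4) (α β : Fin k → Fin 4) (q : M) :
    tensorProj ν (Fin.cons c α : Fin (k + 1) → Fin 4) (Fin.cons d β) q =
      tangentProj ν c d q * tensorProj ν α β q := by
  simp [tensorProj, Fin.prod_univ_succ]

/-- The tensor is tangential in all slots. -/
def IsTangential (ν : M → Euc 4) (S : (Fin k → Fin 4) → M → ℝ) : Prop :=
  ∀ α q, ∑ β, tensorProj ν α β q * S β q = S α q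

theorem IsTangential.sum_mul {S : (Fin k → Fin 4) → M → ℝ} (hS : IsTangential ν S) (β : Fin k → Fin 4)
    (q : M) : ∑ α, S α q * tensorProj ν α β q = S β q := by
  rw [← hS β q]
  exact Finset.sum_congr rfl fun α _ => by rw [tensorProj_symm, mul_comm]

/-- The contraction `⟨S, ∇_c S⟩`. -/
def pairing (f ν : M → Euc 4) (S : (Fin k → Fin 4) → M → ℝ) (c : Fin 4) (q : M) : ℝ :=
  ∑ α, S α q * ambientCovDeriv f ν S (Fin.cons c α) q

/-- The squared norm of a tensor given by its ambient components. -/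
def tensorSq (S : (Fin k → Fin 4) → M → ℝ) (q : M) : ℝ := ∑ α, S α q ^ 2

theorem tensorSq_nonneg (S : (Fin k → Fin 4) → M → ℝ) (q : M) : 0 ≤ tensorSq S q :=
  Finset.sum_nonneg fun _ _ => sq_nonneg _

theorem ChartContDiff.tensorSq {S : (Fin k → Fin 4) → M → ℝ} {l : WithTop ℕ∞}
    (hS : ∀ α, ChartContDiff l (S α)) : ChartContDiff l (tensorSq S) :=
  fun p => ContDiffOn.sum fun α _ => (hS α p).pow 2

variable {S : (Fin k → Fin 4) → M → ℝ}

/-- The projection inside ∇S is symmetric and fixes S, so it may be dropped against S. -/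
theorem pairing_eq (hS : IsTangential ν S) (c : Fin 4) (q : M) :
    pairing f ν S c q = ∑ β, S β q * grad f (S β) q c := by
  simp_rw [pairing, ambientCovDeriv_cons, Finset.mul_sum]
  rw [Finset.sum_comm]
  refine Finset.sum_congr rfl fun β _ => ?_
  simp_rw [← mul_assoc]
  rw [← Finset.sum_mul, hS.sum_mul]

theorem grad_tensorSq (hSd : ∀ α, ChartContDiff 1 (S α)) (hS : IsTangential ν S) (c : Fin 4)
    (q : M) : grad f (tensorSq S) q c = 2 * pairing f ν S c q := by
  have h1 : tensorSq S = fun x => ∑ α, S α x * S α x := by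
    ext x; simp only [tensorSq, sq]
  rw [h1, grad_sum fun α _ => (hSd α).mul (hSd α), pairing_eq hS]
  simp_rw [fun α => grad_mul (hSd α) (hSd α) (f := f) q]
  simp only [WithLp.ofLp_sum, Finset.sum_apply, PiLp.add_apply, PiLp.smul_apply, smul_eq_mul,
    Finset.mul_sum]
  exact Finset.sum_congr rfl fun α _ => by ring

/-- With Π the orthogonal projection, symmetric and idempotent, ⟨∂S, Π∂S⟩ = |Π∂S|². -/
theorem sum_grad_mul_ambientCovDeriv (hν : IsUnitNormal 3 f ν) (q : M) :
    ∑ c, ∑ α, grad f (S α) q c * ambientCovDeriv f ν S (Fin.cons c α) q =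
      tensorSq (ambientCovDeriv f ν S) q := by
  rw [tensorSq, sum_fin_succ_fun]
  refine Finset.sum_congr rfl fun c _ => ?_
  have h1 : ∀ α, ambientCovDeriv f ν S (Fin.cons c α) q ^ 2 = ∑ β, ∑ γ,
      grad f (S β) q c * grad f (S γ) q c * (tensorProj ν β α q * tensorProj ν α γ q) := by
    intro α
    rw [ambientCovDeriv_cons, sq, Finset.sum_mul_sum]
    refine Finset.sum_congr rfl fun β _ => Finset.sum_congr rfl fun γ _ => ?_
    rw [tensorProj_symm ν β α]; ring
  simp_rw [h1]
  rw [Finset.sum_comm]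
  refine Finset.sum_congr rfl fun β _ => ?_
  rw [Finset.sum_comm, ambientCovDeriv_cons, Finset.mul_sum]
  refine Finset.sum_congr rfl fun γ _ => ?_
  rw [← Finset.mul_sum, sum_tensorProj_mul_tensorProj hν]; ring

/-- The trace of ∇²S paired with S. The projection of the inner derivative slot is absorbed by the
gradient, which is already tangential, and the projections of the other slots are absorbed by S. -/
theorem sum_mul_grad_ambientCovDeriv (hf : IsSmoothImmersion 3 f) (hν : IsUnitNormal 3 f ν)
    (hS : IsTangential ν S) (q : M) :
    ∑ c, ∑ α, S α q * ambientCovDeriv f ν (ambientCovDeriv f ν S) (Fin.cons c (Fin.cons c α)) q =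
      ∑ c, ∑ α, S α q * grad f (ambientCovDeriv f ν S (Fin.cons c α)) q c := by
  simp_rw [ambientCovDeriv_cons (ambientCovDeriv f ν S), sum_fin_succ_fun (k := k), tensorProj_cons,
    Finset.mul_sum]
  rw [Finset.sum_comm]
  have h1 : ∀ α : Fin k → Fin 4, ∑ c, ∑ d, ∑ β, S α q * (tangentProj ν c d q *
      tensorProj ν α β q * grad f (ambientCovDeriv f ν S (Fin.cons d β)) q c) =
      ∑ d, ∑ β, S α q * tensorProj ν α β q *
        grad f (ambientCovDeriv f ν S (Fin.cons d β)) q d := by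
    intro α
    rw [Finset.sum_comm]
    refine Finset.sum_congr rfl fun d _ => ?_
    rw [Finset.sum_comm]
    refine Finset.sum_congr rfl fun β _ => ?_
    rw [← sum_tangentProj_mul (x := fun c => grad f (ambientCovDeriv f ν S (Fin.cons d β)) q c)
      (sum_normal_mul_grad hf hν _ q) d, Finset.mul_sum]
    refine Finset.sum_congr rfl fun c _ => ?_
    rw [tangentProj_symm ν c d]; ring
  simp_rw [h1]
  rw [Finset.sum_comm]
  refine Finset.sum_congr rfl fun d _ => ?_
  rw [Finset.sum_comm]
  refine Finset.sum_congr rfl fun β _ => ?_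
  rw [← Finset.sum_mul, hS.sum_mul]

/-- Cauchy–Schwarz over pairs (c, α); |S|² is counted once for each of the 4 values of c, whence 2 =
√4. The diagonal entries of ∇²S are part of its norm. -/
theorem abs_trace_le (q : M) :
    |∑ c, ∑ α, S α q * ambientCovDeriv f ν (ambientCovDeriv f ν S) (Fin.cons c (Fin.cons c α)) q| ≤
      2 * Real.sqrt (tensorSq S q) *
        Real.sqrt (tensorSq (ambientCovDeriv f ν (ambientCovDeriv f ν S)) q) := by
  set T := ambientCovDeriv f ν (ambientCovDeriv f ν S)
  refine abs_le_of_sq_le_sq ?_ (by positivity)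
  rw [mul_pow, mul_pow, Real.sq_sqrt (tensorSq_nonneg _ _), Real.sq_sqrt (tensorSq_nonneg _ _)]
  simp_rw [← Fintype.sum_prod_type' fun (c : Fin 4) (α : Fin k → Fin 4) =>
    S α q * T (Fin.cons c (Fin.cons c α)) q]
  refine (Finset.sum_mul_sq_le_sq_mul_sq _ _ _).trans ?_
  refine mul_le_mul (le_of_eq ?_) ?_ (Finset.sum_nonneg fun _ _ => sq_nonneg _)
    (mul_nonneg (by norm_num) (tensorSq_nonneg _ _))
  · rw [Fintype.sum_prod_type]
    simp only [Finset.sum_const, Finset.card_univ, Fintype.card_fin, nsmul_eq_mul, tensorSq]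
    norm_num
  · rw [Fintype.sum_prod_type, tensorSq, sum_fin_succ_fun]
    refine Finset.sum_le_sum fun c _ => ?_
    rw [sum_fin_succ_fun]
    exact Finset.single_le_sum (f := fun d => ∑ α : Fin k → Fin 4, T (Fin.cons c (Fin.cons d α)) q ^ 2)
      (fun d _ => Finset.sum_nonneg fun _ _ => sq_nonneg _) (Finset.mem_univ c)

theorem sum_pairing_sq_le (q : M) : ∑ c, pairing f ν S c q ^ 2 ≤
    tensorSq S q * tensorSq (ambientCovDeriv f ν S) q := by
  rw [tensorSq, tensorSq, sum_fin_succ_fun, Finset.mul_sum]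
  exact Finset.sum_le_sum fun c _ => Finset.sum_mul_sq_le_sq_mul_sq _ _ _

theorem abs_sum_pairing_mul_le (w : Euc 4) (q : M) : |∑ c, pairing f ν S c q * w c| ≤
    Real.sqrt (tensorSq S q) * Real.sqrt (tensorSq (ambientCovDeriv f ν S) q) * ‖w‖ := by
  refine abs_le_of_sq_le_sq ?_ (by positivity)
  rw [mul_pow, mul_pow, Real.sq_sqrt (tensorSq_nonneg _ _), Real.sq_sqrt (tensorSq_nonneg _ _)]
  refine (Finset.sum_mul_sq_le_sq_mul_sq _ _ _).trans ?_
  have h : ‖w‖ ^ 2 = ∑ c, w c ^ 2 := by rw [EuclideanSpace.norm_sq_eq]; simp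
  rw [h]
  exact mul_le_mul_of_nonneg_right (sum_pairing_sq_le q) (Finset.sum_nonneg fun _ _ => sq_nonneg _)

theorem norm_grad_tensorSq_le (hSd : ∀ α, ChartContDiff 1 (S α)) (hS : IsTangential ν S) (q : M) :
    ‖grad f (tensorSq S) q‖ ≤
      2 * (Real.sqrt (tensorSq S q) * Real.sqrt (tensorSq (ambientCovDeriv f ν S) q)) := by
  refine le_of_sq_le_sq ?_ (by positivity)
  rw [EuclideanSpace.norm_sq_eq, mul_pow, mul_pow, Real.sq_sqrt (tensorSq_nonneg _ _),
    Real.sq_sqrt (tensorSq_nonneg _ _)]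
  simp_rw [Real.norm_eq_abs, sq_abs, grad_tensorSq hSd hS, mul_pow]
  rw [← Finset.mul_sum]
  exact mul_le_mul_of_nonneg_left (sum_pairing_sq_le q) (by norm_num)

variable [T2Space M] [CompactSpace M] [MeasurableSpace M] [BorelSpace M]

theorem chartContDiff_pairing (hf : IsSmoothImmersion 3 f) (hν : IsUnitNormal 3 f ν)
    (hSd : ∀ α, ChartContDiff ∞ (S α)) (c : Fin 4) : ChartContDiff ∞ (pairing f ν S c) :=
  ChartContDiff.sum fun α _ => (hSd α).mul (chartContDiff_ambientCovDeriv hf hν hSd _)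

theorem sum_grad_pairing_mul (hf : IsSmoothImmersion 3 f) (hν : IsUnitNormal 3 f ν)
    (hSd : ∀ α, ChartContDiff ∞ (S α)) (hS : IsTangential ν S) {g : M → ℝ} (hg : ChartContDiff 1 g)
    (q : M) : ∑ c, grad f (fun x => pairing f ν S c x * (tensorSq S x * g x)) q c =
      (tensorSq (ambientCovDeriv f ν S) q + ∑ c, ∑ α, S α q *
        ambientCovDeriv f ν (ambientCovDeriv f ν S) (Fin.cons c (Fin.cons c α)) q) *
        (tensorSq S q * g q) + 2 * (∑ c, pairing f ν S c q ^ 2) * g q +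
        tensorSq S q * ∑ c, pairing f ν S c q * grad f g q c := by
  have hSd1 : ∀ α, ChartContDiff 1 (S α) := fun α => (hSd α).of_le (by simp)
  have hT1 : ∀ α, ChartContDiff 1 (ambientCovDeriv f ν S α) := fun α =>
    (chartContDiff_ambientCovDeriv hf hν hSd α).of_le (by simp)
  have hP1 : ∀ c, ChartContDiff 1 (pairing f ν S c) := fun c =>
    (chartContDiff_pairing hf hν hSd c).of_le (by simp)
  have hQ1 : ChartContDiff 1 (tensorSq S) := ChartContDiff.tensorSq hSd1
  have h1 : ∀ c, grad f (pairing f ν S c) q c =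
      ∑ α, grad f (S α) q c * ambientCovDeriv f ν S (Fin.cons c α) q +
      ∑ α, S α q * grad f (ambientCovDeriv f ν S (Fin.cons c α)) q c := by
    intro c
    have h2 : pairing f ν S c =
      fun x => ∑ α, S α x * ambientCovDeriv f ν S (Fin.cons c α) x := rfl
    rw [h2, grad_sum fun α _ => (hSd1 α).mul (hT1 _)]
    simp_rw [fun α => grad_mul (hSd1 α) (hT1 (Fin.cons c α)) (f := f) q]
    simp only [WithLp.ofLp_sum, Finset.sum_apply, PiLp.add_apply, PiLp.smul_apply, smul_eq_mul]
    rw [← Finset.sum_add_distrib]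
    exact Finset.sum_congr rfl fun α _ => by ring
  rw [sum_mul_grad_ambientCovDeriv hf hν hS, ← sum_grad_mul_ambientCovDeriv hν (S := S),
    ← Finset.sum_add_distrib]
  simp_rw [← h1]
  simp_rw [fun c => grad_mul (hP1 c) (hQ1.mul hg) (f := f) q, grad_mul hQ1 hg]
  simp only [PiLp.add_apply, PiLp.smul_apply, smul_eq_mul, grad_tensorSq hSd1 hS]
  rw [Finset.sum_mul, Finset.mul_sum, Finset.sum_mul, Finset.mul_sum, ← Finset.sum_add_distrib,
    ← Finset.sum_add_distrib]
  exact Finset.sum_congr rfl fun c _ => by ring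

/-- The divergence theorem for ⟨S, ∇S⟩|S|²g, a multiple of ∇|S|² and hence tangential. The term
2|⟨S, ∇S⟩|²g has the favourable sign and is dropped. -/
theorem integral_tensorSq_mul_le (hf : IsSmoothImmersion 3 f) (hν : IsUnitNormal 3 f ν)
    (hSd : ∀ α, ChartContDiff ∞ (S α)) (hS : IsTangential ν S) {g : M → ℝ} (hg : ChartContDiff 1 g)
    (hg0 : ∀ q, 0 ≤ g q) :
    ∫ q, tensorSq (ambientCovDeriv f ν S) q * tensorSq S q * g q ∂inducedVolume 3 f ≤
      ∫ q, (2 * Real.sqrt (tensorSq S q) *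
        Real.sqrt (tensorSq (ambientCovDeriv f ν (ambientCovDeriv f ν S)) q) * tensorSq S q * g q +
        tensorSq S q * (Real.sqrt (tensorSq S q) *
          Real.sqrt (tensorSq (ambientCovDeriv f ν S) q) * ‖grad f g q‖)) ∂inducedVolume 3 f := by
  have := isFiniteMeasure_inducedVolume hf
  have hTd := fun α => chartContDiff_ambientCovDeriv hf hν hSd α
  have hT2d := fun α => chartContDiff_ambientCovDeriv hf hν hTd α
  have c0 := (ChartContDiff.tensorSq hSd).continuous
  have c1 := (ChartContDiff.tensorSq hTd).continuous
  have c2 := (ChartContDiff.tensorSq hT2d).continuous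
  have cg := hg.continuous
  have cgg : Continuous (grad f g) := (hg.grad hf hν (l' := 0) (by simp) (by simp)).continuous
  have hP1 : ∀ c, ChartContDiff 1 (pairing f ν S c) := fun c =>
    (chartContDiff_pairing hf hν hSd c).of_le (by simp)
  have hQ1 : ChartContDiff 1 (tensorSq S) := (ChartContDiff.tensorSq hSd).of_le (by simp)
  have hW : ∀ c, ChartContDiff 1 fun x => pairing f ν S c x * (tensorSq S x * g x) := fun c =>
    (hP1 c).mul (hQ1.mul hg)
  have hdiv := integral_divergence_eq_zero hf hν hW fun q => by
    have h1 : ∀ c, ν q c * (pairing f ν S c q * (tensorSq S q * g q)) =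
        (1 / 2 * (tensorSq S q * g q)) * (ν q c * grad f (tensorSq S) q c) := fun c => by
      rw [grad_tensorSq (fun α => (hSd α).of_le (by simp)) hS]; ring
    simp_rw [h1]
    rw [← Finset.mul_sum, sum_normal_mul_grad hf hν, mul_zero]
  have hdc : Continuous fun q =>
      ∑ c, grad f (fun x => pairing f ν S c x * (tensorSq S x * g x)) q c :=
    continuous_finsetSum _ fun c _ =>
      ((hW c).grad_coord hf hν (l' := 0) (by simp) (by simp) c).continuous
  have hi1 : Integrable (fun q => tensorSq (ambientCovDeriv f ν S) q * tensorSq S q * g q)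
      (inducedVolume 3 f) := continuous_integrable ((c1.mul c0).mul cg)
  have hi2 := continuous_integrable (μ := inducedVolume 3 f) hdc
  rw [← sub_zero (∫ q, tensorSq (ambientCovDeriv f ν S) q * tensorSq S q * g q ∂inducedVolume 3 f),
    ← hdiv, ← integral_sub hi1 hi2]
  refine integral_mono (hi1.sub hi2) (continuous_integrable ?_) fun q => ?_
  · exact ((((continuous_const.mul c0.sqrt).mul c2.sqrt).mul c0).mul cg).add
      (c0.mul ((c0.sqrt.mul c1.sqrt).mul cgg.norm))
  · simp only [sum_grad_pairing_mul hf hν hSd hS hg]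
    have h1 := neg_le_of_abs_le (abs_trace_le (f := f) (ν := ν) (S := S) q)
    have h2 := neg_le_of_abs_le (abs_sum_pairing_mul_le (f := f) (ν := ν) (S := S) (grad f g q) q)
    have h3 := mul_nonneg (tensorSq_nonneg S q) (hg0 q)
    have h4 := mul_le_mul_of_nonneg_right h1 h3
    have h5 := mul_le_mul_of_nonneg_left h2 (tensorSq_nonneg S q)
    have h6 : 0 ≤ 2 * (∑ c, pairing f ν S c q ^ 2) * g q :=
      mul_nonneg (mul_nonneg (by norm_num) (Finset.sum_nonneg fun _ _ => sq_nonneg _)) (hg0 q)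
    nlinarith [h4, h5, h6]

end TensorIdentities

/-! ### The second fundamental form as a tangential tensor. -/

section Shape

variable {M : Type*} [TopologicalSpace M] [ChartedSpace (Euc 3) M]
  [IsManifold (𝓡 3) ∞ M] {f ν : M → Euc 4}

/-- The derivative slot is tangential as every gradient is; the slot of the component index is
tangential because |ν| = 1. -/
theorem isTangential_covShape_zero (hf : IsSmoothImmersion 3 f) (hν : IsUnitNormal 3 f ν) :
    IsTangential ν (covShape f ν 0) := by
  intro α q
  have h1 : ∀ a b : Fin 4, ∑ c, ∑ d, tangentProj ν a c q * tangentProj ν b d q *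
      grad f (fun x => ν x d) q c = grad f (fun x => ν x b) q a := by
    intro a b
    rw [← sum_tangentProj_mul (x := fun c => grad f (fun x => ν x b) q c)
      (sum_normal_mul_grad hf hν _ q) a]
    refine Finset.sum_congr rfl fun c _ => ?_
    rw [← sum_tangentProj_mul (x := fun d => grad f (fun x => ν x d) q c)
      (sum_normal_mul_grad_normal hν q c) b, Finset.mul_sum]
    exact Finset.sum_congr rfl fun d _ => by ring
  have h2 := h1 (α 0) (α 1)
  refine Eq.trans ?_ h2
  refine (sum_fin_succ_fun (k := 1) _).trans (Finset.sum_congr rfl fun c _ => ?_)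
  refine (sum_fin_succ_fun (k := 0) _).trans (Finset.sum_congr rfl fun d _ => ?_)
  rw [Fintype.sum_unique]
  congr 1
  exact Fin.prod_univ_two _

theorem norm_grad_normal_le (q : M) (e : Fin 4) :
    ‖grad f (fun x => ν x e) q‖ ≤ Real.sqrt (tensorSq (covShape f ν 0) q) := by
  rw [EuclideanSpace.norm_eq]
  refine Real.sqrt_le_sqrt ?_
  have h1 : tensorSq (covShape f ν 0) q = ∑ c, ∑ d, grad f (fun x => ν x d) q c ^ 2 := by
    refine (sum_fin_succ_fun (k := 1) _).trans (Finset.sum_congr rfl fun c _ => ?_)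
    refine (sum_fin_succ_fun (k := 0) _).trans (Finset.sum_congr rfl fun d _ => ?_)
    rw [Fintype.sum_unique]; rfl
  rw [h1]
  refine Finset.sum_le_sum fun c _ => ?_
  rw [Real.norm_eq_abs, sq_abs]
  exact Finset.single_le_sum (f := fun d => grad f (fun x => ν x d) q c ^ 2)
    (fun d _ => sq_nonneg _) (Finset.mem_univ e)

end Shape

/-! ### Real inequalities: absorption and choice of constants. -/

section Numeric

theorem sq_mul_le_cube_add_cube {w x : ℝ} (hw : 0 ≤ w) (hx : 0 ≤ x) :
    w ^ 2 * x ≤ x ^ 3 + w ^ 3 := by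
  rcases le_total w x with h | h
  · have := mul_le_mul_of_nonneg_right (pow_le_pow_left₀ hw h 2) hx
    nlinarith [pow_nonneg hw 3]
  · have := mul_le_mul_of_nonneg_left h (sq_nonneg w)
    nlinarith [pow_nonneg hx 3]

/-- After multiplication of `hS` by x, each of the three terms costs at most x³/4. The remaining
quarter stays on the left, and 16 becomes 64. -/
theorem cube_le_of_small {s C x y j N κ : ℝ} (hs : 0 ≤ s) (hC : 0 < C) (hx : 0 ≤ x) (hκ : 0 ≤ κ) (hjx : j ^ 2 ≤ x * N ^ 2)
    (hS : x ^ 2 ≤ C * (4 * (y * j) + s * κ * j ^ 2 + x ^ 2 * N)) (hCN : C * N ≤ 1 / 4) :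
    x ^ 3 ≤ 64 * C ^ 2 * N ^ 2 * y ^ 2 + 64 * (s * C) ^ 3 * κ ^ 3 * N ^ 6 := by
  have h1 : 4 * C * y * (x * j) ≤ 1 / 4 * x ^ 3 + 16 * C ^ 2 * N ^ 2 * y ^ 2 := by
    refine le_of_sq_le_sq ?_ (by positivity)
    have h2 : 16 * C ^ 2 * y ^ 2 * x ^ 2 * j ^ 2 ≤ 16 * C ^ 2 * y ^ 2 * x ^ 2 * (x * N ^ 2) :=
      mul_le_mul_of_nonneg_left hjx (by positivity)
    nlinarith [sq_nonneg (1 / 4 * x ^ 3 - 16 * C ^ 2 * N ^ 2 * y ^ 2)]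
  have h3 : s * C * κ * x * j ^ 2 ≤ 1 / 4 * x ^ 3 + 16 * (s * C) ^ 3 * κ ^ 3 * N ^ 6 := by
    have h4 : s * C * κ * x * j ^ 2 ≤ s * C * κ * x * (x * N ^ 2) :=
      mul_le_mul_of_nonneg_left hjx (by positivity)
    have h5 := sq_mul_le_cube_add_cube hx (w := x) (x := 4 * (s * C) * κ * N ^ 2) (by positivity)
    nlinarith
  have h6 : C * x ^ 3 * N ≤ 1 / 4 * x ^ 3 := by
    have := mul_le_mul_of_nonneg_right hCN (pow_nonneg hx 3)
    linarith
  have h7 := mul_le_mul_of_nonneg_left hS hx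
  nlinarith

theorem sq_le_rpow {N : ℝ} (hN : 0 ≤ N) (h1 : N ≤ 1) : N ^ 2 ≤ N ^ (3 / 2 : ℝ) := by
  rw [← Real.rpow_natCast]
  rcases hN.eq_or_lt with rfl | h
  · rw [Real.zero_rpow (by norm_num), Real.zero_rpow (by norm_num)]
  · exact Real.rpow_le_rpow_of_exponent_ge h h1 (by norm_num)

/-- The bound for the lower-order quantity `x³`, for every size of `N`. -/
theorem exists_cube_le {s C : ℝ} (hs : 0 ≤ s) (hC : 0 < C) :
    ∃ K : ℝ, 0 < K ∧ ∀ x y j N X κ : ℝ, 0 ≤ x → 0 ≤ y → 0 ≤ j → 0 ≤ N → 0 ≤ X → 0 ≤ κ →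
      j ^ 2 ≤ x * N ^ 2 → x ^ 2 ≤ C * (4 * (y * j) + s * κ * j ^ 2 + x ^ 2 * N) →
      y ^ 2 ≤ 2 * X + 3 * x ^ 3 + s ^ 3 * κ ^ 3 * N ^ 3 →
      x ^ 3 ≤ K * N ^ (3 / 2 : ℝ) * (X + x ^ 3) + K * (κ ^ 3 * N ^ 3) := by
  -- The threshold between the cases: below it CN ≤ 1/4 permits absorption and N ≤ 1 permits
  -- lowering powers of N.
  set n : ℝ := min 1 (1 / (4 * C)) with hn
  have hn0 : 0 < n := lt_min one_pos (by positivity)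
  set E : ℝ := n ^ (3 / 2 : ℝ) with hE
  have hE0 : 0 < E := Real.rpow_pos_of_pos hn0 _
  refine ⟨E⁻¹ + 192 * C ^ 2 + 64 * C ^ 2 * s ^ 3 + 64 * (s * C) ^ 3, by positivity, ?_⟩
  intro x y j N X κ hx hy hj hN hX hκ hjx hS hY
  have hNp : 0 ≤ N ^ (3 / 2 : ℝ) := Real.rpow_nonneg hN _
  have hx3 := pow_nonneg hx 3
  have hk : 0 ≤ κ ^ 3 * N ^ 3 := by positivity
  set R := N ^ (3 / 2 : ℝ) with hR
  rcases le_total N n with h | h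
  · have hN1 : N ≤ 1 := h.trans (min_le_left _ _)
    have hCN : C * N ≤ 1 / 4 := by
      have := mul_le_mul_of_nonneg_left (h.trans (min_le_right _ _)) hC.le
      refine this.trans (le_of_eq ?_)
      field_simp
    have h1 := cube_le_of_small hs hC hx hκ hjx hS hCN
    have h2 : N ^ 2 * y ^ 2 ≤ 3 * (R * (X + x ^ 3)) + s ^ 3 * (κ ^ 3 * N ^ 3) := by
      have h3 := mul_le_mul_of_nonneg_left hY (sq_nonneg N)
      have h4 := mul_le_mul_of_nonneg_right (sq_le_rpow hN hN1)
        (show 0 ≤ 3 * (X + x ^ 3) by positivity)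
      have h5 := mul_le_mul_of_nonneg_right (pow_le_one₀ (n := 2) hN hN1)
        (show 0 ≤ s ^ 3 * (κ ^ 3 * N ^ 3) by positivity)
      nlinarith [mul_nonneg (sq_nonneg N) hX]
    have h6 : κ ^ 3 * N ^ 6 ≤ κ ^ 3 * N ^ 3 :=
      mul_le_mul_of_nonneg_left (pow_le_pow_of_le_one hN hN1 (by norm_num)) (by positivity)
    have h7 := mul_le_mul_of_nonneg_left h2 (show 0 ≤ 64 * C ^ 2 by positivity)
    have h8 := mul_le_mul_of_nonneg_left h6 (show 0 ≤ 64 * (s * C) ^ 3 by positivity)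
    have h9 : 0 ≤ R * (X + x ^ 3) := by positivity
    have h10 : 0 ≤ (E⁻¹ + 64 * C ^ 2 * s ^ 3 + 64 * (s * C) ^ 3) * (R * (X + x ^ 3)) := by
      positivity
    have h11 : 0 ≤ (E⁻¹ + 192 * C ^ 2) * (κ ^ 3 * N ^ 3) := by positivity
    linarith
  -- For N ≥ n the estimate is trivial: E⁻¹N^{3/2} ≥ 1, so x³ is bounded by its own multiple on the
  -- right.
  · have h1 : E ≤ R := Real.rpow_le_rpow hn0.le h (by norm_num)
    have h2 : 1 ≤ E⁻¹ * R := by rwa [inv_mul_eq_div, one_le_div hE0]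
    have h3 := mul_le_mul_of_nonneg_right h2 (show 0 ≤ X + x ^ 3 by positivity)
    have h4 : 0 ≤ (192 * C ^ 2 + 64 * C ^ 2 * s ^ 3 + 64 * (s * C) ^ 3) * (R * (X + x ^ 3)) := by
      positivity
    have h5 : 0 ≤ (E⁻¹ + 192 * C ^ 2 + 64 * C ^ 2 * s ^ 3 + 64 * (s * C) ^ 3) *
      (κ ^ 3 * N ^ 3) := by positivity
    linarith

theorem exists_interpolation_const {s C θ : ℝ} (hs : 0 ≤ s) (hC : 0 < C) (hθ : 0 < θ) :
    ∃ c : ℝ, 0 < c ∧ ∀ x y j N X κ : ℝ, 0 ≤ x → 0 ≤ y → 0 ≤ j → 0 ≤ N → 0 ≤ X → 0 ≤ κ →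
      j ^ 2 ≤ x * N ^ 2 → x ^ 2 ≤ C * (4 * (y * j) + s * κ * j ^ 2 + x ^ 2 * N) →
      (∀ ε, 0 < ε → y ^ 2 ≤ 2 * ε * X + 2 * ε⁻¹ * x ^ 3 + s ^ 2 * κ ^ 2 * j ^ 2) →
      x ^ 3 + y ^ 2 ≤ θ * X + c * N ^ (3 / 2 : ℝ) * (X + x ^ 3) +
        c * κ ^ 3 * (N ^ 3 + N ^ (9 / 2 : ℝ)) := by
  obtain ⟨K, hK, hKx⟩ := exists_cube_le hs hC
  refine ⟨(4 * θ⁻¹ + 2) * K + s ^ 3, by positivity, ?_⟩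
  intro x y j N X κ hx hy hj hN hX hκ hjx hS hY
  have hY' : ∀ ε, 0 < ε →
      y ^ 2 ≤ 2 * ε * X + (2 * ε⁻¹ + 1) * x ^ 3 + s ^ 3 * κ ^ 3 * N ^ 3 := by
    intro ε hε
    have h1 := hY ε hε
    have h2 : s ^ 2 * κ ^ 2 * j ^ 2 ≤ s ^ 2 * κ ^ 2 * (x * N ^ 2) :=
      mul_le_mul_of_nonneg_left hjx (by positivity)
    have h3 := sq_mul_le_cube_add_cube (w := s * κ * N) (by positivity) hx
    nlinarith
  -- First use, ε = 1: a bound for x³ in which y no longer occurs.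
  have h1 := hKx x y j N X κ hx hy hj hN hX hκ hjx hS (by
    have := hY' 1 one_pos
    norm_num at this ⊢
    linarith)
  -- Second use: 2ε = θ gives X the required coefficient. Then x³ has coefficient 4θ⁻¹ + 1, and with
  -- the x³ on the left 4θ⁻¹ + 2, all handled by `h1`. The power N^{9/2} enters only as a
  -- nonnegative surplus.
  have h2 := hY' (θ / 2) (by positivity)
  have h3 : (θ / 2)⁻¹ = 2 * θ⁻¹ := by rw [inv_div, div_eq_mul_inv]
  rw [h3] at h2
  have h4 := mul_le_mul_of_nonneg_left h1 (show 0 ≤ 4 * θ⁻¹ + 2 by positivity)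
  have h5 : 0 ≤ N ^ (3 / 2 : ℝ) := Real.rpow_nonneg hN _
  have h6 : 0 ≤ N ^ (9 / 2 : ℝ) := Real.rpow_nonneg hN _
  have h7 : 0 ≤ s ^ 3 * N ^ (3 / 2 : ℝ) * (X + x ^ 3) := by positivity
  have h8 : 0 ≤ ((4 * θ⁻¹ + 2) * K + s ^ 3) * κ ^ 3 * N ^ (9 / 2 : ℝ) := by positivity
  linarith

end Numeric

/-! ### Hölder estimates between the curvature integrals. -/

section Hoelder

variable {M : Type*} [TopologicalSpace M] [CompactSpace M] [MeasurableSpace M] [BorelSpace M]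
  {μ : Measure M} [IsFiniteMeasure μ] {a b r : M → ℝ}

theorem integral_mul_le_of_continuous {p q : ℝ} (hpq : p.HolderConjugate q)
    (ha : Continuous a) (hb : Continuous b) (ha0 : ∀ x, 0 ≤ a x) (hb0 : ∀ x, 0 ≤ b x) :
    ∫ x, a x * b x ∂μ ≤ (∫ x, a x ^ p ∂μ) ^ (1 / p) * (∫ x, b x ^ q ∂μ) ^ (1 / q) :=
  integral_mul_le_Lp_mul_Lq_of_nonneg hpq (ae_of_all _ ha0) (ae_of_all _ hb0)
    (ha.memLp_of_hasCompactSupport (HasCompactSupport.of_compactSpace _))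
    (hb.memLp_of_hasCompactSupport (HasCompactSupport.of_compactSpace _))

theorem setIntegral_pos_eq {g : M → ℝ} (hr0 : ∀ x, 0 ≤ r x) (hg : ∀ x, r x = 0 → g x = 0) :
    ∫ x in {x | 0 < r x}, g x ∂μ = ∫ x, g x ∂μ :=
  setIntegral_eq_integral_of_forall_compl_eq_zero fun x hx =>
    hg x (le_antisymm (not_lt.mp hx) (hr0 x))

/-- Hölder with exponents 3 and 3/2 for a²r² · a², on the set where r > 0. Restricting first is what
makes the L³ norm of a appear on that set only. -/
theorem integral_pow_four_le (ha : Continuous a) (hr : Continuous r) (ha0 : ∀ x, 0 ≤ a x)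
    (hr0 : ∀ x, 0 ≤ r x) : ∫ x, a x ^ 4 * r x ^ 2 ∂μ ≤
      (∫ x, a x ^ 6 * r x ^ 6 ∂μ) ^ (1 / 3 : ℝ) *
        ((∫ x in {x | 0 < r x}, a x ^ (3 : ℝ) ∂μ) ^ (1 / 3 : ℝ)) ^ 2 := by
  have h := integral_mul_le_of_continuous (μ := μ.restrict {x | 0 < r x})
    (Real.holderConjugate_iff.2 ⟨by norm_num, by norm_num⟩ : (3 : ℝ).HolderConjugate (3 / 2))
    ((ha.pow 2).mul (hr.pow 2)) (ha.pow 2)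
    (fun x => mul_nonneg (sq_nonneg _) (sq_nonneg _)) (fun x => sq_nonneg _)
  have h1 : ∀ x, (a x ^ 2 * r x ^ 2) ^ (3 : ℝ) = a x ^ 6 * r x ^ 6 := fun x => by
    rw [show (3 : ℝ) = ((3 : ℕ) : ℝ) by norm_num, Real.rpow_natCast]; ring
  have h2 : ∀ x, (a x ^ 2) ^ (3 / 2 : ℝ) = a x ^ (3 : ℝ) := fun x => by
    rw [← Real.rpow_natCast, ← Real.rpow_mul (ha0 x)]; norm_num
  have h3 : ∀ x, a x ^ 2 * r x ^ 2 * a x ^ 2 = a x ^ 4 * r x ^ 2 := fun x => by ring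
  simp only [Pi.mul_apply, Pi.pow_apply, h1, h2, h3] at h
  rw [setIntegral_pos_eq hr0 (fun x hx => by simp [hx]),
    setIntegral_pos_eq hr0 (fun x hx => by simp [hx])] at h
  refine h.trans (le_of_eq ?_)
  rw [← Real.rpow_natCast (_ ^ (1 / 3 : ℝ)), ← Real.rpow_mul (setIntegral_nonneg_of_ae
    (ae_of_all _ fun x => Real.rpow_nonneg (ha0 x) _))]
  norm_num

theorem integral_pow_five_le (ha : Continuous a) (hr : Continuous r) (ha0 : ∀ x, 0 ≤ a x)
    (hr0 : ∀ x, 0 ≤ r x) : ∫ x, a x ^ 5 * r x ^ 4 ∂μ ≤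
      ((∫ x, a x ^ 6 * r x ^ 6 ∂μ) ^ (1 / 3 : ℝ)) ^ 2 *
        (∫ x in {x | 0 < r x}, a x ^ (3 : ℝ) ∂μ) ^ (1 / 3 : ℝ) := by
  have h := integral_mul_le_of_continuous (μ := μ.restrict {x | 0 < r x})
    (Real.holderConjugate_iff.2 ⟨by norm_num, by norm_num⟩ : (3 / 2 : ℝ).HolderConjugate 3)
    ((ha.pow 4).mul (hr.pow 4)) ha
    (fun x => mul_nonneg (pow_nonneg (ha0 x) _) (pow_nonneg (hr0 x) _)) ha0
  have h1 : ∀ x, (a x ^ 4 * r x ^ 4) ^ (3 / 2 : ℝ) = a x ^ 6 * r x ^ 6 := fun x => by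
    rw [← mul_pow, ← mul_pow, ← Real.rpow_natCast, ← Real.rpow_natCast,
      ← Real.rpow_mul (mul_nonneg (ha0 x) (hr0 x))]
    norm_num
  have h3 : ∀ x, a x ^ 4 * r x ^ 4 * a x = a x ^ 5 * r x ^ 4 := fun x => by ring
  simp only [Pi.mul_apply, Pi.pow_apply, h1, h3] at h
  rw [setIntegral_pos_eq hr0 (fun x hx => by simp [hx]),
    setIntegral_pos_eq hr0 (fun x hx => by simp [hx])] at h
  refine h.trans (le_of_eq ?_)
  rw [← Real.rpow_natCast (_ ^ (1 / 3 : ℝ)), ← Real.rpow_mul (integral_nonneg fun x =>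
    mul_nonneg (pow_nonneg (ha0 x) _) (pow_nonneg (hr0 x) _))]
  norm_num

theorem integral_cube_mul_le (ha : Continuous a) (hb : Continuous b) (hr : Continuous r)
    (ha0 : ∀ x, 0 ≤ a x) (hb0 : ∀ x, 0 ≤ b x) (hr0 : ∀ x, 0 ≤ r x) :
    ∫ x, a x ^ 3 * b x * r x ^ 4 ∂μ ≤ Real.sqrt (∫ x, a x ^ 2 * b x ^ 2 * r x ^ 6 ∂μ) *
      Real.sqrt (∫ x, a x ^ 4 * r x ^ 2 ∂μ) := by
  have h := integral_mul_le_of_continuous (μ := μ) Real.HolderConjugate.two_two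
    ((ha.mul hb).mul (hr.pow 3)) ((ha.pow 2).mul hr)
    (fun x => mul_nonneg (mul_nonneg (ha0 x) (hb0 x)) (pow_nonneg (hr0 x) _))
    (fun x => mul_nonneg (sq_nonneg _) (hr0 x))
  have h1 : ∀ x, a x * b x * r x ^ 3 * (a x ^ 2 * r x) = a x ^ 3 * b x * r x ^ 4 :=
    fun x => by ring
  have h2 : ∀ x, (a x * b x * r x ^ 3) ^ 2 = a x ^ 2 * b x ^ 2 * r x ^ 6 := fun x => by ring
  have h3 : ∀ x, (a x ^ 2 * r x) ^ 2 = a x ^ 4 * r x ^ 2 := fun x => by ring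
  simp only [Pi.mul_apply, Pi.pow_apply, Real.rpow_two, h1, h2, h3] at h
  rwa [← Real.sqrt_eq_rpow, ← Real.sqrt_eq_rpow] at h

end Hoelder

/-! ### The two integral estimates and their combination. -/

section Estimates

variable {M : Type*} [TopologicalSpace M] [T2Space M] [CompactSpace M] [ChartedSpace (Euc 3) M]
  [IsManifold (𝓡 3) ∞ M] [MeasurableSpace M] [BorelSpace M] {f ν : M → Euc 4} {γ : M → ℝ}
  {s κ : ℝ}

theorem normCovDerivA_eq_sqrt (hf : IsSmoothImmersion 3 f) (hν : IsUnitNormal 3 f ν) (j : ℕ)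
    (q : M) : Real.sqrt (tensorSq (covShape f ν j) q) = normCovDerivA (n := 3) f ν j q :=
  (normCovDerivA_eq hf hν j q).symm

theorem tensorSq_covShape (hf : IsSmoothImmersion 3 f) (hν : IsUnitNormal 3 f ν) (j : ℕ)
    (q : M) : tensorSq (covShape f ν j) q = normCovDerivA (n := 3) f ν j q ^ 2 :=
  (normCovDerivA_sq hf hν j q).symm

theorem normCovDerivA_nonneg (f ν : M → Euc 4) (j : ℕ) (q : M) :
    0 ≤ normCovDerivA (n := 3) f ν j q := Real.sqrt_nonneg _

theorem chartContDiff_rpow (hγ : ChartContDiff 1 γ) {t : ℝ} (ht : 1 ≤ t) :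
    ChartContDiff 1 fun q => γ q ^ t :=
  ChartContDiff.comp (φ := fun x : ℝ => x ^ t)
    (Real.contDiff_rpow_const_of_le (n := 1) (by simpa using ht)) hγ

/-- As γ ≤ 1, the exponent t - 1 may be lowered to w. It is applied with (s, 2s/3) and (2s/3, s/3),
and both need exactly s ≥ 3; w > 0 excludes 0⁰ at zeros of γ. -/
theorem norm_grad_rpow_le (hγ : ChartContDiff 1 γ) (hγ0 : ∀ q, 0 ≤ γ q) (hγ1 : ∀ q, γ q ≤ 1)
    (hκ : ∀ q, ‖grad f γ q‖ ≤ κ) {t w : ℝ} (ht : 1 ≤ t) (hw : 0 < w) (hwt : w ≤ t - 1) (q : M) :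
    ‖grad f (fun x => γ x ^ t) q‖ ≤ t * κ * γ q ^ w := by
  have h1 : HasDerivAt (fun x : ℝ => x ^ t) (t * γ q ^ (t - 1)) (γ q) :=
    Real.hasDerivAt_rpow_const (Or.inr ht)
  rw [grad_comp hγ h1, norm_smul, Real.norm_of_nonneg
    (mul_nonneg (by linarith) (Real.rpow_nonneg (hγ0 q) _))]
  have h2 : γ q ^ (t - 1) ≤ γ q ^ w :=
    Real.rpow_le_rpow_of_exponent_ge_of_imp (hγ0 q) (hγ1 q) hwt
      fun _ h => absurd h (hw.trans_le hwt).ne'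
  have h3 := mul_le_mul h2 (hκ q) (norm_nonneg _) (Real.rpow_nonneg (hγ0 q) _)
  calc t * γ q ^ (t - 1) * ‖grad f γ q‖ = t * (γ q ^ (t - 1) * ‖grad f γ q‖) := by ring
    _ ≤ t * (γ q ^ w * κ) := mul_le_mul_of_nonneg_left h3 (by linarith)
    _ = t * κ * γ q ^ w := by ring

theorem rpow_div_six {x : ℝ} (hx : 0 ≤ x) (s : ℝ) (k : ℕ) :
    (x ^ (s / 6)) ^ k = x ^ (s * k / 6) := by
  rw [← Real.rpow_natCast, ← Real.rpow_mul hx]; congr 1; ring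

theorem continuous_rpow_div_six (hγ : ChartContDiff 1 γ) (hs : 3 ≤ s) :
    Continuous fun q => γ q ^ (s / 6) :=
  hγ.continuous.rpow_const fun _ => Or.inr (by linarith)

/-- The interpolation inequality from integration by parts. -/
theorem integral_sq_mul_sq_le (hf : IsSmoothImmersion 3 f) (hν : IsUnitNormal 3 f ν)
    (hs : 3 ≤ s) (hγ : ChartContDiff 1 γ) (hγ0 : ∀ q, 0 ≤ γ q) (hγ1 : ∀ q, γ q ≤ 1)
    (hκ : ∀ q, ‖grad f γ q‖ ≤ κ) {r a b d : M → ℝ} (hr : r = fun q => γ q ^ (s / 6))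
    (ha : a = normCovDerivA (n := 3) f ν 0) (hb : b = normCovDerivA (n := 3) f ν 1)
    (hd : d = normCovDerivA (n := 3) f ν 2) {ε : ℝ} (hε : 0 < ε) :
    ∫ q, a q ^ 2 * b q ^ 2 * r q ^ 6 ∂inducedVolume 3 f ≤
      2 * ε * (∫ q, d q ^ 2 * r q ^ 6 ∂inducedVolume 3 f) +
      2 * ε⁻¹ * (∫ q, a q ^ 6 * r q ^ 6 ∂inducedVolume 3 f) +
      s ^ 2 * κ ^ 2 * (∫ q, a q ^ 4 * r q ^ 2 ∂inducedVolume 3 f) := by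
  have := isFiniteMeasure_inducedVolume hf
  have hr6 : ∀ q, γ q ^ s = r q ^ 6 := fun q => by
    rw [hr]; simp only; rw [rpow_div_six (hγ0 q)]; congr 1; push_cast; ring
  have hr4 : ∀ q, γ q ^ (2 * s / 3) = r q ^ 4 := fun q => by
    rw [hr]; simp only; rw [rpow_div_six (hγ0 q)]; congr 1; push_cast; ring
  have cr : Continuous r := hr ▸ continuous_rpow_div_six hγ hs
  have ca : Continuous a := ha ▸ continuous_normCovDerivA hf hν 0
  have cb : Continuous b := hb ▸ continuous_normCovDerivA hf hν 1
  have cd : Continuous d := hd ▸ continuous_normCovDerivA hf hν 2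
  have hr0 : ∀ q, 0 ≤ r q := fun q => by rw [hr]; exact Real.rpow_nonneg (hγ0 q) _
  have ha0 : ∀ q, 0 ≤ a q := fun q => ha ▸ normCovDerivA_nonneg f ν 0 q
  have hb0 : ∀ q, 0 ≤ b q := fun q => hb ▸ normCovDerivA_nonneg f ν 1 q
  have hd0 : ∀ q, 0 ≤ d q := fun q => hd ▸ normCovDerivA_nonneg f ν 2 q
  have hgd : ∀ q, ‖grad f (fun x => γ x ^ s) q‖ ≤ s * κ * r q ^ 4 := fun q => by
    rw [← hr4]
    exact norm_grad_rpow_le hγ hγ0 hγ1 hκ (by linarith) (by linarith) (by linarith) q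
  have hS := integral_tensorSq_mul_le hf hν (fun α => chartContDiff_covShape hf hν 0 α)
    (isTangential_covShape_zero hf hν) (chartContDiff_rpow hγ (t := s) (by linarith))
    (fun q => Real.rpow_nonneg (hγ0 q) _)
  have e1 : ambientCovDeriv f ν (covShape f ν 0) = covShape f ν 1 := rfl
  have e2 : ambientCovDeriv f ν (covShape f ν 1) = covShape f ν 2 := rfl
  simp only [e1, e2, tensorSq_covShape hf hν, ← ha, ← hb, ← hd, Real.sqrt_sq (ha0 _),
    Real.sqrt_sq (hb0 _), Real.sqrt_sq (hd0 _), hr6] at hS hgd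
  have i2 : Integrable (fun q => d q ^ 2 * r q ^ 6) (inducedVolume 3 f) :=
    continuous_integrable ((cd.pow 2).mul (cr.pow 6))
  have i0 : Integrable (fun q => a q ^ 6 * r q ^ 6) (inducedVolume 3 f) :=
    continuous_integrable ((ca.pow 6).mul (cr.pow 6))
  have i1 : Integrable (fun q => a q ^ 2 * b q ^ 2 * r q ^ 6) (inducedVolume 3 f) :=
    continuous_integrable (((ca.pow 2).mul (cb.pow 2)).mul (cr.pow 6))
  have i4 : Integrable (fun q => a q ^ 4 * r q ^ 2) (inducedVolume 3 f) :=
    continuous_integrable ((ca.pow 4).mul (cr.pow 2))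
  have cg : Continuous (grad f fun x => r x ^ 6) := by
    simp only [← hr6]
    exact ((chartContDiff_rpow hγ (t := s) (by linarith)).grad hf hν (l' := 0) (by simp)
      (by simp)).continuous
  have j20 : Integrable (fun q => ε * (d q ^ 2 * r q ^ 6) + ε⁻¹ * (a q ^ 6 * r q ^ 6))
      (inducedVolume 3 f) := (i2.const_mul _).add (i0.const_mul _)
  have j201 : Integrable (fun q => ε * (d q ^ 2 * r q ^ 6) + ε⁻¹ * (a q ^ 6 * r q ^ 6) +
      1 / 2 * (a q ^ 2 * b q ^ 2 * r q ^ 6)) (inducedVolume 3 f) := j20.add (i1.const_mul _)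
  have hle : ∫ q, (2 * a q * d q * a q ^ 2 * r q ^ 6 +
      a q ^ 2 * (a q * b q * ‖grad f (fun x => r x ^ 6) q‖)) ∂inducedVolume 3 f ≤
      ∫ q, (ε * (d q ^ 2 * r q ^ 6) + ε⁻¹ * (a q ^ 6 * r q ^ 6) +
        1 / 2 * (a q ^ 2 * b q ^ 2 * r q ^ 6) + 1 / 2 * s ^ 2 * κ ^ 2 * (a q ^ 4 * r q ^ 2))
        ∂inducedVolume 3 f := by
    refine integral_mono (continuous_integrable ?_)
      (j201.add (i4.const_mul _)) fun q => ?_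
    · exact ((((continuous_const.mul ca).mul cd).mul (ca.pow 2)).mul (cr.pow 6)).add
        ((ca.pow 2).mul ((ca.mul cb).mul cg.norm))
    · have h1 : 2 * (a q ^ 3 * d q) ≤ ε * d q ^ 2 + ε⁻¹ * a q ^ 6 := by
        have h := mul_nonneg hε.le (sq_nonneg (d q - ε⁻¹ * a q ^ 3))
        have h' : ε * (d q - ε⁻¹ * a q ^ 3) ^ 2 =
            ε * d q ^ 2 + ε⁻¹ * a q ^ 6 - 2 * (a q ^ 3 * d q) := by
          field_simp; ring
        linarith
      have h2 := mul_le_mul_of_nonneg_right h1 (pow_nonneg (hr0 q) 6)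
      have h3 := mul_le_mul_of_nonneg_left (hgd q)
        (mul_nonneg (pow_nonneg (ha0 q) 3) (hb0 q))
      -- Young's inequality for the cutoff term leaves half of ∫a²b²r⁶ on the right. Moving it to
      -- the left doubles the remaining constants.
      have h4 := sq_nonneg (a q * b q * r q ^ 3 - s * κ * a q ^ 2 * r q)
      simp only
      nlinarith
  rw [integral_add j201 (i4.const_mul _), integral_add j20 (i1.const_mul _),
    integral_add (i2.const_mul _) (i0.const_mul _), integral_const_mul, integral_const_mul,
    integral_const_mul, integral_const_mul] at hle
  have h5 : ∀ q, b q ^ 2 * a q ^ 2 * r q ^ 6 = a q ^ 2 * b q ^ 2 * r q ^ 6 := fun q => by ring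
  simp only [h5] at hS
  linarith

/-- The Sobolev inequality applied to `‖A‖⁴ γ^{2s/3}`. -/
theorem integral_pow_six_le (hf : IsSmoothImmersion 3 f) (hν : IsUnitNormal 3 f ν)
    (hs : 3 ≤ s) (hγ : ChartContDiff 1 γ) (hγ0 : ∀ q, 0 ≤ γ q) (hγ1 : ∀ q, γ q ≤ 1)
    (hκ0 : 0 ≤ κ) (hκ : ∀ q, ‖grad f γ q‖ ≤ κ) {r a b : M → ℝ} (hr : r = fun q => γ q ^ (s / 6))
    (ha : a = normCovDerivA (n := 3) f ν 0) (hb : b = normCovDerivA (n := 3) f ν 1) :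
    ∫ q, a q ^ 6 * r q ^ 6 ∂inducedVolume 3 f ≤ sobolevConst *
      (4 * (∫ q, a q ^ 3 * b q * r q ^ 4 ∂inducedVolume 3 f) +
        s * κ * (∫ q, a q ^ 4 * r q ^ 2 ∂inducedVolume 3 f) +
        ∫ q, a q ^ 5 * r q ^ 4 ∂inducedVolume 3 f) ^ (3 / 2 : ℝ) := by
  have := isFiniteMeasure_inducedVolume hf
  have hr4 : ∀ q, γ q ^ (2 * s / 3) = r q ^ 4 := fun q => by
    rw [hr]; simp only; rw [rpow_div_six (hγ0 q)]; congr 1; push_cast; ring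
  have hr2 : ∀ q, γ q ^ (s / 3) = r q ^ 2 := fun q => by
    rw [hr]; simp only; rw [rpow_div_six (hγ0 q)]; congr 1; push_cast; ring
  have cr : Continuous r := hr ▸ continuous_rpow_div_six hγ hs
  have ca : Continuous a := ha ▸ continuous_normCovDerivA hf hν 0
  have cb : Continuous b := hb ▸ continuous_normCovDerivA hf hν 1
  have hr0 : ∀ q, 0 ≤ r q := fun q => by rw [hr]; exact Real.rpow_nonneg (hγ0 q) _
  have ha0 : ∀ q, 0 ≤ a q := fun q => ha ▸ normCovDerivA_nonneg f ν 0 q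
  have hb0 : ∀ q, 0 ≤ b q := fun q => hb ▸ normCovDerivA_nonneg f ν 1 q
  have hg := chartContDiff_rpow hγ (t := 2 * s / 3) (by linarith)
  have hQ : ChartContDiff 1 (tensorSq (covShape f ν 0)) :=
    ChartContDiff.tensorSq fun α => (chartContDiff_covShape hf hν 0 α).of_le (by simp)
  have hQe : ∀ q, tensorSq (covShape f ν 0) q = a q ^ 2 := fun q => by
    rw [ha]; exact tensorSq_covShape hf hν 0 q
  -- The fourth power is written as |A|² · |A|², since |A|² is smooth whereas |A| need not be
  -- differentiable at its zeros.
  have hu : ChartContDiff 1 fun q =>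
    tensorSq (covShape f ν 0) q * tensorSq (covShape f ν 0) q * γ q ^ (2 * s / 3) :=
    (hQ.mul hQ).mul hg
  have hue : ∀ q, tensorSq (covShape f ν 0) q * tensorSq (covShape f ν 0) q *
      γ q ^ (2 * s / 3) = a q ^ 4 * r q ^ 4 := fun q => by rw [hQe, hr4]; ring
  have hu0 : ∀ q, 0 ≤ tensorSq (covShape f ν 0) q * tensorSq (covShape f ν 0) q *
      γ q ^ (2 * s / 3) := fun q => by
    rw [hue]; exact mul_nonneg (pow_nonneg (ha0 q) _) (pow_nonneg (hr0 q) _)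
  have hgu : ∀ q, ‖grad f (fun q => tensorSq (covShape f ν 0) q * tensorSq (covShape f ν 0) q *
      γ q ^ (2 * s / 3)) q‖ ≤ 4 * (a q ^ 3 * b q * r q ^ 4) + s * κ * (a q ^ 4 * r q ^ 2) := by
    intro q
    rw [grad_mul (hQ.mul hQ) hg, grad_mul hQ hQ]
    have h1 : ‖grad f (tensorSq (covShape f ν 0)) q‖ ≤ 2 * (a q * b q) := by
      have h := norm_grad_tensorSq_le (f := f) (fun α =>
        (chartContDiff_covShape hf hν 0 α).of_le (by simp)) (isTangential_covShape_zero hf hν) q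
      have e1 : ambientCovDeriv f ν (covShape f ν 0) = covShape f ν 1 := rfl
      rwa [e1, normCovDerivA_eq_sqrt hf hν, normCovDerivA_eq_sqrt hf hν, ← ha, ← hb] at h
    have h2 : ‖grad f (fun x => γ x ^ (2 * s / 3)) q‖ ≤ s * κ * r q ^ 2 := by
      rw [← hr2]
      refine (norm_grad_rpow_le hγ hγ0 hγ1 hκ (w := s / 3) (by linarith) (by linarith)
        (by linarith) q).trans ?_
      exact mul_le_mul_of_nonneg_right (mul_le_mul_of_nonneg_right (by linarith) hκ0)
        (Real.rpow_nonneg (hγ0 q) _)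
    set G := grad f (fun x => γ x ^ (2 * s / 3)) q
    set P := grad f (tensorSq (covShape f ν 0)) q
    have h3 : (tensorSq (covShape f ν 0) q * tensorSq (covShape f ν 0) q) • G +
        γ q ^ (2 * s / 3) • (tensorSq (covShape f ν 0) q • P + tensorSq (covShape f ν 0) q • P) =
        a q ^ 4 • G + (2 * (r q ^ 4 * a q ^ 2)) • P := by
      rw [hQe, hr4]; module
    have h4 : 0 ≤ a q ^ 4 := pow_nonneg (ha0 q) 4
    have h5 : 0 ≤ 2 * (r q ^ 4 * a q ^ 2) :=
      mul_nonneg two_pos.le (mul_nonneg (pow_nonneg (hr0 q) 4) (sq_nonneg _))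
    rw [h3]
    refine (norm_add_le _ _).trans ?_
    rw [norm_smul, norm_smul, Real.norm_of_nonneg h4, Real.norm_of_nonneg h5]
    have h6 := mul_le_mul_of_nonneg_left h1 h5
    have h7 := mul_le_mul_of_nonneg_left h2 h4
    linarith
  have hS := sobolev_hypersurface hf hν hu hu0 ca fun e q => by
    rw [ha, ← normCovDerivA_eq_sqrt hf hν]; exact norm_grad_normal_le q e
  have h6 : ∀ q, (a q ^ 4 * r q ^ 4) ^ (3 / 2 : ℝ) = a q ^ 6 * r q ^ 6 := fun x => by
    rw [← mul_pow, ← mul_pow, ← Real.rpow_natCast, ← Real.rpow_natCast,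
      ← Real.rpow_mul (mul_nonneg (ha0 x) (hr0 x))]
    norm_num
  simp only [hue, h6] at hS hgu
  have cgu : Continuous (grad f fun q => a q ^ 4 * r q ^ 4) := by
    simp only [hue] at hu
    exact (hu.grad hf hν (l' := 0) (by simp) (by simp)).continuous
  have i3 : Integrable (fun q => a q ^ 3 * b q * r q ^ 4) (inducedVolume 3 f) :=
    continuous_integrable (((ca.pow 3).mul cb).mul (cr.pow 4))
  have i4 : Integrable (fun q => a q ^ 4 * r q ^ 2) (inducedVolume 3 f) :=
    continuous_integrable ((ca.pow 4).mul (cr.pow 2))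
  have i5 : Integrable (fun q => a q ^ 5 * r q ^ 4) (inducedVolume 3 f) :=
    continuous_integrable ((ca.pow 5).mul (cr.pow 4))
  have j34 : Integrable (fun q => 4 * (a q ^ 3 * b q * r q ^ 4) + s * κ * (a q ^ 4 * r q ^ 2))
      (inducedVolume 3 f) := (i3.const_mul _).add (i4.const_mul _)
  refine hS.trans (mul_le_mul_of_nonneg_left ?_ sobolevConst_nonneg)
  refine Real.rpow_le_rpow (integral_nonneg fun q => add_nonneg (norm_nonneg _)
    (mul_nonneg (mul_nonneg (pow_nonneg (ha0 q) _) (pow_nonneg (hr0 q) _)) (ha0 q))) ?_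
    (by norm_num)
  rw [← integral_const_mul, ← integral_const_mul, ← integral_add (i3.const_mul _) (i4.const_mul _),
    ← integral_add j34 i5]
  refine integral_mono (continuous_integrable
    (cgu.norm.add (((ca.pow 4).mul (cr.pow 4)).mul ca)))
    (j34.add i5) fun q => ?_
  have := hgu q
  simp only
  nlinarith

/-- With r = γ^{s/6} all powers of the cutoff are integral. The constant comes from a purely
numerical lemma with C fixed beforehand, so it depends on s and θ alone. -/
theorem exists_curvature_estimate (hs : 3 ≤ s) {θ : ℝ} (hθ : 0 < θ) : ∃ c : ℝ, 0 < c ∧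
    ∀ (M : Type*) [TopologicalSpace M] [T2Space M] [CompactSpace M] [ChartedSpace (Euc 3) M]
      [IsManifold (𝓡 3) ∞ M] [MeasurableSpace M] [BorelSpace M] (f ν : M → Euc 4) (γ : M → ℝ)
      (κ : ℝ) (r a b d : M → ℝ) (N : ℝ),
      IsSmoothImmersion 3 f → IsUnitNormal 3 f ν → ChartContDiff 1 γ → (∀ q, 0 ≤ γ q) →
      (∀ q, γ q ≤ 1) → 0 ≤ κ → (∀ q, ‖grad f γ q‖ ≤ κ) →
      (r = fun q => γ q ^ (s / 6)) → a = normCovDerivA (n := 3) f ν 0 →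
      b = normCovDerivA (n := 3) f ν 1 → d = normCovDerivA (n := 3) f ν 2 →
      N = (∫ q in {q | 0 < r q}, a q ^ (3 : ℝ) ∂inducedVolume 3 f) ^ (1 / 3 : ℝ) →
      (∫ q, a q ^ 6 * r q ^ 6 ∂inducedVolume 3 f) +
        (∫ q, a q ^ 2 * b q ^ 2 * r q ^ 6 ∂inducedVolume 3 f) ≤
        θ * (∫ q, d q ^ 2 * r q ^ 6 ∂inducedVolume 3 f) +
        c * N ^ (3 / 2 : ℝ) * ((∫ q, d q ^ 2 * r q ^ 6 ∂inducedVolume 3 f) +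
          ∫ q, a q ^ 6 * r q ^ 6 ∂inducedVolume 3 f) +
        c * κ ^ 3 * (N ^ 3 + N ^ (9 / 2 : ℝ)) := by
  -- The Sobolev inequality is used after taking the power 2/3; adding 1 secures C > 0.
  set C := sobolevConst ^ (2 / 3 : ℝ) + 1 with hC
  have hC0 : 0 < C := by
    have := Real.rpow_nonneg sobolevConst_nonneg (2 / 3 : ℝ)
    positivity
  obtain ⟨c, hc, hcx⟩ := exists_interpolation_const (s := s) (by linarith) hC0 hθ
  refine ⟨c, hc, ?_⟩
  intro M _ _ _ _ _ _ _ f ν γ κ r a b d N hf hν hγ hγ0 hγ1 hκ0 hκ hr ha hb hd hN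
  have := isFiniteMeasure_inducedVolume hf
  set μ := inducedVolume 3 f
  have cr : Continuous r := hr ▸ continuous_rpow_div_six hγ hs
  have ca : Continuous a := ha ▸ continuous_normCovDerivA hf hν 0
  have cb : Continuous b := hb ▸ continuous_normCovDerivA hf hν 1
  have hr0 : ∀ q, 0 ≤ r q := fun q => by rw [hr]; exact Real.rpow_nonneg (hγ0 q) _
  have ha0 : ∀ q, 0 ≤ a q := fun q => ha ▸ normCovDerivA_nonneg f ν 0 q
  have hb0 : ∀ q, 0 ≤ b q := fun q => hb ▸ normCovDerivA_nonneg f ν 1 q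
  have hX0 : 0 ≤ ∫ q, a q ^ 6 * r q ^ 6 ∂μ := integral_nonneg fun q =>
    mul_nonneg (pow_nonneg (ha0 q) _) (pow_nonneg (hr0 q) _)
  have hX1 : 0 ≤ ∫ q, a q ^ 2 * b q ^ 2 * r q ^ 6 ∂μ := integral_nonneg fun q =>
    mul_nonneg (mul_nonneg (sq_nonneg _) (sq_nonneg _)) (pow_nonneg (hr0 q) _)
  have hX2 : 0 ≤ ∫ q, d q ^ 2 * r q ^ 6 ∂μ := integral_nonneg fun q =>
    mul_nonneg (sq_nonneg _) (pow_nonneg (hr0 q) _)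
  have hJ4 : 0 ≤ ∫ q, a q ^ 4 * r q ^ 2 ∂μ := integral_nonneg fun q =>
    mul_nonneg (pow_nonneg (ha0 q) _) (sq_nonneg _)
  have hN0 : 0 ≤ N := hN ▸ Real.rpow_nonneg (setIntegral_nonneg_of_ae
    (ae_of_all _ fun q => Real.rpow_nonneg (ha0 q) _)) _
  have h4 := integral_pow_four_le (μ := μ) ca cr ha0 hr0
  have h5 := integral_pow_five_le (μ := μ) ca cr ha0 hr0
  have h3 := integral_cube_mul_le (μ := μ) ca cb cr ha0 hb0 hr0
  have h6 := integral_pow_six_le hf hν hs hγ hγ0 hγ1 hκ0 hκ hr ha hb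
  rw [← hN] at h4 h5
  set x := (∫ q, a q ^ 6 * r q ^ 6 ∂μ) ^ (1 / 3 : ℝ) with hx
  have hx3 : x ^ 3 = ∫ q, a q ^ 6 * r q ^ 6 ∂μ := by
    rw [hx, ← Real.rpow_natCast, ← Real.rpow_mul hX0]; norm_num
  have hx2 : x ^ 2 = (∫ q, a q ^ 6 * r q ^ 6 ∂μ) ^ (2 / 3 : ℝ) := by
    rw [hx, ← Real.rpow_natCast, ← Real.rpow_mul hX0]; norm_num
  have hS : x ^ 2 ≤ C * (4 * (Real.sqrt (∫ q, a q ^ 2 * b q ^ 2 * r q ^ 6 ∂μ) *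
      Real.sqrt (∫ q, a q ^ 4 * r q ^ 2 ∂μ)) +
      s * κ * Real.sqrt (∫ q, a q ^ 4 * r q ^ 2 ∂μ) ^ 2 + x ^ 2 * N) := by
    have hz : 0 ≤ 4 * (∫ q, a q ^ 3 * b q * r q ^ 4 ∂μ) +
        s * κ * (∫ q, a q ^ 4 * r q ^ 2 ∂μ) + ∫ q, a q ^ 5 * r q ^ 4 ∂μ := by
      refine add_nonneg (add_nonneg (mul_nonneg (by norm_num) (integral_nonneg fun q => ?_))
        (mul_nonneg (mul_nonneg (by linarith) hκ0) hJ4)) (integral_nonneg fun q => ?_)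
      · exact mul_nonneg (mul_nonneg (pow_nonneg (ha0 q) _) (hb0 q)) (pow_nonneg (hr0 q) _)
      · exact mul_nonneg (pow_nonneg (ha0 q) _) (pow_nonneg (hr0 q) _)
    have h7 := Real.rpow_le_rpow hX0 h6 (show (0 : ℝ) ≤ 2 / 3 by norm_num)
    rw [← hx2, Real.mul_rpow sobolevConst_nonneg (Real.rpow_nonneg hz _),
      ← Real.rpow_mul hz] at h7
    norm_num at h7
    refine h7.trans (mul_le_mul (by rw [hC]; norm_num) ?_ hz hC0.le)
    rw [Real.sq_sqrt hJ4]
    linarith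
  have key := hcx x _ (Real.sqrt (∫ q, a q ^ 4 * r q ^ 2 ∂μ)) N _ κ (Real.rpow_nonneg hX0 _)
    (Real.sqrt_nonneg (∫ q, a q ^ 2 * b q ^ 2 * r q ^ 6 ∂μ)) (Real.sqrt_nonneg _) hN0 hX2 hκ0
    (by rwa [Real.sq_sqrt hJ4]) hS fun ε hε => by
      rw [Real.sq_sqrt hJ4, Real.sq_sqrt hX1, hx3]
      exact integral_sq_mul_sq_le hf hν hs hγ hγ0 hγ1 hκ hr ha hb hd hε
  rwa [hx3, Real.sq_sqrt hX1] at key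

end Estimates
end Hypersurface

end

/-! ### The curvature interpolation inequality. -/

theorem mainTheorem8 (s θ : ℝ) (hs : 3 ≤ s) (hθ : 0 < θ) :
    ∃ c : ℝ, 0 < c ∧
      ∀ (M : Type*) [TopologicalSpace M] [T2Space M] [CompactSpace M]
        [ChartedSpace (Hypersurface.Euc 3) M] [IsManifold (𝓡 3) ∞ M]
        [MeasurableSpace M] [BorelSpace M]
        (f ν : M → Hypersurface.Euc 4),
        Hypersurface.IsSmoothImmersion 3 f → Hypersurface.IsUnitNormal 3 f ν →
      ∀ (γt : Hypersurface.Euc 4 → ℝ) (γ : M → ℝ) (cγ₁ : ℝ),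
        ContDiff ℝ 2 γt → (∀ y, 0 ≤ γt y ∧ γt y ≤ 1) → γ = γt ∘ f →
        (∀ p, Hypersurface.normGrad (n := 3) f γ p ≤ cγ₁) →
      ∀ (μ : Measure M) (A0 A1 A2 : M → ℝ) (N : ℝ),
        μ = Hypersurface.inducedVolume 3 f →
        A0 = Hypersurface.normCovDerivA (n := 3) f ν 0 →
        A1 = Hypersurface.normCovDerivA (n := 3) f ν 1 →
        A2 = Hypersurface.normCovDerivA (n := 3) f ν 2 →
        N = Hypersurface.LqNormA 3 f ν 3 {p | 0 < γ p} →
      Integrable (fun p => A0 p ^ 6 * γ p ^ s) μ ∧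
      Integrable (fun p => A0 p ^ 2 * A1 p ^ 2 * γ p ^ s) μ ∧
      Integrable (fun p => A2 p ^ 2 * γ p ^ s) μ ∧
      IntegrableOn (fun p => A0 p ^ (3 : ℝ)) {p | 0 < γ p} μ ∧
      (∫ p, A0 p ^ 6 * γ p ^ s ∂μ) + (∫ p, A0 p ^ 2 * A1 p ^ 2 * γ p ^ s ∂μ)
        ≤ θ * (∫ p, A2 p ^ 2 * γ p ^ s ∂μ)
          + c * N ^ (3 / 2 : ℝ) * (∫ p, (A2 p ^ 2 + A0 p ^ 6) * γ p ^ s ∂μ)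
          + c * cγ₁ ^ 3 * (N ^ 3 + N ^ (9 / 2 : ℝ)) := by 
  obtain ⟨c, hc, hcx⟩ := Hypersurface.exists_curvature_estimate hs hθ
  refine ⟨c, hc, ?_⟩
  intro M _ _ _ _ _ _ _ f ν hf hν γt γ cγ₁ hγt hγt1 hγ hcγ μ A0 A1 A2 N hμ hA0 hA1 hA2 hN
  subst hμ
  have := Hypersurface.isFiniteMeasure_inducedVolume hf
  have hγ2 : Hypersurface.ChartContDiff 1 γ := by
    rw [hγ]
    exact Hypersurface.ChartContDiff.comp_map hf (by simp) (hγt.of_le (by norm_num))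
  have hγ0 : ∀ q, 0 ≤ γ q := fun q => hγ ▸ (hγt1 (f q)).1
  have hγ1 : ∀ q, γ q ≤ 1 := fun q => hγ ▸ (hγt1 (f q)).2
  have cγ : Continuous fun q => γ q ^ s :=
    hγ2.continuous.rpow_const fun _ => Or.inr (by linarith)
  have c0 : Continuous A0 := hA0 ▸ Hypersurface.continuous_normCovDerivA hf hν 0
  have c1 : Continuous A1 := hA1 ▸ Hypersurface.continuous_normCovDerivA hf hν 1
  have c2 : Continuous A2 := hA2 ▸ Hypersurface.continuous_normCovDerivA hf hν 2
  have i0 : Integrable (fun p => A0 p ^ 6 * γ p ^ s) (Hypersurface.inducedVolume 3 f) :=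
    Hypersurface.continuous_integrable ((c0.pow 6).mul cγ)
  have i2 : Integrable (fun p => A2 p ^ 2 * γ p ^ s) (Hypersurface.inducedVolume 3 f) :=
    Hypersurface.continuous_integrable ((c2.pow 2).mul cγ)
  refine ⟨i0, Hypersurface.continuous_integrable (((c0.pow 2).mul (c1.pow 2)).mul cγ), i2,
    (Hypersurface.continuous_integrable (c0.rpow_const fun _ => Or.inr (by norm_num))).integrableOn,
    ?_⟩
  -- On an empty M the number cγ₁ may be negative, but then all integrals and N vanish; otherwise a
  -- point of M forces cγ₁ ≥ 0.
  rcases isEmpty_or_nonempty M with hM | ⟨⟨p₀⟩⟩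
  · have hN0 : N = 0 := by
      rw [hN, Hypersurface.LqNormA, Measure.eq_zero_of_isEmpty (Hypersurface.inducedVolume 3 f)]
      simp
    rw [hN0, Measure.eq_zero_of_isEmpty (Hypersurface.inducedVolume 3 f)]
    simp
  · have hκ : ∀ q, ‖Hypersurface.grad f γ q‖ ≤ cγ₁ := fun q => by
      rw [← Hypersurface.normGrad_eq hf]; exact hcγ q
    have hr6 : ∀ q, (γ q ^ (s / 6)) ^ 6 = γ q ^ s := fun q => by
      rw [Hypersurface.rpow_div_six (hγ0 q)]; congr 1; push_cast; ring
    have hpos : {q | 0 < γ q ^ (s / 6)} = {q | 0 < γ q} := by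
      ext q
      refine ⟨fun h => (hγ0 q).lt_of_ne fun h0 => ?_, fun h => Real.rpow_pos_of_pos h _⟩
      rw [Set.mem_ofPred_eq, ← h0, Real.zero_rpow (by linarith)] at h
      exact lt_irrefl _ h
    have key := hcx M f ν γ cγ₁ (fun q => γ q ^ (s / 6)) A0 A1 A2 N hf hν hγ2 hγ0 hγ1
      ((norm_nonneg _).trans (hκ p₀)) hκ rfl hA0 hA1 hA2 (by
        rw [hpos, hN, hA0]; rfl)
    simp only [hr6] at key
    simp only [add_mul (_ ^ 2) (_ ^ 6) (γ _ ^ s)]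
    rwa [integral_add i2 i0]
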